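/- **Setting.** Let $m\ge1$, $\mathbb{R}^n=\prod_{i=1}^m\mathbb{R}^{n_i}$ with the Euclidean inner product, and $X=\prod_{i=1}^mX^i$ with $X^i\subset\mathbb{R}^{n_i}$ closed and convex; $\Pi_i$ is the Euclidean projection onto $X^i$. Let $\xi$ be a random variable with values in a measurable space $\Xi$, and let $F=(F_1,\dots,F_m)$ be a random operator such that $F(\cdot,x)$ is measurable with $\mathbb{E}\|F(\xi,x)\|<\infty$ for all $x\in X$ and $F(s,\cdot)$ is continuous on $X$ for almost every $s\in\Xi$ (with respect to the law of $\xi$). Put $T(x)=\mathbb{E}[F(\xi,x)]$ and $X^*=\{x\in X:\langle T(x),y-x\rangle\ge0\ \ \forall y\in X\}$. Assume that $X^*\neq\emptyset$, that $T$ is $L$-Lipschitz on $X$ with $L>0$, and that $T$ is pseudo-monotone on $X$: $\langle T(x),z-x\rangle\ge0\Rightarrow\langle T(z),z-x\rangle\ge0$. Given $x^0\in\mathbb{R}^n$ (with $F(\cdot,x^0)$ measurable), stepsizes $\alpha_k$ with $0<\inf_k\alpha_k\le\hat\alpha:=\sup_k\alpha_k<\frac1{\sqrt6L}$ and integers $N_{k,i}\ge1$,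 define for $k\ge0$, $i\in[m]$ $$z^k_i=\Pi_i\Big[x^k_i-\tfrac{\alpha_k}{N_{k,i}}\sum_{j=1}^{N_{k,i}}F_i(\xi^k_{j,i},x^k)\Big],\qquad x^{k+1}_i=\Pi_i\Big[x^k_i-\tfrac{\alpha_k}{N_{k,i}}\sum_{j=1}^{N_{k,i}}F_i(\eta^k_{j,i},z^k)\Big].$$ All samples $\xi^k_{j,i},\eta^k_{j,i}$ are distributed as $\xi$, and either (centralized) $N_{k,i}$, $\xi^k_{j,i}$, $\eta^k_{j,i}$ do not depend on $i$ and the samples are independent over all $k$, $j$ and both steps, or (distributed) the samples are independent over all $k,i,j$ and both steps. Put $\frac1{\mathcal{N}_k}=\sum_{i=1}^m\frac1{N_{k,i}}$, $N_{k,\min}=\min_iN_{k,i}$, and assume $\sum_k\frac1{\mathcal{N}_k}<\infty$ or $\sum_k\frac1{N_{k,\min}}<\infty$. **Constants.** $C_r$ is the best constant in the Burkholder-Davis-Gundy inequality $\big\|\sup_{i\le N}\|y_i\|\big\|_{L^r}\le C_r\big\|(\sum_{i=1}^N\|y_i-y_{i-1}\|^2)^{1/2}\big\|_{L^r}$ for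 all $\mathbb{R}^d$-valued martingales with $y_0=0$ (all $d$, $N$). $c>1$ is any absolute constant with $h^2[32(1+t+h)^2+18]\le c\,h^2(1+h^2)$ for all $t\in(0,1/\sqrt6)$, $h\ge0$ (for example $c=200$). $\mathsf{A}=1$ if $m=1$ and $\mathsf{A}=2$ if $m>1$; $\mathsf{B}=2$ if $m>1$ and the sampling is distributed, and $\mathsf{B}=1$ otherwise. For $p\ge2$ and $s>0$ let $\mathsf{D}_p=2c\hat\alpha^2C_p^2s^2$, $\mathsf{B}_2=0$, and for $p\ge4$, with $\mathsf{G}=C_p\hat\alpha s$, $$\mathsf{B}_p=\sqrt{3\mathsf{B}}\,C_{p/2}\,\mathsf{G}\left[(1+L\hat\alpha)^2+(3+2L\hat\alpha)\sqrt{\mathsf{A}}\,\mathsf{G}+2\mathsf{A}\mathsf{G}^2\right].$$ For $p\ge 2$, $x^*\in X^*$ and $s\ge0$, let $V_p(x^*,s)$ denote the condition $\big\|\,\|F(\xi,x)-T(x)\|\,\big\|_{L^p}\le s(1+\|x-x^*\|)$ for all $x\in X$. **Proposition (uniform boundedness in $L^p$).** (i) Let $p=2$ or $p\ge4$, and let $V_p(x^*,s)$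 hold for some $x^*\in X^*$ and $s=\sigma(x^*)>0$. If $x^0\in X$, then $x^k-x^*\in L^p$ for all $k$. Let $k_0\ge1$ (or $k_0\geq 0$ if $x^0\in X$) and $\gamma>0$ be such that $$\beta:=\mathsf{B}_p\sqrt\gamma+\mathsf{D}_p\gamma+\mathsf{D}_p^2\gamma^2<1,\qquad\sum_{k\ge k_0}\frac1{\mathcal{N}_k}<\gamma .$$ Then $$\sup_{k\ge k_0}\big\|\|x^k-x^*\|\big\|_{L^p}^2\le\mathsf{c}_p\Big[1+\big\|\|x^{k_0}-x^*\|\big\|_{L^p}^2\Big],$$ with $\mathsf{c}_2=(1-\beta)^{-1}$ and $\mathsf{c}_p=4(1-\beta)^{-2}$ for $p\ge4$. (ii) Let $p\ge2$ and let $\sigma:X^*\to\mathbb{R}_+$ be a locally bounded measurable function such that $V_p(x^*,\sigma(x^*))$ holds for all $x^*\in X^*$, and suppose $\sigma(x^*)\le\sigma$ for all $x^*\in X^*$, where $\sigma>0$. If $x^0\in X$, then $\mathbb{E}[\mathrm{dist}(x^k,X^*)^2]<\infty$ for all $k$. Let $\phi\in(0,\frac{\sqrt5-1}2)$ and let $k_0\ge1$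 (or $k_0\ge0$ if $x^0\in X$) be such that $\sum_{k\ge k_0}\frac1{\mathcal{N}_k}\le\frac{\phi}{2c\hat\alpha^2C_2^2\sigma^2}$. Then $$\sup_{k\ge k_0}\mathbb{E}[\mathrm{dist}(x^k,X^*)^2]\le\frac{1+\mathbb{E}[\mathrm{dist}(x^{k_0},X^*)^2]}{1-\phi-\phi^2}.$$ (iii) Let $p\ge2$, and let $\sigma_{\ell,i}>0$ be such that $\|F_{\ell,i}(\xi,x)-T_{\ell,i}(x)\|_{L^p}\le\sigma_{\ell,i}$ for all $i\in[m]$, $\ell\in[n_i]$, $x\in X$; put $\sigma^2=\sum_{i,\ell}\sigma_{\ell,i}^2$. If $x^0\in X$, then $$\sup_{k\ge0}\mathbb{E}[\mathrm{dist}(x^k,X^*)^2]\le\mathrm{dist}(x^0,X^*)^2+\sum_{k=0}^\infty\frac{17\,C_2^2\hat\alpha^2\sigma^2}{N_{k,\min}}.$$ Norms and expectations of nonnegative quantities take values in $[0,\infty]$; the bounds in (i) and (ii) are trivially true when their right sides are infinite. -/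

import Mathlib

open MeasureTheory ProbabilityTheory Topology
open scoped ENNReal NNReal RealInnerProductSpace

universe u v

namespace StochExtragradient

noncomputable section

/-! ### The Burkholder-Davis-Gundy constant -/

/-- `C > 0` is admissible in the Burkholder-Davis-Gundy inequality with exponent `q`: for every
Euclidean-space valued martingale `y` with `y 0 = 0` and every horizon `N`,
`‖ sup_{i ≤ N} ‖y i‖ ‖_q ≤ C ‖ (∑_{i < N} ‖y (i+1) - y i‖²)^{1/2} ‖_q`. -/
def IsBDGConst (q C : ℝ) : Prop :=
  0 < C ∧
    ∀ (Ω : Type u) [mΩ : MeasurableSpace Ω] (μ : Measure Ω) [IsProbabilityMeasure μ]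
      (ℱ : Filtration ℕ mΩ) (d N : ℕ)
      (y : ℕ → Ω → EuclideanSpace ℝ (Fin d)),
      Martingale y ℱ μ → (∀ᵐ ω ∂μ, y 0 ω = 0) →
        eLpNorm (fun ω => ⨆ i : Fin (N + 1), ‖y i ω‖) (ENNReal.ofReal q) μ ≤
          ENNReal.ofReal C *
            eLpNorm (fun ω => √(∑ i ∈ Finset.range N, ‖y (i + 1) ω - y i ω‖ ^ 2))
              (ENNReal.ofReal q) μ

/-- The best constant `C_q` in the Burkholder-Davis-Gundy inequality. -/
def bdgConst (q : ℝ) : ℝ := sInf {C : ℝ | IsBDGConst.{u} q C}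

/-! ### The absolute constant `c` -/

/-- `c > 1` satisfies `h² (32 (1 + t + h)² + 18) ≤ c h² (1 + h²)` for all `t ∈ (0, 1/√6)` and
`h ≥ 0`. With `t = L α_k` and `h² = α_k² C_p² σ² A / 𝒩_k`, the left side is the factor by which
the noise of one iteration enters the quasi-Fejér inequality. -/
def IsNoiseConst (c : ℝ) : Prop :=
  1 < c ∧ ∀ t h : ℝ, 0 < t → t < 1 / √6 → 0 ≤ h →
    h ^ 2 * (32 * (1 + t + h) ^ 2 + 18) ≤ c * h ^ 2 * (1 + h ^ 2)

/-- Such constants exist. -/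
theorem isNoiseConst_two_hundred : IsNoiseConst 200 := by
  refine ⟨by norm_num, fun t h ht ht' hh => ?_⟩
  have h6 : (2 : ℝ) ≤ √6 := by
    rw [show (2 : ℝ) = √4 by rw [show (4 : ℝ) = 2 ^ 2 by norm_num]; simp]
    exact Real.sqrt_le_sqrt (by norm_num)
  have h1 : t ≤ 1 / 2 := ht'.le.trans (one_div_le_one_div_of_le (by norm_num) h6)
  have h2 : 32 * (1 + t + h) ^ 2 + 18 ≤ 200 * (1 + h ^ 2) := by
    nlinarith [sq_nonneg (h - 1), mul_nonneg ht.le hh, mul_nonneg (sub_nonneg.2 h1) hh,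
      mul_nonneg (sub_nonneg.2 h1) ht.le]
  nlinarith [mul_le_mul_of_nonneg_left h2 (sq_nonneg h)]

/-! ### Variational inequalities and projections -/

section VI

variable {V : Type*} [NormedAddCommGroup V] [InnerProductSpace ℝ V]

/-- The solution set of the variational inequality defined by the operator `T` and the set `X`. -/
def solutionSet (T : V → V) (X : Set V) : Set V :=
  {x | x ∈ X ∧ ∀ y ∈ X, 0 ≤ ⟪T x, y - x⟫}

/-- Euclidean projection: a point of `C` at minimal distance from `u`
(it exists and is unique if `C` is nonempty, closed and convex and `V` is complete). -/
def proj (C : Set V) (u : V) : V :=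
  Classical.epsilon fun y => y ∈ C ∧ ∀ w ∈ C, ‖u - y‖ ≤ ‖u - w‖

end VI

/-! ### The algorithm -/

/-- `ℝ^{n_1} × ⋯ × ℝ^{n_m}` with the direct (Euclidean) inner product. -/
abbrev Space {m : ℕ} (n : Fin m → ℕ) : Type := PiLp 2 fun i => EuclideanSpace ℝ (Fin (n i))

/-- The data of a Cartesian stochastic variational inequality with `m` agents together with the
input of the stochastic extragradient method. Only the samples with `j < N k i` are used. -/
structure Data {m : ℕ} (n : Fin m → ℕ) (Ω : Type u) (Ξ : Type v) where
  /-- the blocks `X^i` of the feasible set -/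
  block : (i : Fin m) → Set (EuclideanSpace ℝ (Fin (n i)))
  /-- the random operator -/
  F : Ξ → Space n → Space n
  /-- the random variable -/
  ξ : Ω → Ξ
  /-- the stepsizes -/
  α : ℕ → ℝ
  /-- the sampling rates -/
  N : ℕ → Fin m → ℕ
  /-- the samples `ξ^k_{j,i}` used in the first projection, indexed by `k`, `i`, `j` -/
  sampleξ : ℕ → Fin m → ℕ → Ω → Ξ
  /-- the samples `η^k_{j,i}` used in the second projection, indexed by `k`, `i`, `j` -/
  sampleη : ℕ → Fin m → ℕ → Ω → Ξ
  /-- the initial iterate -/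
  x₀ : Space n

/-- Coordination of the samples among the agents. -/
inductive Coordination
  | centralized
  | distributed

namespace Data

variable {m : ℕ} {n : Fin m → ℕ} {Ω : Type u} {Ξ : Type v} (D : Data n Ω Ξ)

/-- The feasible set `X = ∏ X^i`. -/
def X : Set (Space n) := {x | ∀ i, x i ∈ D.block i}

/-- One projection step with base point `x`, stepsize `α_k`, samples `s` and evaluation point `w`:
block `i` of the result is `Π_i [x_i - (α_k / N_{k,i}) ∑_j F_i(s_{j,i}, w)]`. -/
def step (k : ℕ) (s : Fin m → ℕ → Ξ) (x w : Space n) : Space n :=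
  WithLp.toLp 2 fun i =>
    proj (D.block i) (x i - (D.α k / D.N k i) • ∑ j ∈ Finset.range (D.N k i), D.F (s i j) w i)

/-- The intermediate point `z^k` as a function of `x^k`. -/
def mid (k : ℕ) (ω : Ω) (x : Space n) : Space n :=
  D.step k (fun i j => D.sampleξ k i j ω) x x

/-- The iterates `x^k` of the stochastic extragradient method. -/
def x : ℕ → Ω → Space n
  | 0, _ => D.x₀
  | k + 1, ω => D.step k (fun i j => D.sampleη k i j ω) (x k ω) (D.mid k ω (x k ω))

/-- `1 / 𝒩_k = ∑_i 1 / N_{k,i}`. -/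
def invN (k : ℕ) : ℝ := ∑ i, 1 / (D.N k i : ℝ)

/-- `N_{k,min} = min_i N_{k,i}`. -/
def Nmin (k : ℕ) : ℕ := ⨅ i, D.N k i

/-- `α̂ = sup_k α_k`. -/
def αhat : ℝ := ⨆ k, D.α k

/-- The samples of both projection steps (`true`: first projection, `false`: second). -/
def sample (b : Bool) : ℕ → Fin m → ℕ → Ω → Ξ := if b then D.sampleξ else D.sampleη

section Assumptions

variable [MeasurableSpace Ω] (P : Measure Ω)

/-- The mean operator `T(x) = 𝔼[F(ξ, x)]`. -/
def T (x : Space n) : Space n := ∫ ω, D.F (D.ξ ω) x ∂P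

/-- The solution set `X^*`. -/
def Xstar : Set (Space n) := solutionSet (D.T P) D.X

/-- Stochastic model: `X` is closed and convex, `F` is a Carathéodory map on `Ξ × X`, `ξ` is a random
variable, and `𝔼‖F(ξ, x)‖ < ∞` on `X`. The random vectors evaluated at the initial iterate (which
need not lie in `X`) are measurable as well. -/
structure StochasticModel [MeasurableSpace Ξ] : Prop where
  isClosed : ∀ i, IsClosed (D.block i)
  convex : ∀ i, Convex ℝ (D.block i)
  measurable_ξ : Measurable D.ξ
  continuousOn : ∀ᵐ s ∂(P.map D.ξ), ContinuousOn (D.F s) D.X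
  measurable_F : ∀ x ∈ D.X, Measurable fun s => D.F s x
  measurable_F_init : Measurable fun s => D.F s D.x₀
  integrable : ∀ x ∈ D.X, Integrable (fun ω => D.F (D.ξ ω) x) P

/-- The mean operator is `L`-Lipschitz continuous on `X`, `L > 0`. -/
def LipschitzMean (L : ℝ) : Prop :=
  0 < L ∧ ∀ x ∈ D.X, ∀ y ∈ D.X, ‖D.T P x - D.T P y‖ ≤ L * ‖x - y‖

/-- The mean operator is pseudo-monotone on `X`. -/
def PseudoMonotone : Prop :=
  ∀ x ∈ D.X, ∀ z ∈ D.X, 0 ≤ ⟪D.T P x, z - x⟫ → 0 ≤ ⟪D.T P z, z - x⟫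

/-- Sampling rate. -/
def SamplingRate : Prop :=
  (∀ k i, 0 < D.N k i) ∧
    (Summable D.invN ∨ Summable fun k => 1 / (D.Nmin k : ℝ))

/-- Sampling coordination. All samples are distributed as `ξ`. Centralized: the agents share the
sample sizes and the samples, and the samples (over all iterations and both steps) are independent.
Distributed: the samples over all iterations, both steps and all agents are independent. -/
structure SamplingCoordination [MeasurableSpace Ξ] (coord : Coordination) : Prop where
  measurable : ∀ b k i j, j < D.N k i → Measurable (D.sample b k i j)
  identDistrib : ∀ b k i j, j < D.N k i → IdentDistrib (D.sample b k i j) D.ξ P P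
  coordination : match coord with
    | .centralized =>
        (∀ k i i', D.N k i = D.N k i') ∧
        (∀ b k i i' j, j < D.N k i → D.sample b k i j = D.sample b k i' j) ∧
        ∀ i, iIndepFun
          (fun a : {a : Bool × ℕ × ℕ // a.2.2 < D.N a.2.1 i} =>
            D.sample a.1.1 a.1.2.1 i a.1.2.2) P
    | .distributed =>
        iIndepFun
          (fun a : {a : Bool × ℕ × Fin m × ℕ // a.2.2.2 < D.N a.2.1 a.2.2.1} =>
            D.sample a.1.1 a.1.2.1 a.1.2.2.1 a.1.2.2.2) P

/-- Stepsizes bounded away from zero: `0 < inf α_k ≤ sup α_k < 1 / (√6 L)`. -/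
def StepsizeBounds (L : ℝ) : Prop :=
  (0 < ⨅ k, D.α k) ∧ BddAbove (Set.range D.α) ∧ D.αhat < 1 / (√6 * L)

/-- `‖ ‖F(ξ, x) - T(x)‖ ‖_p ≤ s (1 + ‖x - x^*‖)` for all `x ∈ X`. -/
def VarianceBoundAt (p : ℝ) (xs : Space n) (s : ℝ) : Prop :=
  ∀ x ∈ D.X, eLpNorm (fun ω => ‖D.F (D.ξ ω) x - D.T P x‖) (ENNReal.ofReal p) P ≤
    ENNReal.ofReal (s * (1 + ‖x - xs‖))

/-- Variance control on the whole solution set, by a locally bounded measurable function. -/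
structure VarianceControlOnSolutions (p : ℝ) (s : D.Xstar P → ℝ≥0) : Prop where
  measurable : Measurable s
  locallyBounded : ∀ y, ∃ U ∈ 𝓝 y, BddAbove (s '' U)
  bound : ∀ y : D.Xstar P, D.VarianceBoundAt P p y (s y)

/-- Uniform variance control over `X`, componentwise. -/
def UniformVarianceControl (p : ℝ) (s : (i : Fin m) → Fin (n i) → ℝ) : Prop :=
  (∀ i l, 0 < s i l) ∧
    ∀ i l, ∀ x ∈ D.X,
      eLpNorm (fun ω => D.F (D.ξ ω) x i l - D.T P x i l) (ENNReal.ofReal p) P ≤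
        ENNReal.ofReal (s i l)

/-- The standing assumptions, except for the control of the variance. -/
structure Standing [MeasurableSpace Ξ] (coord : Coordination) (L : ℝ) : Prop where
  consistent : (D.Xstar P).Nonempty
  model : D.StochasticModel P
  lipschitz : D.LipschitzMean P L
  pseudoMonotone : D.PseudoMonotone P
  rate : D.SamplingRate
  coordination : D.SamplingCoordination P coord
  stepsize : D.StepsizeBounds L

/-- `𝔼[dist(x^k, X^*)²]`, as an element of `[0, ∞]`. -/
def expSqDist (k : ℕ) : ℝ≥0∞ :=
  ∫⁻ ω, ENNReal.ofReal (Metric.infDist (D.x k ω) (D.Xstar P) ^ 2) ∂P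

end Assumptions

end Data

/-! ### The constants of the bound -/

/-- `A = 1` for one agent and `A = 2` otherwise. -/
def constA (m : ℕ) : ℝ := if m = 1 then 1 else 2

/-- `B = 1` for one agent or centralized sampling, `B = 2` for several agents with distributed
sampling. -/
def constB (m : ℕ) : Coordination → ℝ
  | .centralized => 1
  | .distributed => if m = 1 then 1 else 2

/-- `D_p = 2 c α̂² C_p² σ²`. -/
def constD (p c αhat s : ℝ) : ℝ := 2 * c * αhat ^ 2 * bdgConst.{u} p ^ 2 * s ^ 2

/-- `B_2 = 0`; for `p ≠ 2`, with `G = C_p α̂ σ` and `q = p / 2`,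
`B_p = √(3 B) C_q G [(1 + L α̂)² + (3 + 2 L α̂) √A G + 2 A G²]`. -/
def constBp (p A B L αhat s : ℝ) : ℝ :=
  if p = 2 then 0 else
    let G := bdgConst.{u} p * αhat * s
    √(3 * B) * bdgConst.{u} (p / 2) * G *
      ((1 + L * αhat) ^ 2 + (3 + 2 * L * αhat) * √A * G + 2 * A * G ^ 2)

/-- `β = B_p √γ + D_p γ + D_p² γ²`. -/
def constβ (Bp Dp γ : ℝ) : ℝ := Bp * √γ + Dp * γ + Dp ^ 2 * γ ^ 2

/-- `c_2 = (1 - β)⁻¹` and `c_p = 4 (1 - β)⁻²` for `p ≠ 2`. -/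
def boundConst (p β : ℝ) : ℝ := if p = 2 then (1 - β)⁻¹ else 4 * ((1 - β) ^ 2)⁻¹

end

end StochExtragradient

/-!
# Boundedness of the iterates of the stochastic extragradient method

**One iteration.** Write `e₁`, `e₂` for the oracle errors of the two projection steps, that is, the
sample averages of the random operator minus its mean `T`. The variational characterization of
projections, pseudo-monotonicity of `T` and the stepsize bound give, for every solution `y`, the
quasi-Fejér inequality (`extragradient_step`)

  `‖x^{k+1} - y‖² ≤ ‖x^k - y‖² + 3 α² (‖e₁‖² + ‖e₂‖²) + 2 α ⟪e₂, y - z^k⟫`,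

and `‖z^k - y‖` is bounded by `‖x^k - y‖` and `‖e₁‖` (`norm_mid_sub_le`).

**Moments of the errors.** Given the past, an oracle error is a sum of independent centered terms.
The Burkholder-Davis-Gundy inequality, applied to the samples one at a time
(`eLpNorm_sum_le_bdgConst`, `Data.Regular.eLpNorm_err_le`), bounds its `L^p` norm by
`C_p s √(∑ 1/N) ‖1 + ‖x - y‖‖_p`. The centralized and the distributed sampling are treated together:
agents that share their samples form a group, with one representative, and only the samples of the
representatives are counted. That the best constant `C_p` is itself admissible requires that some
constant is, so the inequality is proved here for exponents `q ≥ 2` (`exists_isBDGConst`). The proof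
is pathwise: a deterministic inequality bounds the `q`-th power of the maximum of a sequence by that
of its quadratic variation up to a discrete stochastic integral, and the latter has mean zero.

**Mean square.** For `p = 2` the term `⟪e₂, y - z^k⟫` has mean zero, also if `y` is replaced by the
solution nearest to `x^k`, which depends on the past only. This gives a recursion
`δ_{k+1}² ≤ δ_k² + w_k (1 + δ_k²)` with summable `w_k`, whose solution is bounded
(`sq_le_of_recursion`); it covers the bounds at one solution (`Data.Admissible.two_bound`) and those
of the distance to the solution set (`Data.Admissible.dist_bound`). The nearest solution exists
since the solution set is closed and, by Minty's lemma, convex. If the variance is uniformly bounded,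
the increments `w_k` enter without the factor `1 + δ_k²` (`Data.Admissible.expSqDist_le_of_uniform`).

**Higher moments.** For `p ≥ 4` the inequality is summed over the iterations and taken in `L^{p/2}`.
The martingale `∑ 2 α ⟪e₂, y - z^k⟫` is estimated by the Burkholder-Davis-Gundy inequality with
exponent `p/2`, over all samples of all iterations at once
(`Data.Admissible.eLpNorm_sum_inner_le`). With `M` the largest of the `L^p` distances up to some
iteration this yields `M² ≤ δ² + β (1 + M + M²)`, hence the claim (`Data.Admissible.four_bound`).
Two facts make the constants fit: `√3 C_p ≥ 2` (`two_le_sqrt_three_mul_bdgConst`), and, in the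
distributed case, the smallness of the noise of a single iteration that follows from `β < 1` and the
size of `c` (`noise_const_ge`).

**Null sets.** The random operator is continuous in the second variable for almost every value of
the first one only. Setting it to zero at the exceptional values changes the iterates on a null set
only (`Data.Standing.exists_admissible`).
-/

/-! ### The Burkholder-Davis-Gundy inequality for exponents at least two -/

namespace StochExtragradient

section Pathwise

variable {E : Type*} [NormedAddCommGroup E] [InnerProductSpace ℝ E]

/-- A weighted Young inequality with a constant that is not optimal: it suffices to compare `y` with
`δ * x`. -/
theorem rpow_sub_one_mul_le {q δ x y : ℝ} (hq : 1 ≤ q) (hδ : 0 < δ) (hx : 0 ≤ x) (hy : 0 ≤ y) :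
    x ^ (q - 1) * y ≤ δ * x ^ q + (δ⁻¹) ^ (q - 1) * y ^ q := by
  have hxq : x ^ q = x ^ (q - 1) * x := by
    conv_lhs => rw [show q = (q - 1) + 1 by ring]
    rw [Real.rpow_add_of_nonneg hx (by linarith) zero_le_one, Real.rpow_one]
  have hyq : y ^ q = y ^ (q - 1) * y := by
    conv_lhs => rw [show q = (q - 1) + 1 by ring]
    rw [Real.rpow_add_of_nonneg hy (by linarith) zero_le_one, Real.rpow_one]
  have h1 : 0 ≤ x ^ (q - 1) := Real.rpow_nonneg hx _
  rcases le_total y (δ * x) with h | h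
  · have : x ^ (q - 1) * y ≤ δ * x ^ q := by
      rw [hxq]; nlinarith [mul_le_mul_of_nonneg_left h h1]
    have : 0 ≤ (δ⁻¹) ^ (q - 1) * y ^ q := by positivity
    linarith
  · have hx' : x ≤ δ⁻¹ * y := by
      rw [inv_mul_eq_div, le_div_iff₀ hδ]; linarith
    have h2 : x ^ (q - 1) ≤ (δ⁻¹) ^ (q - 1) * y ^ (q - 1) := by
      rw [← Real.mul_rpow (by positivity) hy]
      exact Real.rpow_le_rpow hx hx' (by linarith)
    have h3 : x ^ (q - 1) * y ≤ (δ⁻¹) ^ (q - 1) * y ^ q := by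
      rw [hyq, ← mul_assoc]; exact mul_le_mul_of_nonneg_right h2 hy
    have : 0 ≤ δ * x ^ q := by positivity
    linarith

theorem rpow_eq_rpow_sub_two_mul_sq {q x : ℝ} (hq : 2 ≤ q) (hx : 0 ≤ x) :
    x ^ q = x ^ (q - 2) * x ^ 2 := by
  conv_lhs => rw [show q = (q - 2) + 2 by ring]
  rw [Real.rpow_add_of_nonneg hx (by linarith) zero_le_two, Real.rpow_two]

/-- The analogue of `rpow_sub_one_mul_le` for the product of `x ^ (q - 2)` and `y ^ 2`. -/
theorem rpow_sub_two_mul_sq_le {q δ x y : ℝ} (hq : 2 ≤ q) (hδ : 0 < δ) (hx : 0 ≤ x) (hy : 0 ≤ y) :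
    x ^ (q - 2) * y ^ 2 ≤ δ ^ 2 * x ^ q + (δ⁻¹) ^ (q - 2) * y ^ q := by
  have hxq := rpow_eq_rpow_sub_two_mul_sq hq hx
  have hyq := rpow_eq_rpow_sub_two_mul_sq hq hy
  have h1 : 0 ≤ x ^ (q - 2) := Real.rpow_nonneg hx _
  rcases le_total y (δ * x) with h | h
  · have h4 : y ^ 2 ≤ δ ^ 2 * x ^ 2 := by rw [← mul_pow]; exact pow_le_pow_left₀ hy h 2
    have : x ^ (q - 2) * y ^ 2 ≤ δ ^ 2 * x ^ q := by
      rw [hxq]; nlinarith [mul_le_mul_of_nonneg_left h4 h1]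
    have : 0 ≤ (δ⁻¹) ^ (q - 2) * y ^ q := by positivity
    linarith
  · have hx' : x ≤ δ⁻¹ * y := by
      rw [inv_mul_eq_div, le_div_iff₀ hδ]; linarith
    have h2 : x ^ (q - 2) ≤ (δ⁻¹) ^ (q - 2) * y ^ (q - 2) := by
      rw [← Real.mul_rpow (by positivity) hy]
      exact Real.rpow_le_rpow hx hx' (by linarith)
    have h3 : x ^ (q - 2) * y ^ 2 ≤ (δ⁻¹) ^ (q - 2) * y ^ q := by
      rw [hyq, ← mul_assoc]; exact mul_le_mul_of_nonneg_right h2 (by positivity)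
    have : 0 ≤ δ ^ 2 * x ^ q := by positivity
    linarith

/-- The tangent inequality of the convex function `x ↦ x ^ q` on the half-line. -/
theorem rpow_tangent_le {q x y : ℝ} (hq : 1 ≤ q) (hx : 0 ≤ x) (hy : 0 ≤ y) :
    q * (y ^ (q - 1) * x) ≤ x ^ q + (q - 1) * y ^ q := by
  rcases hy.eq_or_lt with rfl | hy
  · rcases hq.eq_or_lt with rfl | hq
    · simp
    · rw [Real.zero_rpow (by linarith), Real.zero_rpow (by linarith)]
      simp only [zero_mul, mul_zero, add_zero]
      positivity
  · have h := one_add_mul_self_le_rpow_one_add (s := x / y - 1)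
      (by have : 0 ≤ x / y := by positivity
          linarith) hq
    rw [show 1 + (x / y - 1) = x / y by ring, Real.div_rpow hx hy.le,
      le_div_iff₀ (by positivity)] at h
    have : y ^ q = y ^ (q - 1) * y := by
      conv_lhs => rw [show q = (q - 1) + 1 by ring]
      rw [Real.rpow_add_of_nonneg hy.le (by linarith) zero_le_one, Real.rpow_one]
    have h2 : (1 + q * (x / y - 1)) * y ^ q = y ^ q + q * (y ^ (q - 1) * x) - q * y ^ q := by
      have : x / y * y ^ q = y ^ (q - 1) * x := by rw [this]; field_simp
      linear_combination q * this
    linarith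

/-- A Lipschitz estimate for `x ↦ x ^ s`, multiplied by `max x y` so that it also holds for
`s < 1`. -/
theorem abs_rpow_sub_rpow_mul_max_le {s x y : ℝ} (hs : 0 ≤ s) (hx : 0 ≤ x) (hy : 0 ≤ y) :
    |x ^ s - y ^ s| * max x y ≤ (s + 1) * max x y ^ s * |x - y| := by
  wlog h : y ≤ x generalizing x y
  · have := this hy hx (le_of_not_ge h)
    rwa [abs_sub_comm, max_comm, abs_sub_comm x y]
  rw [max_eq_left h, abs_of_nonneg (sub_nonneg.2 (Real.rpow_le_rpow hy h hs)),
    abs_of_nonneg (sub_nonneg.2 h)]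
  rcases hx.eq_or_lt with rfl | hx
  · have : y = 0 := le_antisymm h hy
    subst this; simp
  · set t := y / x with ht
    have hyt : y = t * x := by rw [ht]; field_simp
    have ht0 : 0 ≤ t := by positivity
    have ht1 : t ≤ 1 := (div_le_one hx).2 h
    have key : 1 - t ^ s ≤ (s + 1) * (1 - t) := by
      rcases le_total 1 s with h1 | h1
      · have := one_add_mul_self_le_rpow_one_add (s := t - 1) (by linarith) h1
        rw [show 1 + (t - 1) = t by ring] at this
        nlinarith
      · have : t ≤ t ^ s := by
          rcases ht0.eq_or_lt with h0 | h0
          · rw [← h0]; exact Real.rpow_nonneg le_rfl _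
          · simpa using Real.rpow_le_rpow_of_exponent_ge h0 ht1 h1
        nlinarith
    rw [hyt, Real.mul_rpow ht0 hx.le]
    have : 0 ≤ x ^ s * x := by positivity
    nlinarith [mul_le_mul_of_nonneg_left key this]

/-- Second order expansion of the `q`-th power of the norm. -/
theorem norm_add_rpow_le {q : ℝ} (hq : 2 ≤ q) (a d : E) :
    ‖a + d‖ ^ q ≤ ‖a‖ ^ q + q * (‖a‖ ^ (q - 2) * ⟪a, d⟫) +
      q * q * 2 ^ q * (‖a‖ ^ (q - 2) * ‖d‖ ^ 2 + ‖d‖ ^ q) := by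
  set x := ‖a + d‖ with hx
  set y := ‖a‖ with hy
  have hx0 : 0 ≤ x := norm_nonneg _
  have hy0 : 0 ≤ y := norm_nonneg _
  have hd0 : 0 ≤ ‖d‖ := norm_nonneg _
  have hxy : |x - y| ≤ ‖d‖ := by
    have := abs_norm_sub_norm_le (a + d) a
    simpa using this
  have hin : ⟪a + d, d⟫ = ⟪a, d⟫ + ‖d‖ ^ 2 := by
    rw [inner_add_left, real_inner_self_eq_norm_sq]
  -- the gradient inequality at `a + d`
  have h1 : x ^ q ≤ y ^ q + q * (x ^ (q - 2) * ⟪a + d, d⟫) := by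
    have ht := rpow_tangent_le (q := q) (x := y) (y := x) (by linarith) hy0 hx0
    have hxq := rpow_eq_rpow_sub_two_mul_sq hq hx0
    have hxq1 : x ^ (q - 1) = x ^ (q - 2) * x := by
      conv_lhs => rw [show q - 1 = (q - 2) + 1 by ring]
      rw [Real.rpow_add_of_nonneg hx0 (by linarith) zero_le_one, Real.rpow_one]
    have hc : x ^ 2 - x * y ≤ ⟪a + d, d⟫ := by
      have e : ⟪a + d, d⟫ = x ^ 2 - ⟪a + d, a⟫ := by
        rw [hx, ← real_inner_self_eq_norm_sq, ← inner_sub_right, add_sub_cancel_left]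
      have := real_inner_le_norm (a + d) a
      rw [e]; linarith
    have h0 : 0 ≤ x ^ (q - 2) := Real.rpow_nonneg hx0 _
    have := mul_le_mul_of_nonneg_left hc (mul_nonneg (by linarith : 0 ≤ q) h0)
    rw [hxq1] at ht
    nlinarith
  -- replacing the factor `‖a + d‖ ^ (q - 2)` by `‖a‖ ^ (q - 2)` costs a term of second order
  have h2 : (x ^ (q - 2) - y ^ (q - 2)) * ⟪a + d, d⟫ ≤
      ((q - 2) + 1) * max x y ^ (q - 2) * ‖d‖ ^ 2 := by
    calc (x ^ (q - 2) - y ^ (q - 2)) * ⟪a + d, d⟫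
        ≤ |x ^ (q - 2) - y ^ (q - 2)| * |⟪a + d, d⟫| := by rw [← abs_mul]; exact le_abs_self _
      _ ≤ |x ^ (q - 2) - y ^ (q - 2)| * (max x y * ‖d‖) := by
          gcongr
          exact (abs_real_inner_le_norm _ _).trans
            (mul_le_mul_of_nonneg_right (le_max_left _ _) hd0)
      _ = (|x ^ (q - 2) - y ^ (q - 2)| * max x y) * ‖d‖ := by ring
      _ ≤ (((q - 2) + 1) * max x y ^ (q - 2) * |x - y|) * ‖d‖ := by
          exact mul_le_mul_of_nonneg_right
            (abs_rpow_sub_rpow_mul_max_le (s := q - 2) (by linarith) hx0 hy0) hd0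
      _ ≤ (((q - 2) + 1) * max x y ^ (q - 2) * ‖d‖) * ‖d‖ := by
          have : 0 ≤ max x y := le_max_of_le_left hx0
          have : 0 ≤ (q - 2) + 1 := by linarith
          gcongr
      _ = _ := by ring
  have h3 : max x y ^ (q - 2) * ‖d‖ ^ 2 ≤ 2 ^ (q - 2) * (y ^ (q - 2) * ‖d‖ ^ 2 + ‖d‖ ^ q) := by
    have hm : max x y ≤ y + ‖d‖ := max_le (by have := abs_le.1 hxy; linarith) (by linarith)
    have hb : max x y ^ (q - 2) ≤ (2 : ℝ) ^ (q - 2) * (max y ‖d‖) ^ (q - 2) := by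
      rw [← Real.mul_rpow zero_le_two (le_max_of_le_left hy0)]
      refine Real.rpow_le_rpow (le_max_of_le_left hx0) (hm.trans ?_) (by linarith)
      have := le_max_left y ‖d‖
      have := le_max_right y ‖d‖
      linarith
    rw [rpow_eq_rpow_sub_two_mul_sq hq hd0, ← add_mul, ← mul_assoc]
    refine mul_le_mul_of_nonneg_right (hb.trans ?_) (by positivity)
    refine mul_le_mul_of_nonneg_left ?_ (by positivity)
    rcases le_total y ‖d‖ with h | h
    · rw [max_eq_right h]; exact le_add_of_nonneg_left (by positivity)
    · rw [max_eq_left h]; exact le_add_of_nonneg_right (by positivity)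
  have h4 : (2 : ℝ) ^ q = 2 ^ (q - 2) * 2 ^ 2 := rpow_eq_rpow_sub_two_mul_sq hq zero_le_two
  have h5 : (1 : ℝ) ≤ 2 ^ (q - 2) := Real.one_le_rpow (by norm_num) (by linarith)
  have h6 : 0 ≤ y ^ (q - 2) * ‖d‖ ^ 2 := by positivity
  have h7 : 0 ≤ ‖d‖ ^ q := by positivity
  have h8 : q * (x ^ (q - 2) * ⟪a + d, d⟫) ≤ q * (y ^ (q - 2) * ⟪a, d⟫) +
      q * (y ^ (q - 2) * ‖d‖ ^ 2 +
        ((q - 2) + 1) * (2 ^ (q - 2) * (y ^ (q - 2) * ‖d‖ ^ 2 + ‖d‖ ^ q))) := by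
    rw [← mul_add]
    refine mul_le_mul_of_nonneg_left ?_ (by linarith)
    have := mul_le_mul_of_nonneg_left h3 (by linarith : 0 ≤ (q - 2) + 1)
    have e : x ^ (q - 2) * ⟪a + d, d⟫ = (x ^ (q - 2) - y ^ (q - 2)) * ⟪a + d, d⟫ +
      (y ^ (q - 2) * ⟪a, d⟫ + y ^ (q - 2) * ‖d‖ ^ 2) := by
      conv_rhs => rw [sub_mul]
      conv_lhs => rw [hin]
      rw [hin]; ring
    rw [e]; linarith
  have h9 : y ^ (q - 2) * ‖d‖ ^ 2 +
        ((q - 2) + 1) * (2 ^ (q - 2) * (y ^ (q - 2) * ‖d‖ ^ 2 + ‖d‖ ^ q)) ≤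
      q * 2 ^ q * (y ^ (q - 2) * ‖d‖ ^ 2 + ‖d‖ ^ q) := by
    rw [h4]
    set K := (2 : ℝ) ^ (q - 2)
    set U := y ^ (q - 2) * ‖d‖ ^ 2
    set W := ‖d‖ ^ q
    have hU : U ≤ K * (U + W) := by nlinarith
    have : 0 ≤ K * (U + W) := by positivity
    nlinarith
  have := mul_le_mul_of_nonneg_left h9 (by linarith : 0 ≤ q)
  nlinarith

end Pathwise
end StochExtragradient

namespace StochExtragradient

section Pathwise

variable {E : Type*} [NormedAddCommGroup E] [InnerProductSpace ℝ E]

/-- A pathwise form of Doob's maximal inequality: the last sum is a discrete stochastic integral,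
which has mean zero along a martingale. -/
theorem partialSups_rpow_le {q : ℝ} (hq : 2 ≤ q) (y : ℕ → E) (h0 : y 0 = 0) (N : ℕ) :
    (q - 1) * partialSups (fun i => ‖y i‖) N ^ q ≤
      q * (partialSups (fun i => ‖y i‖) N ^ (q - 1) * ‖y N‖) -
        q * ∑ k ∈ Finset.range N,
          ⟪(partialSups (fun i => ‖y i‖) k ^ (q - 1) * ‖y k‖⁻¹) • y k, y (k + 1) - y k⟫ := by
  set M := fun k => partialSups (fun i => ‖y i‖) k with hM
  have hM0 : ∀ k, 0 ≤ M k := fun k =>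
    (norm_nonneg (y 0)).trans (le_partialSups_of_le (fun i => ‖y i‖) (Nat.zero_le k))
  induction N with
  | zero => simp [h0]; rw [Real.zero_rpow (by linarith)]; simp
  | succ N ih =>
    rw [Finset.sum_range_succ]
    have hin : ⟪(M N ^ (q - 1) * ‖y N‖⁻¹) • y N, y (N + 1) - y N⟫ ≤
        M N ^ (q - 1) * (‖y (N + 1)‖ - ‖y N‖) := by
      rw [real_inner_smul_left, mul_assoc]
      refine mul_le_mul_of_nonneg_left ?_ (Real.rpow_nonneg (hM0 N) _)
      rcases eq_or_ne (y N) 0 with h | h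
      · simp [h]
      · rw [inner_sub_right, real_inner_self_eq_norm_sq, inv_mul_le_iff₀ (norm_pos_iff.2 h)]
        have := real_inner_le_norm (y N) (y (N + 1))
        nlinarith
    have hstep : (q - 1) * M (N + 1) ^ q - q * (M (N + 1) ^ (q - 1) * ‖y (N + 1)‖) ≤
        (q - 1) * M N ^ q - q * (M N ^ (q - 1) * ‖y (N + 1)‖) := by
      have hs : M (N + 1) = M N ⊔ ‖y (N + 1)‖ := partialSups_succ _ _
      rcases le_total ‖y (N + 1)‖ (M N) with h | h
      · rw [hs, sup_eq_left.2 h]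
      · rw [hs, sup_eq_right.2 h]
        have ht := rpow_tangent_le (q := q) (by linarith) (norm_nonneg (y (N + 1))) (hM0 N)
        have e : ‖y (N + 1)‖ ^ q = ‖y (N + 1)‖ ^ (q - 1) * ‖y (N + 1)‖ := by
          conv_lhs => rw [show q = (q - 1) + 1 by ring]
          rw [Real.rpow_add_of_nonneg (norm_nonneg _) (by linarith) zero_le_one, Real.rpow_one]
        rw [← e]
        linarith
    have := mul_le_mul_of_nonneg_left hin (by linarith : 0 ≤ q)
    change (q - 1) * M (N + 1) ^ q ≤ q * (M (N + 1) ^ (q - 1) * ‖y (N + 1)‖) -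
      q * (∑ k ∈ Finset.range N, ⟪(M k ^ (q - 1) * ‖y k‖⁻¹) • y k, y (k + 1) - y k⟫ +
        ⟪(M N ^ (q - 1) * ‖y N‖⁻¹) • y N, y (N + 1) - y N⟫)
    change (q - 1) * M N ^ q ≤ q * (M N ^ (q - 1) * ‖y N‖) -
      q * ∑ k ∈ Finset.range N, ⟪(M k ^ (q - 1) * ‖y k‖⁻¹) • y k, y (k + 1) - y k⟫ at ih
    linarith

theorem sum_norm_rpow_le {E : Type*} [NormedAddCommGroup E] {q : ℝ} (hq : 2 ≤ q) (d : ℕ → E)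
    (N : ℕ) :
    ∑ k ∈ Finset.range N, ‖d k‖ ^ q ≤ √(∑ k ∈ Finset.range N, ‖d k‖ ^ 2) ^ q := by
  set S := √(∑ k ∈ Finset.range N, ‖d k‖ ^ 2)
  have hS : S ^ 2 = ∑ k ∈ Finset.range N, ‖d k‖ ^ 2 :=
    Real.sq_sqrt (Finset.sum_nonneg fun _ _ => by positivity)
  have hS0 : 0 ≤ S := Real.sqrt_nonneg _
  rw [rpow_eq_rpow_sub_two_mul_sq hq hS0, hS, Finset.mul_sum]
  refine Finset.sum_le_sum fun k hk => ?_
  rw [rpow_eq_rpow_sub_two_mul_sq hq (norm_nonneg _)]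
  refine mul_le_mul_of_nonneg_right ?_ (by positivity)
  refine Real.rpow_le_rpow (norm_nonneg _) ?_ (by linarith)
  refine Real.le_sqrt_of_sq_le ?_
  exact Finset.single_le_sum (f := fun k => ‖d k‖ ^ 2) (fun _ _ => by positivity) hk

/-- Pathwise Burkholder-Davis-Gundy inequality: up to a discrete stochastic integral, the maximum of
a sequence is controlled by its quadratic variation. -/
theorem exists_pathwise_bdg {q : ℝ} (hq : 2 ≤ q) :
    ∃ K c₁ c₂ : ℝ, 0 < K ∧ ∀ (E : Type) [NormedAddCommGroup E] [InnerProductSpace ℝ E]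
      (y : ℕ → E) (_ : y 0 = 0) (N : ℕ),
      partialSups (fun i => ‖y i‖) N ^ q ≤
        K * √(∑ k ∈ Finset.range N, ‖y (k + 1) - y k‖ ^ 2) ^ q +
          ∑ k ∈ Finset.range N,
            ⟪(c₁ * partialSups (fun i => ‖y i‖) k ^ (q - 1) * ‖y k‖⁻¹ + c₂ * ‖y k‖ ^ (q - 2)) • y k,
              y (k + 1) - y k⟫ := by
  -- `K₁` is the constant of the maximal inequality, `C` that of the second order expansion; `δ` is
  -- so small that the term `M ^ q` that the expansion produces can be absorbed
  set K₁ : ℝ := q * ((1 / (2 * q))⁻¹) ^ (q - 1) with hK₁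
  set C : ℝ := q * q * 2 ^ q with hC
  have hK₁0 : 0 < K₁ := by positivity
  have hC0 : 0 < C := by positivity
  set δ : ℝ := (4 * K₁ * C + 1)⁻¹ with hδ
  have hδ0 : 0 < δ := by positivity
  set K₃ : ℝ := (δ⁻¹) ^ (q - 2) with hK₃
  have hK₃0 : 0 < K₃ := by positivity
  refine ⟨4 * K₁ * C * (K₃ + 1), -4 * q, 4 * K₁ * q, by positivity, ?_⟩
  intro E _ _ y h0 N
  have hA := partialSups_rpow_le hq y h0 N
  set M := fun k => partialSups (fun i => ‖y i‖) k with hM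
  have hM0 : ∀ k, 0 ≤ M k := fun k =>
    (norm_nonneg (y 0)).trans (le_partialSups_of_le (fun i => ‖y i‖) (Nat.zero_le k))
  change (q - 1) * M N ^ q ≤ q * (M N ^ (q - 1) * ‖y N‖) -
      q * ∑ k ∈ Finset.range N, ⟪(M k ^ (q - 1) * ‖y k‖⁻¹) • y k, y (k + 1) - y k⟫ at hA
  change M N ^ q ≤ _ + ∑ k ∈ Finset.range N,
    ⟪(-4 * q * M k ^ (q - 1) * ‖y k‖⁻¹ + 4 * K₁ * q * ‖y k‖ ^ (q - 2)) • y k, y (k + 1) - y k⟫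
  set S := √(∑ k ∈ Finset.range N, ‖y (k + 1) - y k‖ ^ 2) with hS
  have hS0 : 0 ≤ S := Real.sqrt_nonneg _
  have hSsq : S ^ 2 = ∑ k ∈ Finset.range N, ‖y (k + 1) - y k‖ ^ 2 :=
    Real.sq_sqrt (Finset.sum_nonneg fun _ _ => by positivity)
  set σ₁ := ∑ k ∈ Finset.range N, ⟪(M k ^ (q - 1) * ‖y k‖⁻¹) • y k, y (k + 1) - y k⟫ with hσ₁
  set σ₂ := ∑ k ∈ Finset.range N, ‖y k‖ ^ (q - 2) * ⟪y k, y (k + 1) - y k⟫ with hσ₂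
  have hsum : ∑ k ∈ Finset.range N,
      ⟪(-4 * q * M k ^ (q - 1) * ‖y k‖⁻¹ + 4 * K₁ * q * ‖y k‖ ^ (q - 2)) • y k,
        y (k + 1) - y k⟫ = -4 * q * σ₁ + 4 * K₁ * q * σ₂ := by
    rw [hσ₁, hσ₂, Finset.mul_sum, Finset.mul_sum, ← Finset.sum_add_distrib]
    refine Finset.sum_congr rfl fun k _ => ?_
    rw [real_inner_smul_left, real_inner_smul_left]; ring
  rw [hsum]
  -- summing the second order expansions along the path
  have hX : ‖y N‖ ^ q ≤ q * σ₂ + C * (M N ^ (q - 2) * S ^ 2 + S ^ q) := by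
    have hT : ∀ n ≤ N, ‖y n‖ ^ q ≤ ∑ k ∈ Finset.range n,
        (q * (‖y k‖ ^ (q - 2) * ⟪y k, y (k + 1) - y k⟫) +
          C * (‖y k‖ ^ (q - 2) * ‖y (k + 1) - y k‖ ^ 2 + ‖y (k + 1) - y k‖ ^ q)) := by
      intro n
      induction n with
      | zero => intro _; simp [h0]; rw [Real.zero_rpow (by linarith)]
      | succ n ih =>
        intro hn
        have h1 := norm_add_rpow_le hq (y n) (y (n + 1) - y n)
        rw [add_sub_cancel] at h1
        rw [Finset.sum_range_succ]
        have := ih (by omega)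
        linarith
    refine (hT N le_rfl).trans ?_
    rw [Finset.sum_add_distrib, ← Finset.mul_sum, ← Finset.mul_sum, Finset.sum_add_distrib]
    have h2 : ∑ k ∈ Finset.range N, ‖y k‖ ^ (q - 2) * ‖y (k + 1) - y k‖ ^ 2 ≤
        M N ^ (q - 2) * S ^ 2 := by
      rw [hSsq, Finset.mul_sum]
      refine Finset.sum_le_sum fun k hk => ?_
      refine mul_le_mul_of_nonneg_right ?_ (by positivity)
      refine Real.rpow_le_rpow (norm_nonneg _) ?_ (by linarith)
      exact le_partialSups_of_le (fun i => ‖y i‖) (Finset.mem_range.1 hk).le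
    have h3 := sum_norm_rpow_le hq (fun k => y (k + 1) - y k) N
    have := mul_le_mul_of_nonneg_left (add_le_add h2 h3) hC0.le
    linarith
  -- Young's inequality for the mixed terms of both inequalities
  have hY1 := rpow_sub_one_mul_le (q := q) (δ := 1 / (2 * q)) (by linarith) (by positivity)
    (hM0 N) (norm_nonneg (y N))
  have hY2 := rpow_sub_two_mul_sq_le (q := q) hq hδ0 (hM0 N) hS0
  have hMq : 0 ≤ M N ^ q := Real.rpow_nonneg (hM0 N) _
  have hB : M N ^ q ≤ 2 * K₁ * ‖y N‖ ^ q - 2 * q * σ₁ := by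
    have := mul_le_mul_of_nonneg_left hY1 (by linarith : 0 ≤ q)
    have e : q * (1 / (2 * q) * M N ^ q + ((1 / (2 * q))⁻¹) ^ (q - 1) * ‖y N‖ ^ q) =
      M N ^ q / 2 + K₁ * ‖y N‖ ^ q := by
      rw [hK₁]; field_simp
    rw [e] at this
    nlinarith
  have hδ2 : 4 * K₁ * C * δ ^ 2 ≤ 1 := by
    have h1 : 4 * K₁ * C * δ ≤ 1 := by
      rw [hδ, mul_inv_le_iff₀ (by positivity)]; linarith
    have h2 : δ ≤ 1 := inv_le_one_of_one_le₀ (by nlinarith [mul_pos hK₁0 hC0])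
    nlinarith
  have h5 := mul_le_mul_of_nonneg_left hX (by positivity : 0 ≤ 2 * K₁)
  have h6 := mul_le_mul_of_nonneg_left hY2 (by positivity : 0 ≤ 2 * K₁ * C)
  have h7 := mul_le_mul_of_nonneg_right hδ2 hMq
  have h8 : 2 * K₁ * C * (M N ^ (q - 2) * S ^ 2) ≤
    M N ^ q / 2 + 2 * K₁ * C * (K₃ * S ^ q) := by
    rw [hK₃]; linarith
  linarith

end Pathwise

section Expectation

variable {Ω : Type*} {mΩ : MeasurableSpace Ω} {μ : Measure Ω} [IsProbabilityMeasure μ]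

theorem integral_inner_eq_zero_of_condExp_eq_zero {E : Type*} [NormedAddCommGroup E]
    [InnerProductSpace ℝ E] [CompleteSpace E] {m : MeasurableSpace Ω} (hm : m ≤ mΩ) {f g : Ω → E}
    (hf : StronglyMeasurable[m] f) (hg : Integrable g μ)
    (hfg : Integrable (fun ω => ⟪f ω, g ω⟫) μ) (h0 : μ[g | m] =ᵐ[μ] 0) :
    ∫ ω, ⟪f ω, g ω⟫ ∂μ = 0 := by
  rw [← integral_condExp hm]
  have h : μ[fun ω => ⟪f ω, g ω⟫ | m] =ᵐ[μ] fun ω => ⟪f ω, (μ[g | m]) ω⟫ :=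
    condExp_bilin_of_stronglyMeasurable_left (μ := μ) (innerSL ℝ) hf hfg hg
  rw [integral_congr_ae h]
  rw [integral_congr_ae (g := 0)]
  · simp
  · filter_upwards [h0] with ω hω
    simp [hω]

/-- The Burkholder-Davis-Gundy inequality holds with some constant: the stochastic integral in the
pathwise inequality has mean zero. -/
theorem exists_isBDGConst {q : ℝ} (hq : 2 ≤ q) : ∃ C, IsBDGConst.{u} q C := by
  obtain ⟨K, c₁, c₂, hK, hpath⟩ := exists_pathwise_bdg hq
  refine ⟨K ^ (1 / q), by positivity, ?_⟩
  intro Ω mΩ μ _ ℱ d N y hy h0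
  set S : Ω → ℝ := fun ω => √(∑ i ∈ Finset.range N, ‖y (i + 1) ω - y i ω‖ ^ 2) with hS
  set M : ℕ → Ω → ℝ := fun k ω => partialSups (fun i => ‖y i ω‖) k with hM
  have hq0 : ENNReal.ofReal q ≠ 0 := by simp; linarith
  have hqt : ENNReal.ofReal q ≠ ∞ := ENNReal.ofReal_ne_top
  have hqr : (ENNReal.ofReal q).toReal = q := ENNReal.toReal_ofReal (by linarith)
  have hym : ∀ i, AEStronglyMeasurable (y i) μ := fun i => (hy.integrable i).1
  have hSm : AEStronglyMeasurable S μ := by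
    refine (Finset.aemeasurable_fun_sum _ fun i _ => ?_).sqrt.aestronglyMeasurable
    exact ((hym (i + 1)).sub (hym i)).norm.aemeasurable.pow_const 2
  -- if the quadratic variation is not in `L^q`, the right side is infinite
  by_cases hfin : MemLp S (ENNReal.ofReal q) μ
  swap
  · have : eLpNorm S (ENNReal.ofReal q) μ = ∞ := by
      by_contra h
      exact hfin ⟨hSm, lt_top_iff_ne_top.2 h⟩
    rw [this, ENNReal.mul_top (by simp; positivity)]
    exact le_top
  have hdL : ∀ i < N, MemLp (fun ω => y (i + 1) ω - y i ω) (ENNReal.ofReal q) μ := by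
    intro i hi
    refine hfin.mono ((hym (i + 1)).sub (hym i)) (ae_of_all _ fun ω => ?_)
    rw [Real.norm_of_nonneg (Real.sqrt_nonneg _)]
    refine Real.le_sqrt_of_sq_le ?_
    exact Finset.single_le_sum (f := fun i => ‖y (i + 1) ω - y i ω‖ ^ 2)
      (fun _ _ => by positivity) (Finset.mem_range.2 hi)
  have hyL : ∀ i ≤ N, MemLp (y i) (ENNReal.ofReal q) μ := by
    intro i
    induction i with
    | zero => intro _; exact (MemLp.zero' (ε := EuclideanSpace ℝ (Fin d))).ae_eq
                (h0.mono fun ω h => by simp [h])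
    | succ i ih =>
      intro hi
      have := (ih (by omega)).add (hdL i (by omega))
      refine this.ae_eq (ae_of_all _ fun ω => ?_)
      simp
  have hM0 : ∀ k ω, 0 ≤ M k ω := fun k ω =>
    (norm_nonneg (y 0 ω)).trans (le_partialSups_of_le (fun i => ‖y i ω‖) (Nat.zero_le k))
  have hMsucc : ∀ k, M (k + 1) = fun ω => M k ω ⊔ ‖y (k + 1) ω‖ := fun k => by
    funext ω; exact partialSups_succ _ _
  have hMzero : M 0 = fun ω => ‖y 0 ω‖ := by funext ω; simp [hM]
  have hMsm : ∀ k, StronglyMeasurable[ℱ k] (M k) := by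
    intro k
    induction k with
    | zero => rw [hMzero]; exact (hy.stronglyAdapted 0).norm
    | succ k ih =>
      rw [hMsucc]
      have h1 : StronglyMeasurable[ℱ (k + 1)] (M k) := ih.mono (ℱ.mono (Nat.le_succ k))
      have h2 : StronglyMeasurable[ℱ (k + 1)] fun ω => ‖y (k + 1) ω‖ :=
        (hy.stronglyAdapted (k + 1)).norm
      exact (h1.measurable.sup h2.measurable).stronglyMeasurable
  have hML : ∀ k ≤ N, MemLp (M k) (ENNReal.ofReal q) μ := by
    intro k
    induction k with
    | zero => intro h; rw [hMzero]; exact (hyL 0 h).norm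
    | succ k ih => intro h; rw [hMsucc]; exact (ih (by omega)).sup (hyL (k + 1) h).norm
  have hMi : ∀ k ≤ N, Integrable (fun ω => M k ω ^ q) μ := by
    intro k hk
    have := (hML k hk).integrable_norm_rpow hq0 hqt
    rw [hqr] at this
    exact this.congr (ae_of_all _ fun ω => by simp [abs_of_nonneg (hM0 k ω)])
  have hdi : ∀ i < N, Integrable (fun ω => ‖y (i + 1) ω - y i ω‖ ^ q) μ := by
    intro k hk
    have := (hdL k hk).integrable_norm_rpow hq0 hqt
    rwa [hqr] at this
  have hSi : Integrable (fun ω => S ω ^ q) μ := by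
    have := hfin.integrable_norm_rpow hq0 hqt
    rw [hqr] at this
    exact this.congr (ae_of_all _ fun ω => by simp [abs_of_nonneg (Real.sqrt_nonneg _), hS])
  set G : ℕ → Ω → EuclideanSpace ℝ (Fin d) := fun k ω =>
    (c₁ * M k ω ^ (q - 1) * ‖y k ω‖⁻¹ + c₂ * ‖y k ω‖ ^ (q - 2)) • y k ω with hG
  have hGm : ∀ k, StronglyMeasurable[ℱ k] (G k) := by
    intro k
    have h1 := (hMsm k).measurable
    have h2 := (hy.stronglyAdapted k).norm.measurable
    have h3 : Measurable[ℱ k] fun ω =>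
        c₁ * M k ω ^ (q - 1) * ‖y k ω‖⁻¹ + c₂ * ‖y k ω‖ ^ (q - 2) :=
      (((h1.pow_const (q - 1)).const_mul c₁).mul h2.inv).add ((h2.pow_const (q - 2)).const_mul c₂)
    exact StronglyMeasurable.smul h3.stronglyMeasurable (hy.stronglyAdapted k)
  -- the integrand is in the dual space, because it is bounded by a multiple of `M ^ (q - 1)`
  have hGb : ∀ k ω, ‖G k ω‖ ≤ (|c₁| + |c₂|) * M k ω ^ (q - 1) := by
    intro k ω
    have hle : ‖y k ω‖ ≤ M k ω := le_partialSups (fun i => ‖y i ω‖) k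
    have hMq : 0 ≤ M k ω ^ (q - 1) := Real.rpow_nonneg (hM0 k ω) _
    rw [hG, norm_smul]
    rcases eq_or_ne (y k ω) 0 with h | h
    · simp only [h, norm_zero, mul_zero]; positivity
    have hpos : 0 < ‖y k ω‖ := norm_pos_iff.2 h
    have e2 : ‖y k ω‖ ^ (q - 2) * ‖y k ω‖ = ‖y k ω‖ ^ (q - 1) := by
      rw [← Real.rpow_add_one hpos.ne']; congr 1; ring
    have e3 : ‖y k ω‖ ^ (q - 1) ≤ M k ω ^ (q - 1) :=
      Real.rpow_le_rpow hpos.le hle (by linarith)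
    calc ‖c₁ * M k ω ^ (q - 1) * ‖y k ω‖⁻¹ + c₂ * ‖y k ω‖ ^ (q - 2)‖ * ‖y k ω‖
        ≤ (‖c₁ * M k ω ^ (q - 1) * ‖y k ω‖⁻¹‖ + ‖c₂ * ‖y k ω‖ ^ (q - 2)‖) * ‖y k ω‖ := by
          gcongr; exact norm_add_le _ _
      _ = |c₁| * M k ω ^ (q - 1) * (‖y k ω‖⁻¹ * ‖y k ω‖) +
          |c₂| * (‖y k ω‖ ^ (q - 2) * ‖y k ω‖) := by
          rw [norm_mul, norm_mul, norm_mul, Real.norm_eq_abs c₁, Real.norm_eq_abs c₂,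
            Real.norm_of_nonneg hMq, Real.norm_of_nonneg (inv_nonneg.2 hpos.le),
            Real.norm_of_nonneg (Real.rpow_nonneg hpos.le _)]
          ring
      _ ≤ _ := by
          rw [inv_mul_cancel₀ hpos.ne', e2, mul_one, add_mul]
          gcongr
  have hGi : ∀ k < N, Integrable (fun ω => ⟪G k ω, y (k + 1) ω - y k ω⟫) μ := by
    intro k hk
    refine Integrable.mono' (g := fun ω => (|c₁| + |c₂|) * (1 * M k ω ^ q +
      ((1 : ℝ)⁻¹) ^ (q - 1) * ‖y (k + 1) ω - y k ω‖ ^ q)) ?_ ?_ ?_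
    · exact (((hMi k hk.le).const_mul 1).add ((hdi k hk).const_mul _)).const_mul _
    · exact ((hGm k).mono (ℱ.le k)).aestronglyMeasurable.inner ((hym (k + 1)).sub (hym k))
    · refine ae_of_all _ fun ω => (norm_inner_le_norm _ _).trans ?_
      refine (mul_le_mul_of_nonneg_right (hGb k ω) (norm_nonneg _)).trans ?_
      rw [mul_assoc]
      exact mul_le_mul_of_nonneg_left (rpow_sub_one_mul_le (by linarith) one_pos (hM0 k ω)
        (norm_nonneg _)) (by positivity)
  have hG0 : ∀ k < N, ∫ ω, ⟪G k ω, y (k + 1) ω - y k ω⟫ ∂μ = 0 := by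
    intro k hk
    refine integral_inner_eq_zero_of_condExp_eq_zero (ℱ.le k) (hGm k)
      ((hy.integrable (k + 1)).sub (hy.integrable k)) (hGi k hk) ?_
    have h1 := condExp_sub (hy.integrable (k + 1)) (hy.integrable k) (ℱ k)
    refine h1.trans ?_
    filter_upwards [hy.condExp_ae_eq (Nat.le_succ k), hy.condExp_ae_eq (le_refl k)] with ω h2 h3
    rw [Pi.sub_apply, h3]
    erw [h2]
    simp
  have hmain : ∫ ω, M N ω ^ q ∂μ ≤ K * ∫ ω, S ω ^ q ∂μ := by
    calc ∫ ω, M N ω ^ q ∂μ ≤ ∫ ω, (K * S ω ^ q +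
          ∑ k ∈ Finset.range N, ⟪G k ω, y (k + 1) ω - y k ω⟫) ∂μ := by
          refine integral_mono_ae (hMi N le_rfl) ((hSi.const_mul K).add
            (integrable_finsetSum _ fun k hk => hGi k (Finset.mem_range.1 hk))) ?_
          filter_upwards [h0] with ω hω
          exact hpath _ (fun i => y i ω) hω N
      _ = K * ∫ ω, S ω ^ q ∂μ := by
          rw [integral_add (hSi.const_mul K)
            (integrable_finsetSum _ fun k hk => hGi k (Finset.mem_range.1 hk)),
            integral_finsetSum _ fun k hk => hGi k (Finset.mem_range.1 hk),
            Finset.sum_eq_zero fun k hk => hG0 k (Finset.mem_range.1 hk), add_zero,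
            integral_const_mul]
  have hle : eLpNorm (fun ω => ⨆ i : Fin (N + 1), ‖y i ω‖) (ENNReal.ofReal q) μ ≤
      eLpNorm (M N) (ENNReal.ofReal q) μ := by
    refine eLpNorm_mono_real fun ω => ?_
    rw [Real.norm_of_nonneg (Real.iSup_nonneg fun _ => norm_nonneg _)]
    exact ciSup_le fun i => le_partialSups_of_le (fun i => ‖y i ω‖) (Nat.lt_succ_iff.1 i.2)
  refine hle.trans ?_
  rw [(hML N le_rfl).eLpNorm_eq_integral_rpow_norm hq0 hqt,
    hfin.eLpNorm_eq_integral_rpow_norm hq0 hqt, hqr, ← ENNReal.ofReal_mul (by positivity)]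
  refine ENNReal.ofReal_le_ofReal ?_
  have e1 : ∀ ω, ‖M N ω‖ = M N ω := fun ω => Real.norm_of_nonneg (hM0 N ω)
  have e2 : ∀ ω, ‖S ω‖ = S ω := fun ω => Real.norm_of_nonneg (Real.sqrt_nonneg _)
  simp only [e1, e2]
  rw [one_div, ← Real.mul_rpow hK.le
    (integral_nonneg fun ω => Real.rpow_nonneg (Real.sqrt_nonneg _) _)]
  exact Real.rpow_le_rpow (integral_nonneg fun ω => Real.rpow_nonneg (hM0 N ω) _) hmain
    (by positivity)

end Expectation

end StochExtragradient

/-! ### Sums of martingale differences driven by independent samples -/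

namespace StochExtragradient

section Norms

variable {Ω : Type*} {mΩ : MeasurableSpace Ω} {μ : Measure Ω}
  {E : Type*} [NormedAddCommGroup E]

theorem eLpNorm_norm_sq {q : ℝ} (hq : 0 < q) (f : Ω → E) :
    eLpNorm (fun ω => ‖f ω‖ ^ 2) (ENNReal.ofReal (q / 2)) μ =
      eLpNorm f (ENNReal.ofReal q) μ ^ 2 := by
  have h := eLpNorm_norm_rpow (μ := μ) (p := ENNReal.ofReal (q / 2)) f zero_lt_two
  rw [← ENNReal.ofReal_mul (by positivity), div_mul_cancel₀ _ two_ne_zero, ENNReal.rpow_two] at h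
  rw [← h]
  simp_rw [Real.rpow_two]

/-- Minkowski's inequality in `L^(q/2)` for the squares. -/
theorem eLpNorm_sqrt_sum_sq_le {q : ℝ} (hq : 2 ≤ q) {ι : Type*} (s : Finset ι) (f : ι → Ω → E)
    (hf : ∀ i ∈ s, AEStronglyMeasurable (f i) μ) (b : ι → ℝ)
    (hfb : ∀ i ∈ s, eLpNorm (f i) (ENNReal.ofReal q) μ ≤ ENNReal.ofReal (b i)) :
    eLpNorm (fun ω => √(∑ i ∈ s, ‖f i ω‖ ^ 2)) (ENNReal.ofReal q) μ ≤
      ENNReal.ofReal √(∑ i ∈ s, b i ^ 2) := by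
  have hsq : eLpNorm (fun ω => √(∑ i ∈ s, ‖f i ω‖ ^ 2)) (ENNReal.ofReal q) μ ^ 2 ≤
      ENNReal.ofReal √(∑ i ∈ s, b i ^ 2) ^ 2 := by
    rw [← eLpNorm_norm_sq (by linarith), ← ENNReal.ofReal_pow (Real.sqrt_nonneg _),
      Real.sq_sqrt (Finset.sum_nonneg fun _ _ => sq_nonneg _),
      ENNReal.ofReal_sum_of_nonneg fun _ _ => sq_nonneg _]
    have e : (fun ω => ‖√(∑ i ∈ s, ‖f i ω‖ ^ 2)‖ ^ 2) = ∑ i ∈ s, fun ω => ‖f i ω‖ ^ 2 := by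
      funext ω
      rw [Real.norm_of_nonneg (Real.sqrt_nonneg _),
        Real.sq_sqrt (Finset.sum_nonneg fun _ _ => by positivity), Finset.sum_apply]
    rw [e]
    refine (eLpNorm_sum_le (fun i hi => ?_) ?_).trans (Finset.sum_le_sum fun i hi => ?_)
    · exact ((hf i hi).norm.aemeasurable.pow_const 2).aestronglyMeasurable
    · rw [← ENNReal.ofReal_one]; exact ENNReal.ofReal_le_ofReal (by linarith)
    · rw [eLpNorm_norm_sq (by linarith)]
      refine (pow_le_pow_left' (hfb i hi) 2).trans ?_
      rcases le_total 0 (b i) with h | h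
      · rw [ENNReal.ofReal_pow h]
      · rw [ENNReal.ofReal_of_nonpos h]; simp
  exact (ENNReal.pow_le_pow_left_iff two_ne_zero).1 hsq

end Norms

section BDG

/-- The best constant is itself admissible, as long as the quadratic variation is finite. -/
theorem eLpNorm_iSup_le_bdgConst {q : ℝ} (hq : 2 ≤ q) {Ω : Type u} {mΩ : MeasurableSpace Ω}
    {μ : Measure Ω} [IsProbabilityMeasure μ] {ℱ : Filtration ℕ mΩ} {d N : ℕ}
    {y : ℕ → Ω → EuclideanSpace ℝ (Fin d)} (hy : Martingale y ℱ μ) (h0 : ∀ᵐ ω ∂μ, y 0 ω = 0)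
    {b : ℝ} (hb : eLpNorm (fun ω => √(∑ i ∈ Finset.range N, ‖y (i + 1) ω - y i ω‖ ^ 2))
      (ENNReal.ofReal q) μ ≤ ENNReal.ofReal b) (hb0 : 0 ≤ b) :
    eLpNorm (fun ω => ⨆ i : Fin (N + 1), ‖y i ω‖) (ENNReal.ofReal q) μ ≤
      ENNReal.ofReal (bdgConst.{u} q * b) := by
  have hC : ∀ C ∈ {C : ℝ | IsBDGConst.{u} q C},
      eLpNorm (fun ω => ⨆ i : Fin (N + 1), ‖y i ω‖) (ENNReal.ofReal q) μ ≤
        ENNReal.ofReal (C * b) := by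
    intro C hC
    rw [ENNReal.ofReal_mul hC.1.le]
    exact (hC.2 Ω μ ℱ d N y hy h0).trans (mul_le_mul_right hb _)
  obtain ⟨C₀, hC₀⟩ := exists_isBDGConst.{u} hq
  have hne : ({C : ℝ | IsBDGConst.{u} q C}).Nonempty := ⟨C₀, hC₀⟩
  have hfin := ((hC C₀ hC₀).trans_lt ENNReal.ofReal_lt_top).ne
  rw [← ENNReal.ofReal_toReal hfin]
  refine ENNReal.ofReal_le_ofReal ?_
  have hC' : ∀ C ∈ {C : ℝ | IsBDGConst.{u} q C},
      (eLpNorm (fun ω => ⨆ i : Fin (N + 1), ‖y i ω‖) (ENNReal.ofReal q) μ).toReal ≤ C * b :=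
    fun C h => ENNReal.toReal_le_of_le_ofReal (mul_nonneg h.1.le hb0) (hC C h)
  rcases hb0.eq_or_lt with h | h
  · rw [← h, mul_zero]; simpa [← h] using hC' C₀ hC₀
  · rw [← div_le_iff₀ h]
    exact le_csInf hne fun C hC => (div_le_iff₀ h).2 (hC' C hC)

theorem bdgConst_nonneg (q : ℝ) : 0 ≤ bdgConst.{u} q := Real.sInf_nonneg fun _ h => h.1.le

variable {Ω : Type u} {mΩ : MeasurableSpace Ω} {μ : Measure Ω} [IsProbabilityMeasure μ]

/-- The case of a Euclidean space of `eLpNorm_sum_le_bdgConst`. Adding the increments one sample at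
a time, in the order of their stages, gives a martingale. -/
theorem eLpNorm_sum_le_bdgConst_euclidean {q : ℝ} (hq : 2 ≤ q) {n : ℕ} {A : Type*}
    (m : A → MeasurableSpace Ω) (hm : ∀ a, m a ≤ mΩ) (stage : A → ℕ) (s : Finset A)
    (hs : ∀ a ∈ s, ∀ a', stage a' < stage a → a' ∈ s) (d : A → Ω → EuclideanSpace ℝ (Fin n))
    (hdm : ∀ a ∈ s, StronglyMeasurable[(⨆ a' ∈ {a' | stage a' < stage a}, m a') ⊔ m a] (d a))
    (hd0 : ∀ a ∈ s, ∀ t : Set A, a ∉ t → {a' | stage a' < stage a} ⊆ t →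
      μ[d a | ⨆ a' ∈ t, m a'] =ᵐ[μ] 0)
    (b : A → ℝ) (hdb : ∀ a ∈ s, eLpNorm (d a) (ENNReal.ofReal q) μ ≤ ENNReal.ofReal (b a)) :
    eLpNorm (∑ a ∈ s, d a) (ENNReal.ofReal q) μ ≤
      ENNReal.ofReal (bdgConst.{u} q * √(∑ a ∈ s, b a ^ 2)) := by
  classical
  -- enumerate the samples in the order of their stages
  set M := s.card with hM
  obtain ⟨e, he⟩ : ∃ e : Fin M ≃ s, Monotone fun i => stage (e i) :=
    ⟨(Tuple.sort fun i => stage (s.equivFin.symm i)).trans s.equivFin.symm,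
      Tuple.monotone_sort fun i => stage (s.equivFin.symm i)⟩
  set t : ℕ → Set A := fun k => {a | ∃ i : Fin M, (i : ℕ) < k ∧ (e i : A) = a} with ht
  have htmono : Monotone t := fun k l hkl a ⟨i, hi, hia⟩ => ⟨i, hi.trans_le hkl, hia⟩
  let ℱ : Filtration ℕ mΩ :=
    { seq := fun k => ⨆ a ∈ t k, m a
      mono' := fun k l hkl => biSup_mono fun a ha => htmono hkl ha
      le' := fun k => iSup₂_le fun a _ => hm a }
  have hpast : ∀ i : Fin M, {a' | stage a' < stage (e i)} ⊆ t i := by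
    intro i a' ha'
    have hmem : a' ∈ s := hs _ (e i).2 a' ha'
    refine ⟨e.symm ⟨a', hmem⟩, ?_, by simp⟩
    by_contra hcon
    have : stage (e i) ≤ stage (e (e.symm ⟨a', hmem⟩)) := he (by exact_mod_cast not_lt.1 hcon)
    simp only [Equiv.apply_symm_apply] at this
    exact absurd ha' (not_lt.2 this)
  have hnot : ∀ i : Fin M, (e i : A) ∉ t i := by
    rintro i ⟨j, hj, hji⟩
    have : j = i := e.injective (Subtype.ext hji)
    exact absurd hj (by rw [this]; exact lt_irrefl _)
  set D : ℕ → Ω → EuclideanSpace ℝ (Fin n) :=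
    fun k => if h : k < M then d (e ⟨k, h⟩) else 0 with hD
  have hDpos : ∀ i : Fin M, D i = d (e i) := fun i => by simp [hD, i.2]
  have hDm : ∀ k, StronglyMeasurable[ℱ (k + 1)] (D k) := by
    intro k
    by_cases h : k < M
    · rw [hDpos ⟨k, h⟩]
      refine (hdm _ (e ⟨k, h⟩).2).mono (sup_le ?_ ?_)
      · exact biSup_mono fun a ha => htmono (Nat.le_succ k) (hpast ⟨k, h⟩ ha)
      · exact le_biSup m (show (e ⟨k, h⟩ : A) ∈ t (k + 1) from ⟨⟨k, h⟩, Nat.lt_succ_self k, rfl⟩)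
    · have : D k = 0 := by simp [hD, h]
      rw [this]; exact stronglyMeasurable_zero
  have hDb : ∀ k, eLpNorm (D k) (ENNReal.ofReal q) μ ≤
      ENNReal.ofReal (if h : k < M then b (e ⟨k, h⟩) else 0) := by
    intro k
    by_cases h : k < M
    · rw [hDpos ⟨k, h⟩, dif_pos h]; exact hdb _ (e ⟨k, h⟩).2
    · have : D k = 0 := by simp [hD, h]
      rw [this]; simp
  have hDi : ∀ k, Integrable (D k) μ := by
    intro k
    have h1 : MemLp (D k) (ENNReal.ofReal q) μ :=
      ⟨((hDm k).mono (ℱ.le _)).aestronglyMeasurable, (hDb k).trans_lt ENNReal.ofReal_lt_top⟩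
    refine h1.integrable ?_
    rw [← ENNReal.ofReal_one]; exact ENNReal.ofReal_le_ofReal (by linarith)
  set y : ℕ → Ω → EuclideanSpace ℝ (Fin n) := fun k => ∑ i ∈ Finset.range k, D i with hy
  have hyd : ∀ k, y (k + 1) - y k = D k := fun k => by
    simp [hy, Finset.sum_range_succ]
  have hmart : Martingale y ℱ μ := by
    refine martingale_of_condExp_sub_eq_zero_nat ?_ ?_ ?_
    · intro k
      refine Finset.stronglyMeasurable_sum _ fun i hi => ?_
      exact (hDm i).mono (ℱ.mono (Finset.mem_range.1 hi))
    · exact fun k => integrable_finsetSum' _ fun i _ => hDi i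
    · intro k
      rw [hyd]
      by_cases h : k < M
      · rw [hDpos ⟨k, h⟩]
        exact hd0 _ (e ⟨k, h⟩).2 (t k) (hnot ⟨k, h⟩) (hpast ⟨k, h⟩)
      · have : D k = 0 := by simp [hD, h]
        rw [this, condExp_zero]
  have hsum : ∀ {β : Type u} [AddCommMonoid β] (f : A → β) (g : ℕ → β),
      (∀ i : Fin M, g i = f (e i)) → ∑ k ∈ Finset.range M, g k = ∑ a ∈ s, f a := by
    intro β _ f g hfg
    rw [Finset.sum_range, ← Finset.sum_coe_sort s f, ← e.sum_comp]
    exact Finset.sum_congr rfl fun i _ => hfg i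
  have hsumR : ∀ (f : A → ℝ) (g : ℕ → ℝ),
      (∀ i : Fin M, g i = f (e i)) → ∑ k ∈ Finset.range M, g k = ∑ a ∈ s, f a := by
    intro f g hfg
    rw [Finset.sum_range, ← Finset.sum_coe_sort s f, ← e.sum_comp]
    exact Finset.sum_congr rfl fun i _ => hfg i
  have hyM : y M = ∑ a ∈ s, d a := hsum d D hDpos
  rw [← hyM]
  have hS := eLpNorm_sqrt_sum_sq_le (μ := μ) hq (Finset.range M) D
    (fun k _ => ((hDm k).mono (ℱ.le _)).aestronglyMeasurable) _ (fun k _ => hDb k)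
  rw [hsumR (fun a => b a ^ 2) _ fun i => by simp [i.2]] at hS
  have hfin := eLpNorm_iSup_le_bdgConst hq hmart (N := M) (by simp [hy]) (b := √(∑ a ∈ s, b a ^ 2))
    (by
      refine le_of_eq_of_le ?_ hS
      congr 1
      funext ω
      congr 1
      refine Finset.sum_congr rfl fun k _ => ?_
      rw [← hyd k, Pi.sub_apply]) (Real.sqrt_nonneg _)
  refine le_trans ?_ hfin
  refine eLpNorm_mono_real fun ω => ?_
  have := le_ciSup (f := fun i : Fin (M + 1) => ‖y i ω‖) (Set.finite_range _).bddAbove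
    (Fin.last M)
  simpa using this

/-- The Burkholder-Davis-Gundy inequality for a sum of martingale differences which are indexed by
samples: every sample has a stage, the increment of a sample depends on that sample and on those of
earlier stages, and it is centered given any collection of other samples that contains the earlier
stages. -/
theorem eLpNorm_sum_le_bdgConst {q : ℝ} (hq : 2 ≤ q) {E : Type*} [NormedAddCommGroup E]
    [InnerProductSpace ℝ E] [FiniteDimensional ℝ E] {A : Type*}
    (m : A → MeasurableSpace Ω) (hm : ∀ a, m a ≤ mΩ) (stage : A → ℕ) (s : Finset A)
    (hs : ∀ a ∈ s, ∀ a', stage a' < stage a → a' ∈ s) (d : A → Ω → E)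
    (hdm : ∀ a ∈ s, StronglyMeasurable[(⨆ a' ∈ {a' | stage a' < stage a}, m a') ⊔ m a] (d a))
    (hd0 : ∀ a ∈ s, ∀ t : Set A, a ∉ t → {a' | stage a' < stage a} ⊆ t →
      μ[d a | ⨆ a' ∈ t, m a'] =ᵐ[μ] 0)
    (b : A → ℝ) (hdb : ∀ a ∈ s, eLpNorm (d a) (ENNReal.ofReal q) μ ≤ ENNReal.ofReal (b a)) :
    eLpNorm (∑ a ∈ s, d a) (ENNReal.ofReal q) μ ≤
      ENNReal.ofReal (bdgConst.{u} q * √(∑ a ∈ s, b a ^ 2)) := by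
  have : CompleteSpace E := FiniteDimensional.complete ℝ E
  set L := (stdOrthonormalBasis ℝ E).repr with hL
  have hnorm : ∀ f : Ω → E, eLpNorm (fun ω => L (f ω)) (ENNReal.ofReal q) μ =
      eLpNorm f (ENNReal.ofReal q) μ :=
    fun f => eLpNorm_congr_norm_ae (ae_of_all _ fun ω => L.norm_map _)
  have hle : ∀ a ∈ s, ((⨆ a' ∈ {a' | stage a' < stage a}, m a') ⊔ m a) ≤ mΩ :=
    fun a _ => sup_le (iSup₂_le fun a _ => hm a) (hm a)
  have hdi : ∀ a ∈ s, Integrable (d a) μ := by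
    intro a ha
    have h1 : MemLp (d a) (ENNReal.ofReal q) μ :=
      ⟨((hdm a ha).mono (hle a ha)).aestronglyMeasurable, (hdb a ha).trans_lt ENNReal.ofReal_lt_top⟩
    refine h1.integrable ?_
    rw [← ENNReal.ofReal_one]; exact ENNReal.ofReal_le_ofReal (by linarith)
  have key := eLpNorm_sum_le_bdgConst_euclidean (μ := μ) hq m hm stage s hs
    (fun a ω => L (d a ω)) (fun a ha => L.continuous.comp_stronglyMeasurable (hdm a ha))
    (fun a ha t hat ht => by
      refine (ContinuousLinearMap.comp_condExp_comm (m := ⨆ a' ∈ t, m a') (hdi a ha)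
        L.toContinuousLinearEquiv.toContinuousLinearMap).symm.trans ?_
      filter_upwards [hd0 a ha t hat ht] with ω hω
      simp [hω]) b
    (fun a ha => by rw [hnorm]; exact hdb a ha)
  rw [← hnorm]
  refine le_of_eq_of_le ?_ key
  congr 1
  funext ω
  simp [Finset.sum_apply]

end BDG

end StochExtragradient

namespace StochExtragradient

section LowerBound

/-- The best constant is bounded away from one: the sum of two independent signs gives
`C_p ≥ 2^(1/4) ≥ 2/√3`. This absorbs the factor two in front of the martingale part. -/
theorem two_le_sqrt_three_mul_bdgConst {p : ℝ} (hp : 4 ≤ p) : 2 ≤ √3 * bdgConst.{u} p := by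
  -- a fair sign
  let ν : Measure (ULift.{u} Bool) :=
    (2 : ℝ≥0∞)⁻¹ • Measure.dirac ⟨true⟩ + (2 : ℝ≥0∞)⁻¹ • Measure.dirac ⟨false⟩
  have hν : IsProbabilityMeasure ν := ⟨by simp [ν, ENNReal.inv_two_add_inv_two]⟩
  let sgn : ULift.{u} Bool → ℝ := fun b => if b.down then 1 else -1
  have hsgn : Measurable sgn := measurable_of_countable _
  have hsgn_abs : ∀ b, |sgn b| = 1 := fun b => by by_cases h : b.down <;> simp [sgn, h]
  have hsgn_sq : ∀ b, sgn b ^ 2 = 1 := fun b => by rw [← sq_abs, hsgn_abs]; norm_num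
  have hνi : ∫ b, sgn b ∂ν = 0 := by
    rw [integral_add_measure, integral_smul_measure, integral_smul_measure, integral_dirac,
      integral_dirac]
    · simp [sgn]
    · exact (integrable_dirac (by simp [sgn])).smul_measure (by simp)
    · exact (integrable_dirac (by simp [sgn])).smul_measure (by simp)
  let μ : Measure (Fin 2 → ULift.{u} Bool) := Measure.pi fun _ => ν
  have hind : iIndepFun (fun (i : Fin 2) (ω : Fin 2 → ULift.{u} Bool) => ω i) μ :=
    iIndepFun_pi (X := fun (_ : Fin 2) (b : ULift.{u} Bool) => b) fun _ => aemeasurable_id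
  let d : Fin 2 → (Fin 2 → ULift.{u} Bool) → ℝ := fun i ω => sgn (ω i)
  have hdm : ∀ i, Measurable (d i) := fun i => hsgn.comp (measurable_pi_apply i)
  have hd1 : ∀ i ω, ‖d i ω‖ = 1 := fun i ω => by rw [Real.norm_eq_abs]; exact hsgn_abs _
  have hdi : ∀ i, ∫ ω, d i ω ∂μ = 0 := by
    intro i
    have := (measurePreserving_eval (fun _ : Fin 2 => ν) i)
    rw [← hνi, ← this.map_eq, integral_map (measurable_pi_apply i).aemeasurable
      hsgn.aestronglyMeasurable]
  have hdint : ∀ i, Integrable (d i) μ := fun i =>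
    Integrable.of_bound (hdm i).aestronglyMeasurable 1 (ae_of_all _ fun ω => (hd1 i ω).le)
  have hmle : ∀ i : Fin 2,
      MeasurableSpace.comap (fun ω : Fin 2 → ULift.{u} Bool => ω i) inferInstance ≤
        MeasurableSpace.pi := fun i => (measurable_pi_apply i).comap_le
  have hdsm : ∀ i, StronglyMeasurable[MeasurableSpace.comap
      (fun ω : Fin 2 → ULift.{u} Bool => ω i) inferInstance] (d i) := fun i =>
    (hsgn.comp (comap_measurable _)).stronglyMeasurable
  have key := eLpNorm_sum_le_bdgConst (μ := μ) (q := p) (by linarith)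
    (fun i => MeasurableSpace.comap (fun ω : Fin 2 → ULift.{u} Bool => ω i) inferInstance)
    hmle (fun _ => 0) Finset.univ (fun _ _ _ _ => Finset.mem_univ _) d
    (fun i _ => (hdsm i).mono le_sup_right)
    (fun i _ t hit _ => by
      have hI : Indep (MeasurableSpace.comap (fun ω : Fin 2 → ULift.{u} Bool => ω i) inferInstance)
          (⨆ a' ∈ t, MeasurableSpace.comap (fun ω : Fin 2 → ULift.{u} Bool => ω a') inferInstance)
          μ := by
        have := indep_iSup_of_disjoint hmle ((iIndepFun_iff_iIndep ..).1 hind) (S := {i}) (T := t)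
          (by simpa using hit)
        simpa using this
      have hle : (⨆ a' ∈ t, MeasurableSpace.comap
          (fun ω : Fin 2 → ULift.{u} Bool => ω a') inferInstance) ≤ MeasurableSpace.pi :=
        iSup₂_le fun a _ => hmle a
      refine (condExp_indep_eq (hmle i) hle (hdsm i) hI).trans ?_
      rw [hdi]; rfl) (fun _ => 1)
    (fun i _ => by
      refine (eLpNorm_le_of_ae_bound (C := 1) (ae_of_all _ fun ω => (hd1 i ω).le)).trans ?_
      simp)
  have hmem : MemLp (∑ a, d a) (ENNReal.ofReal 4) μ :=
    memLp_finsetSum' _ fun i _ =>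
      MemLp.of_bound (hdm i).aestronglyMeasurable 1 (ae_of_all _ fun ω => (hd1 i ω).le)
  have h4 := (eLpNorm_le_eLpNorm_of_exponent_le (ENNReal.ofReal_le_ofReal hp) hmem.1).trans key
  have hprod : ∫ ω, d 0 ω * d 1 ω ∂μ = 0 := by
    have hI : IndepFun (d 0) (d 1) μ :=
      (hind.indepFun (i := 0) (j := 1) (by decide)).comp hsgn hsgn
    rw [hI.integral_fun_mul_eq_mul_integral (hdint 0).1 (hdint 1).1, hdi]; simp
  have hpi : Integrable (fun ω => d 0 ω * d 1 ω) μ :=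
    Integrable.of_bound ((hdm 0).mul (hdm 1)).aestronglyMeasurable 1
      (ae_of_all _ fun ω => by rw [norm_mul, hd1, hd1]; norm_num)
  have h8 : ∫ ω, ‖(∑ a, d a) ω‖ ^ (4 : ℝ) ∂μ = 8 := by
    have : ∀ ω, ‖(∑ a, d a) ω‖ ^ (4 : ℝ) = 8 + 8 * (d 0 ω * d 1 ω) := by
      intro ω
      have h0 : d 0 ω ^ 2 = 1 := hsgn_sq _
      have h1 : d 1 ω ^ 2 = 1 := hsgn_sq _
      rw [show (4 : ℝ) = ((4 : ℕ) : ℝ) by norm_num, Real.rpow_natCast, Real.norm_eq_abs,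
        Even.pow_abs (by decide)]
      simp only [Finset.sum_apply, Fin.sum_univ_two]
      have : (d 0 ω + d 1 ω) ^ 2 = 2 + 2 * (d 0 ω * d 1 ω) := by linear_combination h0 + h1
      have h2 : (d 0 ω * d 1 ω) ^ 2 = 1 := by rw [mul_pow, h0, h1, one_mul]
      calc (d 0 ω + d 1 ω) ^ 4 = ((d 0 ω + d 1 ω) ^ 2) ^ 2 := by ring
        _ = _ := by rw [this]; linear_combination 4 * h2
    simp only [this]
    rw [integral_add (integrable_const _) (hpi.const_mul 8), integral_const_mul, hprod]
    simp
  rw [hmem.eLpNorm_eq_integral_rpow_norm (by simp) ENNReal.ofReal_ne_top,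
    ENNReal.toReal_ofReal (by norm_num), h8] at h4
  have h5 := (ENNReal.ofReal_le_ofReal_iff
    (mul_nonneg (bdgConst_nonneg _) (Real.sqrt_nonneg _))).1 h4
  simp only [Finset.sum_const, Finset.card_univ, Fintype.card_fin, one_pow, nsmul_eq_mul] at h5
  have hC := bdgConst_nonneg.{u} p
  set C := bdgConst.{u} p
  have h6 : (8 : ℝ) ≤ (C * √((2 : ℕ) * 1)) ^ 4 := by
    calc (8 : ℝ) = (8 ^ ((4 : ℝ)⁻¹)) ^ 4 := by
          rw [← Real.rpow_natCast, ← Real.rpow_mul (by norm_num)]; norm_num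
      _ ≤ _ := pow_le_pow_left₀ (by positivity) h5 4
  have h7 : (√((2 : ℕ) * 1)) ^ 4 = (4 : ℝ) := by
    rw [show 4 = 2 * 2 by norm_num, pow_mul, Real.sq_sqrt (by norm_num)]; norm_num
  rw [mul_pow, h7] at h6
  have h9 : 4 / 3 ≤ C ^ 2 := by nlinarith [sq_nonneg (C ^ 2)]
  have h10 : (2 : ℝ) ^ 2 ≤ (√3 * C) ^ 2 := by
    rw [mul_pow, Real.sq_sqrt (by norm_num)]; linarith
  exact (pow_le_pow_iff_left₀ (by norm_num) (by positivity) two_ne_zero).1 h10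

end LowerBound

end StochExtragradient

namespace StochExtragradient
/-! ### Projections, variational inequalities and one extragradient step -/

section Deterministic

variable {V : Type*} [NormedAddCommGroup V] [InnerProductSpace ℝ V]

/-- The variational characterization of the projection `p` of `u` onto a convex set `C`. -/
def IsProj (C : Set V) (u p : V) : Prop := p ∈ C ∧ ∀ w ∈ C, ⟪u - p, w - p⟫ ≤ 0

theorem IsProj.norm_sub_le {C : Set V} {u p u' p' : V} (h : IsProj C u p) (h' : IsProj C u' p') :
    ‖p - p'‖ ≤ ‖u - u'‖ := by
  have h1 := h.2 p' h'.1
  have h2 := h'.2 p h.1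
  have h3 : ‖p - p'‖ ^ 2 ≤ ⟪u - u', p - p'⟫ := by
    have e : ⟪u - u', p - p'⟫ - ‖p - p'‖ ^ 2 = -⟪u - p, p' - p⟫ - ⟪u' - p', p - p'⟫ := by
      rw [← real_inner_self_eq_norm_sq, ← inner_sub_left, ← neg_sub p p', inner_neg_right, neg_neg,
        ← inner_sub_left]
      congr 1; abel
    linarith
  have h4 := real_inner_le_norm (u - u') (p - p')
  by_contra! hlt
  nlinarith [norm_nonneg (u - u')]

theorem isProj_self {C : Set V} {u : V} (h : u ∈ C) : IsProj C u u := ⟨h, by simp⟩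

theorem isProj_proj [CompleteSpace V] {C : Set V} (hne : C.Nonempty) (hc : IsClosed C)
    (hconv : Convex ℝ C) (u : V) : IsProj C u (proj C u) := by
  obtain ⟨y, hy, hmin⟩ := exists_norm_eq_iInf_of_complete_convex hne hc.isComplete hconv u
  have hex : ∃ y, y ∈ C ∧ ∀ w ∈ C, ‖u - y‖ ≤ ‖u - w‖ := by
    refine ⟨y, hy, fun w hw => ?_⟩
    rw [hmin]
    exact ciInf_le ⟨0, by rintro _ ⟨v, rfl⟩; exact norm_nonneg _⟩ (⟨w, hw⟩ : C)
  have hp : proj C u ∈ C ∧ ∀ w ∈ C, ‖u - proj C u‖ ≤ ‖u - w‖ := Classical.epsilon_spec hex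
  refine ⟨hp.1, (norm_eq_iInf_iff_real_inner_le_zero hconv hp.1).1 ?_⟩
  have : Nonempty C := ⟨⟨y, hy⟩⟩
  exact le_antisymm (le_ciInf fun w => hp.2 w w.2)
    (ciInf_le ⟨0, by rintro _ ⟨v, rfl⟩; exact norm_nonneg _⟩ (⟨proj C u, hp.1⟩ : C))

theorem IsProj.norm_sub_le_of_mem {C : Set V} {u p w : V} (h : IsProj C u p) (hw : w ∈ C) :
    ‖u - p‖ ≤ ‖u - w‖ := by
  have h1 := h.2 w hw
  have e : ‖u - w‖ ^ 2 = ‖u - p‖ ^ 2 - 2 * ⟪u - p, w - p⟫ + ‖w - p‖ ^ 2 := by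
    rw [← norm_sub_sq_real]; congr 2; abel
  refine (pow_le_pow_iff_left₀ (norm_nonneg _) (norm_nonneg _) two_ne_zero).1 ?_
  nlinarith [sq_nonneg ‖w - p‖]

theorem IsProj.infDist_eq {C : Set V} {u p : V} (h : IsProj C u p) :
    Metric.infDist u C = ‖u - p‖ := by
  refine le_antisymm (by simpa [dist_eq_norm] using Metric.infDist_le_dist_of_mem h.1) ?_
  refine (Metric.le_infDist ⟨p, h.1⟩).2 fun w hw => ?_
  rw [dist_eq_norm]
  exact h.norm_sub_le_of_mem hw

theorem continuous_of_isProj {C : Set V} {f : V → V} (hf : ∀ u, IsProj C u (f u)) :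
    Continuous f :=
  (LipschitzWith.mk_one fun u v => by
    rw [dist_eq_norm, dist_eq_norm]; exact (hf u).norm_sub_le (hf v)).continuous

theorem continuousOn_of_lipschitz {V : Type*} [NormedAddCommGroup V] {T : V → V} {X : Set V} {L : ℝ}
    (hT : ∀ x ∈ X, ∀ y ∈ X, ‖T x - T y‖ ≤ L * ‖x - y‖) : ContinuousOn T X := by
  refine LipschitzOnWith.continuousOn (K := L.toNNReal) (LipschitzOnWith.of_dist_le_mul ?_)
  intro x hx y hy
  rw [dist_eq_norm, dist_eq_norm]
  exact (hT x hx y hy).trans (mul_le_mul_of_nonneg_right (Real.le_coe_toNNReal L) (norm_nonneg _))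

theorem isClosed_solutionSet {T : V → V} {X : Set V} (hX : IsClosed X) (hT : ContinuousOn T X) :
    IsClosed (solutionSet T X) := by
  refine IsSeqClosed.isClosed fun x a hx hxa => ?_
  have ha : a ∈ X := hX.mem_of_tendsto hxa (Filter.Eventually.of_forall fun k => (hx k).1)
  refine ⟨ha, fun y hy => ?_⟩
  have hTa : Filter.Tendsto (fun k => T (x k)) Filter.atTop (𝓝 (T a)) :=
    (hT a ha).tendsto.comp (tendsto_nhdsWithin_iff.2
      ⟨hxa, Filter.Eventually.of_forall fun k => (hx k).1⟩)
  exact ge_of_tendsto' (hTa.inner (tendsto_const_nhds.sub hxa)) fun k => (hx k).2 y hy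

/-- Minty's lemma: for a continuous pseudo-monotone operator the solutions of the variational
inequality are the solutions of its dual form, which is a system of linear inequalities. -/
theorem mem_solutionSet_iff_minty {T : V → V} {X : Set V} (hX : Convex ℝ X) (hT : ContinuousOn T X)
    (hmono : ∀ x ∈ X, ∀ z ∈ X, 0 ≤ ⟪T x, z - x⟫ → 0 ≤ ⟪T z, z - x⟫) {x : V} (hx : x ∈ X) :
    x ∈ solutionSet T X ↔ ∀ y ∈ X, 0 ≤ ⟪T y, y - x⟫ := by
  refine ⟨fun h y hy => hmono x hx y hy (h.2 y hy), fun h => ⟨hx, fun y hy => ?_⟩⟩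
  have hmem : ∀ k : ℕ, x + (1 / ((k : ℝ) + 1)) • (y - x) ∈ X := fun k =>
    hX.add_smul_sub_mem hx hy ⟨by positivity, by
      rw [div_le_one (by positivity)]; linarith [k.cast_nonneg (α := ℝ)]⟩
  have hlim : Filter.Tendsto (fun k : ℕ => x + (1 / ((k : ℝ) + 1)) • (y - x)) Filter.atTop
      (𝓝 x) := by
    have := (tendsto_const_nhds (x := x)).add
      ((tendsto_one_div_add_atTop_nhds_zero_nat (𝕜 := ℝ)).smul_const (y - x))
    simpa using this
  have hTl := (hT x hx).tendsto.comp (tendsto_nhdsWithin_iff.2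
      ⟨hlim, Filter.Eventually.of_forall hmem⟩)
  refine ge_of_tendsto' (hTl.inner (tendsto_const_nhds (x := y - x))) fun k => ?_
  have := h _ (hmem k)
  rw [add_sub_cancel_left, real_inner_smul_right] at this
  exact nonneg_of_mul_nonneg_right this (by positivity)

theorem convex_solutionSet {T : V → V} {X : Set V} (hX : Convex ℝ X) (hT : ContinuousOn T X)
    (hmono : ∀ x ∈ X, ∀ z ∈ X, 0 ≤ ⟪T x, z - x⟫ → 0 ≤ ⟪T z, z - x⟫) :
    Convex ℝ (solutionSet T X) := by
  intro x hx y hy a b ha hb hab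
  have hm := hX hx.1 hy.1 ha hb hab
  rw [mem_solutionSet_iff_minty hX hT hmono hm]
  intro w hw
  have h1 := (mem_solutionSet_iff_minty hX hT hmono hx.1).1 hx w hw
  have h2 := (mem_solutionSet_iff_minty hX hT hmono hy.1).1 hy w hw
  have e : w - (a • x + b • y) = a • (w - x) + b • (w - y) := by
    rw [smul_sub, smul_sub]
    have : w = a • w + b • w := by rw [← add_smul, hab, one_smul]
    nth_rewrite 1 [this]; abel
  rw [e, inner_add_right, real_inner_smul_right, real_inner_smul_right]
  positivity

/-- The quasi-Fejér inequality of one extragradient step with inexact operator values `g₁`, `g₂`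
at the base point `x` and at the intermediate point `z`. -/
theorem extragradient_step {T : V → V} {X : Set V} {L α : ℝ}
    (hT : ∀ x ∈ X, ∀ y ∈ X, ‖T x - T y‖ ≤ L * ‖x - y‖)
    (hmono : ∀ x ∈ X, ∀ z ∈ X, 0 ≤ ⟪T x, z - x⟫ → 0 ≤ ⟪T z, z - x⟫)
    (hα : 0 ≤ α) (hαL : 3 * (L * α) ^ 2 ≤ 1) {x z x' g₁ g₂ xs : V} (hx : x ∈ X)
    (hz : IsProj X (x - α • g₁) z) (hx' : IsProj X (x - α • g₂) x') (hxs : xs ∈ solutionSet T X) :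
    ‖x' - xs‖ ^ 2 ≤ ‖x - xs‖ ^ 2 + 3 * α ^ 2 * (‖g₁ - T x‖ ^ 2 + ‖g₂ - T z‖ ^ 2) +
      2 * α * ⟪g₂ - T z, xs - z⟫ := by
  have h1 := hx'.2 xs hxs.1
  have h2 := hz.2 x' hx'.1
  have h3 := hmono xs hxs.1 z hz.1 (hxs.2 z hz.1)
  -- decompose with respect to the differences of the points involved
  have e1 : x - α • g₂ - x' = (x - xs) - (x' - xs) - α • g₂ := by abel
  have i1 : ⟪x - xs, x' - xs⟫ - ‖x' - xs‖ ^ 2 - α * ⟪g₂, x' - xs⟫ ≥ 0 := by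
    have : ⟪x - α • g₂ - x', xs - x'⟫ =
        -(⟪x - xs, x' - xs⟫ - ‖x' - xs‖ ^ 2 - α * ⟪g₂, x' - xs⟫) := by
      rw [e1, ← neg_sub x' xs, inner_neg_right, inner_sub_left, inner_sub_left,
        real_inner_self_eq_norm_sq, real_inner_smul_left]
    linarith
  have n1 : ‖x - x'‖ ^ 2 = ‖x - xs‖ ^ 2 - 2 * ⟪x - xs, x' - xs⟫ + ‖x' - xs‖ ^ 2 := by
    rw [← norm_sub_sq_real]; congr 2; abel
  have n2 : ‖x - x'‖ ^ 2 = ‖x - z‖ ^ 2 - 2 * ⟪x - z, x' - z⟫ + ‖x' - z‖ ^ 2 := by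
    rw [← norm_sub_sq_real]; congr 2; abel
  have i2 : ⟪x - z, x' - z⟫ - α * ⟪g₁, x' - z⟫ ≤ 0 := by
    have : ⟪x - α • g₁ - z, x' - z⟫ = ⟪x - z, x' - z⟫ - α * ⟪g₁, x' - z⟫ := by
      rw [sub_right_comm, inner_sub_left, real_inner_smul_left]
    linarith
  have i3 : ⟪g₂, x' - xs⟫ = ⟪g₂, x' - z⟫ + ⟪T z, z - xs⟫ - ⟪g₂ - T z, xs - z⟫ := by
    have e2 : x' - xs = (x' - z) + (z - xs) := by abel
    rw [e2, inner_add_right, inner_sub_left, ← neg_sub z xs, inner_neg_right, inner_neg_right]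
    ring
  have i4 : 2 * α * (⟪g₁, x' - z⟫ - ⟪g₂, x' - z⟫) ≤ ‖x' - z‖ ^ 2 + α ^ 2 * ‖g₁ - g₂‖ ^ 2 := by
    rw [← inner_sub_left]
    have := real_inner_le_norm (g₁ - g₂) (x' - z)
    nlinarith [sq_nonneg (‖x' - z‖ - α * ‖g₁ - g₂‖), mul_le_mul_of_nonneg_left this hα]
  have i5 : ‖g₁ - g₂‖ ^ 2 ≤ 3 * (‖g₁ - T x‖ ^ 2 + ‖g₂ - T z‖ ^ 2 + (L * ‖x - z‖) ^ 2) := by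
    have t1 : ‖g₁ - g₂‖ ≤ ‖g₁ - T x‖ + ‖g₂ - T z‖ + L * ‖x - z‖ := by
      have : g₁ - g₂ = (g₁ - T x) - (g₂ - T z) + (T x - T z) := by abel
      rw [this]
      refine (norm_add_le _ _).trans (add_le_add (norm_sub_le _ _) (hT x hx z hz.1))
    set a := ‖g₁ - T x‖
    set b := ‖g₂ - T z‖
    set c := L * ‖x - z‖
    have : ‖g₁ - g₂‖ ^ 2 ≤ (a + b + c) ^ 2 := pow_le_pow_left₀ (norm_nonneg _) t1 2
    nlinarith [sq_nonneg (a - b), sq_nonneg (b - c), sq_nonneg (a - c)]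
  have i6 : α ^ 2 * (3 * (L * ‖x - z‖) ^ 2) ≤ ‖x - z‖ ^ 2 := by
    have := mul_le_mul_of_nonneg_right hαL (sq_nonneg ‖x - z‖)
    nlinarith
  have i7 := mul_le_mul_of_nonneg_left i5 (sq_nonneg α)
  have i8 := mul_nonneg hα h3
  nlinarith

theorem norm_mid_sub_le {T : V → V} {X : Set V} {L α : ℝ}
    (hT : ∀ x ∈ X, ∀ y ∈ X, ‖T x - T y‖ ≤ L * ‖x - y‖) (hα : 0 ≤ α) {x z g xs : V} (hx : x ∈ X)
    (hz : IsProj X (x - α • g) z) (hxs : xs ∈ solutionSet T X) :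
    ‖z - xs‖ ≤ (1 + L * α) * ‖x - xs‖ + α * ‖g - T x‖ := by
  have hp : IsProj X (xs - α • T xs) xs := by
    refine ⟨hxs.1, fun w hw => ?_⟩
    have := mul_nonneg hα (hxs.2 w hw)
    rw [sub_right_comm, sub_self, zero_sub, inner_neg_left, real_inner_smul_left]
    linarith
  refine (hz.norm_sub_le hp).trans ?_
  have e : x - α • g - (xs - α • T xs) = (x - xs) - α • (T x - T xs) - α • (g - T x) := by
    simp only [smul_sub]; abel
  rw [e]
  have h1 := norm_sub_le ((x - xs) - α • (T x - T xs)) (α • (g - T x))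
  have h2 := norm_sub_le (x - xs) (α • (T x - T xs))
  rw [norm_smul, Real.norm_of_nonneg hα] at h1 h2
  have h3 := mul_le_mul_of_nonneg_left (hT x hx xs hxs.1) hα
  linarith

theorem norm_next_sub_le {T : V → V} {X : Set V} {L α : ℝ}
    (hT : ∀ x ∈ X, ∀ y ∈ X, ‖T x - T y‖ ≤ L * ‖x - y‖) (hα : 0 ≤ α) {x z x' g xs : V} (hz : z ∈ X)
    (hx' : IsProj X (x - α • g) x') (hxs : xs ∈ solutionSet T X) :
    ‖x' - xs‖ ≤ ‖x - xs‖ + α * ‖g - T z‖ + L * α * ‖z - xs‖ := by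
  have hp : IsProj X (xs - α • T xs) xs := by
    refine ⟨hxs.1, fun w hw => ?_⟩
    have := mul_nonneg hα (hxs.2 w hw)
    rw [sub_right_comm, sub_self, zero_sub, inner_neg_left, real_inner_smul_left]
    linarith
  refine (hx'.norm_sub_le hp).trans ?_
  have e : x - α • g - (xs - α • T xs) = (x - xs) - α • (g - T z) - α • (T z - T xs) := by
    simp only [smul_sub]; abel
  rw [e]
  have h1 := norm_sub_le ((x - xs) - α • (g - T z)) (α • (T z - T xs))
  have h2 := norm_sub_le (x - xs) (α • (g - T z))
  rw [norm_smul, Real.norm_of_nonneg hα] at h1 h2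
  have h3 := mul_le_mul_of_nonneg_left (hT z hz xs hxs.1) hα
  linarith

end Deterministic

end StochExtragradient

/-! ### Fresh samples evaluated at points determined by the past -/

namespace StochExtragradient

section Fresh

variable {Ω Ξ W : Type*} {mΩ : MeasurableSpace Ω} [MeasurableSpace Ξ] [MeasurableSpace W]
  {P : Measure Ω} [IsProbabilityMeasure P] {S ξ : Ω → Ξ} {w : Ω → W}

theorem map_prodMk_eq (hS : Measurable S) (hw : Measurable w) (hind : IndepFun S w P)
    (hid : IdentDistrib S ξ P P) :
    P.map (fun ω => (S ω, w ω)) = (P.map ξ).prod (P.map w) := by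
  rw [(indepFun_iff_map_prod_eq_prod_map_map hS.aemeasurable hw.aemeasurable).1 hind, hid.map_eq]

theorem lintegral_comp_fresh (hS : Measurable S) (hξ : Measurable ξ) (hw : Measurable w)
    (hind : IndepFun S w P) (hid : IdentDistrib S ξ P P) {H : Ξ × W → ℝ≥0∞} (hH : Measurable H) :
    ∫⁻ ω, H (S ω, w ω) ∂P = ∫⁻ ω, ∫⁻ ω', H (ξ ω', w ω) ∂P ∂P := by
  rw [← lintegral_map hH (hS.prodMk hw), map_prodMk_eq hS hw hind hid,
    lintegral_prod_symm' _ hH, lintegral_map hH.lintegral_prod_left' hw]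
  refine lintegral_congr fun ω => ?_
  exact lintegral_map (hH.comp measurable_prodMk_right) hξ

/-- A bound for the moments of a random field at deterministic points carries over to a fresh
sample of the field at an independent random point. -/
theorem eLpNorm_comp_fresh_le {E : Type*} [NormedAddCommGroup E] [MeasurableSpace E]
    [OpensMeasurableSpace E]
    (hS : Measurable S) (hξ : Measurable ξ) (hw : Measurable w)
    (hind : IndepFun S w P) (hid : IdentDistrib S ξ P P) {q : ℝ} (hq : 0 < q) {H : Ξ × W → E}
    (hH : Measurable H) {φ : W → ℝ}
    (hφ : ∀ ω, eLpNorm (fun ω' => H (ξ ω', w ω)) (ENNReal.ofReal q) P ≤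
      ENNReal.ofReal (φ (w ω))) :
    eLpNorm (fun ω => H (S ω, w ω)) (ENNReal.ofReal q) P ≤
      eLpNorm (fun ω => φ (w ω)) (ENNReal.ofReal q) P := by
  have hq0 : ENNReal.ofReal q ≠ 0 := by simpa using hq
  have hqr : (ENNReal.ofReal q).toReal = q := ENNReal.toReal_ofReal hq.le
  simp only [eLpNorm_eq_lintegral_rpow_enorm_toReal hq0 ENNReal.ofReal_ne_top, hqr] at hφ ⊢
  refine ENNReal.rpow_le_rpow ?_ (by positivity)
  rw [lintegral_comp_fresh hS hξ hw hind hid (H := fun p => ‖H p‖ₑ ^ q) (hH.enorm.pow_const q)]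
  refine lintegral_mono fun ω => ?_
  have h1 := (hφ ω).trans (Real.ofReal_le_enorm (φ (w ω)))
  have h2 := ENNReal.rpow_le_rpow h1 hq.le
  rwa [← ENNReal.rpow_mul, one_div, inv_mul_cancel₀ hq.ne', ENNReal.rpow_one] at h2

theorem integral_comp_fresh {E : Type*} [NormedAddCommGroup E] [NormedSpace ℝ E]
    (hS : Measurable S) (hξ : Measurable ξ) (hw : Measurable w)
    (hind : IndepFun S w P) (hid : IdentDistrib S ξ P P) {H : Ξ × W → E}
    (hH : StronglyMeasurable H) (hint : Integrable (fun ω => H (S ω, w ω)) P) :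
    ∫ ω, H (S ω, w ω) ∂P = ∫ ω, ∫ ω', H (ξ ω', w ω) ∂P ∂P := by
  have hmap := map_prodMk_eq hS hw hind hid
  have hint' : Integrable H ((P.map ξ).prod (P.map w)) := by
    rw [← hmap, integrable_map_measure hH.aestronglyMeasurable (hS.prodMk hw).aemeasurable]
    exact hint
  have : IsProbabilityMeasure (P.map ξ) := Measure.isProbabilityMeasure_map hξ.aemeasurable
  have : IsProbabilityMeasure (P.map w) := Measure.isProbabilityMeasure_map hw.aemeasurable
  rw [← integral_map (f := H) (hS.prodMk hw).aemeasurable hH.aestronglyMeasurable, hmap,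
    integral_prod_symm _ hint', integral_map hw.aemeasurable]
  · refine integral_congr_ae (ae_of_all _ fun ω => ?_)
    exact integral_map hξ.aemeasurable
      (hH.comp_measurable measurable_prodMk_right).aestronglyMeasurable
  · exact hH.integral_prod_left'.aestronglyMeasurable

/-- A centered random field, sampled afresh at a point determined by the past, is centered given the
past. -/
theorem condExp_comp_fresh_eq_zero {Ω Ξ W : Type*} {𝒢 mΩ : MeasurableSpace Ω} [MeasurableSpace Ξ]
    [MeasurableSpace W] {P : Measure Ω} [IsProbabilityMeasure P] {S ξ : Ω → Ξ} {w : Ω → W}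
    {E : Type*} [NormedAddCommGroup E] [NormedSpace ℝ E]
    [CompleteSpace E] (h𝒢 : 𝒢 ≤ mΩ)
    (hS : Measurable S) (hξ : Measurable ξ) (hw : Measurable[𝒢] w)
    (hind : Indep (MeasurableSpace.comap S inferInstance) 𝒢 P) (hid : IdentDistrib S ξ P P)
    {H : Ξ × W → E} (hH : StronglyMeasurable H) (hint : Integrable (fun ω => H (S ω, w ω)) P)
    (h0 : ∀ ω, ∫ ω', H (ξ ω', w ω) ∂P = 0) :
    P[fun ω => H (S ω, w ω) | 𝒢] =ᵐ[P] 0 := by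
  refine (ae_eq_condExp_of_forall_setIntegral_eq h𝒢 hint (fun _ _ _ => integrableOn_zero)
    (fun s hs _ => ?_) stronglyMeasurable_zero.aestronglyMeasurable).symm
  have hw' : Measurable[𝒢] fun ω => (w ω, s.indicator (fun _ => (1 : ℝ)) ω) :=
    hw.prodMk (measurable_const.indicator hs)
  have hind' : IndepFun S (fun ω => (w ω, s.indicator (fun _ => (1 : ℝ)) ω)) P :=
    indep_of_indep_of_le_right hind hw'.comap_le
  have e : ∀ ω, s.indicator (fun ω => H (S ω, w ω)) ω =
      (fun p : Ξ × W × ℝ => p.2.2 • H (p.1, p.2.1))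
        (S ω, (w ω, s.indicator (fun _ => (1 : ℝ)) ω)) := by
    intro ω
    by_cases h : ω ∈ s <;> simp [h]
  have hHm : StronglyMeasurable fun p : Ξ × W × ℝ => p.2.2 • H (p.1, p.2.1) :=
    (measurable_snd.comp measurable_snd).stronglyMeasurable.smul
      (hH.comp_measurable (measurable_fst.prodMk (measurable_fst.comp measurable_snd)))
  have hint' := hint.indicator (h𝒢 s hs)
  rw [← integral_indicator (h𝒢 s hs), ← integral_indicator (h𝒢 s hs)]
  rw [integral_congr_ae (ae_of_all _ e)]
  rw [integral_comp_fresh (w := fun ω => (w ω, s.indicator (fun _ => (1 : ℝ)) ω)) hS hξ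
    (hw'.mono h𝒢 le_rfl) hind' hid hHm (hint'.congr (ae_of_all _ e))]
  simp only [integral_smul, h0, smul_zero]
  simp

end Fresh

end StochExtragradient

/-! ### The samples of the algorithm and their history -/

namespace StochExtragradient

/-- The projection of a vector to the blocks `i'` with `g i' = i`. -/
noncomputable def blk {m : ℕ} {n : Fin m → ℕ} (g : Fin m → Fin m) (i : Fin m) :
    Space n →L[ℝ] Space n :=
  LinearMap.toContinuousLinearMap
    { toFun := fun v => WithLp.toLp 2 fun i' => if g i' = i then v i' else 0
      map_add' := fun v w => by
        ext i' l
        by_cases h : g i' = i <;> simp [h]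
      map_smul' := fun c v => by
        ext i' l
        by_cases h : g i' = i <;> simp [h] }

theorem blk_apply {m : ℕ} {n : Fin m → ℕ} (g : Fin m → Fin m) (i : Fin m) (v : Space n)
    (i' : Fin m) : blk g i v i' = if g i' = i then v i' else 0 := rfl

theorem norm_blk_sq {m : ℕ} {n : Fin m → ℕ} (g : Fin m → Fin m) (i : Fin m) (v : Space n) :
    ‖blk g i v‖ ^ 2 = ∑ i', if g i' = i then ‖v i'‖ ^ 2 else 0 := by
  rw [PiLp.norm_sq_eq_of_L2]
  refine Finset.sum_congr rfl fun i' _ => ?_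
  rw [blk_apply]
  by_cases h : g i' = i <;> simp [h]

theorem norm_blk_le {m : ℕ} {n : Fin m → ℕ} (g : Fin m → Fin m) (i : Fin m) (v : Space n) :
    ‖blk g i v‖ ≤ ‖v‖ := by
  refine (pow_le_pow_iff_left₀ (norm_nonneg _) (norm_nonneg _) two_ne_zero).1 ?_
  rw [norm_blk_sq, PiLp.norm_sq_eq_of_L2]
  refine Finset.sum_le_sum fun i' _ => ?_
  by_cases h : g i' = i <;> simp [h]

namespace Data

variable {m : ℕ} {n : Fin m → ℕ} {Ω : Type u} {Ξ : Type v} (D : Data n Ω Ξ)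

/-- The projection onto the feasible set, block by block. -/
noncomputable def projX (x : Space n) : Space n := WithLp.toLp 2 fun i => proj (D.block i) (x i)

/-- The average of the operator over the samples `s` of iteration `k`. -/
noncomputable def est (k : ℕ) (s : Fin m → ℕ → Ξ) (w : Space n) : Space n :=
  WithLp.toLp 2 fun i => (D.N k i : ℝ)⁻¹ • ∑ j ∈ Finset.range (D.N k i), D.F (s i j) w i

theorem step_eq (k : ℕ) (s : Fin m → ℕ → Ξ) (x w : Space n) :
    D.step k s x w = D.projX (x - D.α k • D.est k s w) := by
  simp only [step, projX, est]
  congr 1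
  funext i
  simp [smul_smul, div_eq_mul_inv]

/-- The points at which the operator is sampled: `x^k` in the first projection of iteration `k` and
`z^k` in the second one. -/
noncomputable def pt (b : Bool) (k : ℕ) (ω : Ω) : Space n :=
  if b then D.x k ω else D.mid k ω (D.x k ω)

/-- The oracle error of a projection step. -/
noncomputable def err [MeasurableSpace Ω] (P : Measure Ω) (b : Bool) (k : ℕ) (ω : Ω) : Space n :=
  D.est k (fun i j => D.sample b k i j ω) (D.pt b k ω) - D.T P (D.pt b k ω)

variable (g : Fin m → Fin m)

/-- The indices `(b, k, i, j)` of the samples, one agent `i = g i` for each group of agents that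
share their samples. -/
abbrev Idx : Type :=
  {a : Bool × ℕ × Fin m × ℕ // g a.2.2.1 = a.2.2.1 ∧ a.2.2.2 < D.N a.2.1 a.2.2.1}

variable {D g} in
/-- The order in which the samples are drawn: the projection steps are numbered consecutively. -/
def Idx.stage (a : D.Idx g) : ℕ := 2 * a.1.2.1 + if a.1.1 then 0 else 1

variable {D g} in
/-- The sample with a given index. -/
def Idx.smp (a : D.Idx g) : Ω → Ξ := D.sample a.1.1 a.1.2.1 a.1.2.2.1 a.1.2.2.2

/-- The information contained in the samples of the first `t` projection steps. -/
abbrev hist [MeasurableSpace Ξ] (t : ℕ) : MeasurableSpace Ω :=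
  ⨆ a ∈ {a : D.Idx g | a.stage < t}, MeasurableSpace.comap a.smp inferInstance

/-- Standing assumptions with a Carathéodory map that is continuous in the second variable for
every value of the first one. The map `g` sends an agent to the representative of its group: agents
of the same group share their samples. -/
structure Regular [MeasurableSpace Ω] [MeasurableSpace Ξ] (P : Measure Ω) : Prop where
  nonempty : D.X.Nonempty
  model : D.StochasticModel P
  continuousOn : ∀ s, ContinuousOn (D.F s) D.X
  continuousOn_T : ContinuousOn (D.T P) D.X
  N_pos : ∀ k i, 0 < D.N k i
  measurable : ∀ b k i j, j < D.N k i → Measurable (D.sample b k i j)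
  identDistrib : ∀ b k i j, j < D.N k i → IdentDistrib (D.sample b k i j) D.ξ P P
  idem : ∀ i, g (g i) = g i
  N_rep : ∀ k i, D.N k (g i) = D.N k i
  sample_rep : ∀ b k i j, j < D.N k i → D.sample b k (g i) j = D.sample b k i j
  indep : iIndepFun (fun a : D.Idx g => a.smp) P

variable {D g}

section Measurability

variable [MeasurableSpace Ω] [MeasurableSpace Ξ] {P : Measure Ω} (hR : D.Regular g P)

include hR

theorem Regular.isProj (u : Space n) : IsProj D.X u (D.projX u) := by
  obtain ⟨x₁, hx₁⟩ := hR.nonempty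
  have h := fun i => isProj_proj ⟨_, hx₁ i⟩ (hR.model.isClosed i) (hR.model.convex i) (u i)
  refine ⟨fun i => (h i).1, fun w hw => ?_⟩
  rw [PiLp.inner_apply]
  exact Finset.sum_nonpos fun i _ => (h i).2 (w i) (hw i)

theorem Regular.continuous_projX : Continuous D.projX := continuous_of_isProj hR.isProj

theorem Regular.projX_eq {x : Space n} (hx : x ∈ D.X) : D.projX x = x := by
  have := (hR.isProj x).norm_sub_le (isProj_self hx)
  rw [sub_self, norm_zero] at this
  exact sub_eq_zero.1 (norm_le_zero_iff.1 this)

theorem Regular.measurable_F_projX :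
    Measurable fun p : Ξ × Space n => D.F p.1 (D.projX p.2) := by
  have h := measurable_uncurry_of_continuous_of_measurable
    (u := fun (x : Space n) (s : Ξ) => D.F s (D.projX x))
    (fun s => (hR.continuousOn s).comp_continuous hR.continuous_projX fun x => (hR.isProj x).1)
    (fun x => hR.model.measurable_F _ (hR.isProj x).1)
  exact h.comp measurable_swap

theorem Regular.continuous_T_projX : Continuous fun x : Space n => D.T P (D.projX x) :=
  hR.continuousOn_T.comp_continuous hR.continuous_projX fun x => (hR.isProj x).1

theorem Regular.measurable_F_comp {Ω' : Type*} [MeasurableSpace Ω'] {S : Ω' → Ξ}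
    {w : Ω' → Space n} (hS : Measurable S) (hw : Measurable w) (hwX : ∀ ω, w ω ∈ D.X) :
    Measurable fun ω => D.F (S ω) (w ω) := by
  have := hR.measurable_F_projX.comp (hS.prodMk hw)
  have e : (fun ω => D.F (S ω) (w ω)) =
      (fun p : Ξ × Space n => D.F p.1 (D.projX p.2)) ∘ fun ω => (S ω, w ω) := by
    funext ω
    simp [hR.projX_eq (hwX ω)]
  rw [e]; exact this

theorem Regular.measurable_step {Ω' : Type*} [MeasurableSpace Ω'] (k : ℕ)
    {s : Ω' → Fin m → ℕ → Ξ} {x w : Ω' → Space n} (hx : Measurable x)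
    (hF : ∀ i j, j < D.N k i → Measurable fun ω => D.F (s ω i j) (w ω)) :
    Measurable fun ω => D.step k (s ω) (x ω) (w ω) := by
  simp only [step_eq]
  have hest : Measurable fun ω => D.est k (s ω) (w ω) := by
    refine (WithLp.measurable_toLp 2 _).comp (measurable_pi_lambda _ fun i => ?_)
    have hsum : Measurable fun ω => ∑ j ∈ Finset.range (D.N k i), D.F (s ω i j) (w ω) i := by
      refine Finset.measurable_fun_sum _ fun j hj => ?_
      have h2 : Measurable fun x : Space n => x i := by fun_prop
      exact h2.comp (hF i j (Finset.mem_range.1 hj))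
    exact hsum.const_smul (D.N k i : ℝ)⁻¹
  have hest' : Measurable fun ω => D.α k • D.est k (s ω) (w ω) := hest.const_smul (D.α k)
  exact hR.continuous_projX.measurable.comp (hx.sub hest')

theorem Regular.mid_mem (k : ℕ) (ω : Ω) (x : Space n) : D.mid k ω x ∈ D.X := by
  rw [mid, step_eq]; exact (hR.isProj _).1

theorem Regular.x_mem {k : ℕ} (hk : D.x₀ ∈ D.X ∨ 1 ≤ k) (ω : Ω) : D.x k ω ∈ D.X := by
  cases k with
  | zero => simpa [x] using hk
  | succ k => rw [x, step_eq]; exact (hR.isProj _).1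

theorem Regular.measurable_sample_hist {b : Bool} {k : ℕ} {i : Fin m} {j t : ℕ} (hj : j < D.N k i)
    (ht : 2 * k + (if b then 0 else 1) < t) : Measurable[D.hist g t] (D.sample b k i j) := by
  rw [← hR.sample_rep b k i j hj]
  let a : D.Idx g := ⟨(b, k, g i, j), hR.idem i, by simpa [hR.N_rep] using hj⟩
  have h1 : Measurable[MeasurableSpace.comap a.smp inferInstance] a.smp := comap_measurable _
  refine h1.mono ?_ le_rfl
  exact le_biSup (fun a : D.Idx g => MeasurableSpace.comap a.smp inferInstance)
    (show a ∈ {a : D.Idx g | a.stage < t} from ht)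

/-- The iterate `x^k` is determined by the samples of the first `2 k` projection steps, the
intermediate point `z^k` by those of the first `2 k + 1` steps. -/
theorem Regular.measurable_hist (k : ℕ) :
    Measurable[D.hist g (2 * k)] (D.x k) ∧
      Measurable[D.hist g (2 * k + 1)] fun ω => D.mid k ω (D.x k ω) := by
  have hmono : ∀ {s t : ℕ}, s ≤ t → D.hist g s ≤ D.hist g t := fun h =>
    biSup_mono fun a ha => lt_of_lt_of_le ha h
  have hmid : ∀ k, Measurable[D.hist g (2 * k)] (D.x k) →
      Measurable[D.hist g (2 * k + 1)] fun ω => D.mid k ω (D.x k ω) := by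
    intro k hk
    have hk' := hk.mono (hmono (Nat.le_succ (2 * k))) le_rfl
    refine @Regular.measurable_step _ _ _ _ _ _ _ _ _ hR Ω (D.hist g (2 * k + 1)) k
      (fun ω i j => D.sampleξ k i j ω) _ _ hk' fun i j hj => ?_
    have hs : Measurable[D.hist g (2 * k + 1)] (D.sampleξ k i j) :=
      hR.measurable_sample_hist (b := true) hj (by simp)
    by_cases h : D.x₀ ∈ D.X ∨ 1 ≤ k
    · exact @Regular.measurable_F_comp _ _ _ _ _ _ _ _ _ hR Ω (D.hist g (2 * k + 1)) _ _
        hs hk' (hR.x_mem h)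
    · have : k = 0 := by omega
      subst this
      exact hR.model.measurable_F_init.comp hs
  have hx : ∀ k, Measurable[D.hist g (2 * k)] (D.x k) := by
    intro k
    induction k with
    | zero => exact measurable_const
    | succ k ih =>
      have h1 := ih.mono (hmono (show 2 * k ≤ 2 * (k + 1) by omega)) le_rfl
      have h2 := (hmid k ih).mono (hmono (show 2 * k + 1 ≤ 2 * (k + 1) by omega)) le_rfl
      refine @Regular.measurable_step _ _ _ _ _ _ _ _ _ hR Ω (D.hist g (2 * (k + 1))) k
        (fun ω i j => D.sampleη k i j ω) _ _ h1 fun i j hj => ?_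
      have hs : Measurable[D.hist g (2 * (k + 1))] (D.sampleη k i j) :=
        hR.measurable_sample_hist (b := false) hj (by simp; omega)
      exact @Regular.measurable_F_comp _ _ _ _ _ _ _ _ _ hR Ω (D.hist g (2 * (k + 1))) _ _
        hs h2 fun ω => hR.mid_mem k ω _
  exact ⟨hx k, hmid k (hx k)⟩

theorem Regular.measurable_smp (a : D.Idx g) : Measurable a.smp :=
  hR.measurable _ _ _ _ a.2.2

theorem Regular.hist_le (t : ℕ) : D.hist g t ≤ (inferInstance : MeasurableSpace Ω) :=
  iSup₂_le fun a _ => (hR.measurable_smp a).comap_le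

theorem Regular.measurable_pt (b : Bool) (k : ℕ) :
    Measurable[D.hist g (2 * k + if b then 0 else 1)] (D.pt b k) := by
  cases b
  · exact (hR.measurable_hist k).2
  · exact (hR.measurable_hist k).1

end Measurability

end Data

end StochExtragradient

/-! ### Moments of the oracle errors -/

namespace StochExtragradient
namespace Data

variable {m : ℕ} {n : Fin m → ℕ} {Ω : Type u} {Ξ : Type v} (D : Data n Ω Ξ) (g : Fin m → Fin m)

/-- The indices of the samples of the first `K` iterations. -/
def idxs (K : ℕ) : Finset (D.Idx g) :=
  Finset.subtype _ ((Finset.univ : Finset Bool) ×ˢ Finset.range K ×ˢ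
    (Finset.univ : Finset (Fin m)) ×ˢ Finset.range (∑ k ∈ Finset.range K, ∑ i, D.N k i))

variable {D g}

theorem N_le_sum {K k : ℕ} (hk : k < K) (i : Fin m) :
    D.N k i ≤ ∑ k ∈ Finset.range K, ∑ i, D.N k i :=
  (Finset.single_le_sum (f := D.N k) (fun _ _ => Nat.zero_le _) (Finset.mem_univ i)).trans
    (Finset.single_le_sum (f := fun k => ∑ i, D.N k i) (fun _ _ => Nat.zero_le _)
      (Finset.mem_range.2 hk))

theorem mem_idxs {K : ℕ} {a : D.Idx g} : a ∈ D.idxs g K ↔ a.1.2.1 < K := by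
  simp only [idxs, Finset.mem_subtype, Finset.mem_product, Finset.mem_univ, Finset.mem_range,
    true_and]
  exact ⟨fun h => h.1, fun h => ⟨h, a.2.2.trans_le (N_le_sum h _)⟩⟩

theorem sum_idxs {M : Type*} [AddCommMonoid M] (K : ℕ) {f' : D.Idx g → M}
    (f : Bool → ℕ → Fin m → ℕ → M) (hf : ∀ a, f' a = f a.1.1 a.1.2.1 a.1.2.2.1 a.1.2.2.2) :
    ∑ a ∈ D.idxs g K, f' a =
      ∑ b, ∑ k ∈ Finset.range K, ∑ i, if g i = i then ∑ j ∈ Finset.range (D.N k i), f b k i j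
        else 0 := by
  rw [Finset.sum_congr rfl fun a _ => hf a, idxs, Finset.sum_subtype_eq_sum_filter
    (f := fun a : Bool × ℕ × Fin m × ℕ => f a.1 a.2.1 a.2.2.1 a.2.2.2), Finset.sum_filter,
    Finset.sum_product]
  refine Finset.sum_congr rfl fun b _ => ?_
  rw [Finset.sum_product]
  refine Finset.sum_congr rfl fun k hk => ?_
  rw [Finset.sum_product]
  refine Finset.sum_congr rfl fun i _ => ?_
  by_cases h : g i = i
  · simp only [h, true_and, if_true]
    rw [← Finset.sum_filter]
    refine Finset.sum_congr ?_ fun _ _ => rfl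
    ext j
    simp only [Finset.mem_filter, Finset.mem_range]
    exact ⟨fun h => h.2, fun h => ⟨h.trans_le (N_le_sum (Finset.mem_range.1 hk) i), h⟩⟩
  · simp [h]

variable [MeasurableSpace Ω] [MeasurableSpace Ξ] {P : Measure Ω}

variable (D P) in
/-- The centered random operator, composed with the projection onto the feasible set. -/
noncomputable def cent (p : Ξ × Space n) : Space n :=
  D.F p.1 (D.projX p.2) - D.T P (D.projX p.2)

section

variable (hR : D.Regular g P)

include hR

theorem Regular.measurable_cent : Measurable (D.cent P) :=
  hR.measurable_F_projX.sub (hR.continuous_T_projX.measurable.comp measurable_snd)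

theorem Regular.err_eq_sum {b : Bool} {k : ℕ} {ω : Ω} (h : D.pt b k ω ∈ D.X) :
    D.err P b k ω = ∑ i, if g i = i then ∑ j ∈ Finset.range (D.N k i),
      (D.N k i : ℝ)⁻¹ • blk g i (D.cent P (D.sample b k i j ω, D.pt b k ω)) else 0 := by
  have hc : ∀ s, D.cent P (s, D.pt b k ω) = D.F s (D.pt b k ω) - D.T P (D.pt b k ω) := fun s => by
    simp [cent, hR.projX_eq h]
  simp only [hc]
  ext1 i'
  have e : (∑ i, if g i = i then ∑ j ∈ Finset.range (D.N k i), (D.N k i : ℝ)⁻¹ •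
      blk g i (D.F (D.sample b k i j ω) (D.pt b k ω) - D.T P (D.pt b k ω)) else 0) i' =
      ∑ i, if g i' = i then ∑ j ∈ Finset.range (D.N k i), (D.N k i : ℝ)⁻¹ •
        (D.F (D.sample b k i j ω) (D.pt b k ω) i' - D.T P (D.pt b k ω) i') else 0 := by
    rw [WithLp.ofLp_sum, Finset.sum_apply]
    refine Finset.sum_congr rfl fun i _ => ?_
    by_cases h1 : g i = i
    · rw [if_pos h1, WithLp.ofLp_sum, Finset.sum_apply]
      simp only [PiLp.smul_apply, blk_apply]
      by_cases h2 : g i' = i <;> simp [h2]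
    · have h2 : g i' ≠ i := fun h2 => h1 (by rw [← h2]; exact hR.idem i')
      simp [h1, h2]
  rw [e, Finset.sum_ite_eq, if_pos (Finset.mem_univ _), hR.N_rep]
  have hN : (D.N k i' : ℝ) ≠ 0 := by exact_mod_cast (hR.N_pos k i').ne'
  have e2 : D.err P b k ω i' = (D.N k i' : ℝ)⁻¹ • ∑ j ∈ Finset.range (D.N k i'),
      D.F (D.sample b k i' j ω) (D.pt b k ω) i' - D.T P (D.pt b k ω) i' := rfl
  rw [e2, ← Finset.smul_sum, Finset.sum_sub_distrib, smul_sub, Finset.sum_const,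
    Finset.card_range, ← Nat.cast_smul_eq_nsmul ℝ, smul_smul, inv_mul_cancel₀ hN, one_smul]
  congr 2
  refine Finset.sum_congr rfl fun j hj => ?_
  rw [hR.sample_rep b k i' j (Finset.mem_range.1 hj)]

theorem Regular.indep_smp (a : D.Idx g) {t : Set (D.Idx g)} (ha : a ∉ t) :
    Indep (MeasurableSpace.comap a.smp inferInstance)
      (⨆ a' ∈ t, MeasurableSpace.comap a'.smp inferInstance) P := by
  have := indep_iSup_of_disjoint (fun a : D.Idx g => (hR.measurable_smp a).comap_le)
    ((iIndepFun_iff_iIndep ..).1 hR.indep) (S := {a}) (T := t) (by simpa using ha)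
  simpa using this

theorem Regular.indep_smp_hist (a : D.Idx g) :
    Indep (MeasurableSpace.comap a.smp inferInstance) (D.hist g a.stage) P :=
  hR.indep_smp a (t := {a' | a'.stage < a.stage}) (by simp)

theorem Regular.identDistrib_smp (a : D.Idx g) : IdentDistrib a.smp D.ξ P P :=
  hR.identDistrib _ _ _ _ a.2.2

variable [IsProbabilityMeasure P]

theorem Regular.integral_cent (w : Space n) : ∫ ω, D.cent P (D.ξ ω, w) ∂P = 0 := by
  have hi := hR.model.integrable _ (hR.isProj w).1
  simp only [cent]
  rw [integral_sub hi (integrable_const _), integral_const]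
  simp [T]

theorem Regular.integrable_cent (w : Space n) : Integrable (fun ω => D.cent P (D.ξ ω, w)) P :=
  (hR.model.integrable _ (hR.isProj w).1).sub (integrable_const (D.T P (D.projX w)))

/-- Moments of a sum of increments, each of which is a centered random field evaluated at a sample
and at a point determined by the samples of the earlier projection steps. -/
theorem Regular.eLpNorm_sum_smp_le {q : ℝ} (hq : 2 ≤ q) {E : Type*} [NormedAddCommGroup E]
    [InnerProductSpace ℝ E] [FiniteDimensional ℝ E] [MeasurableSpace E] [BorelSpace E]
    {𝒲 : Type*} [MeasurableSpace 𝒲] (K : ℕ) (W : D.Idx g → Ω → 𝒲)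
    (hW : ∀ a, Measurable[D.hist g a.stage] (W a)) (H : D.Idx g → Ξ × 𝒲 → E)
    (hH : ∀ a, Measurable (H a))
    (h0 : ∀ a ω, ∫ ω', H a (D.ξ ω', W a ω) ∂P = 0) (φ : D.Idx g → 𝒲 → ℝ)
    (hφ : ∀ a ∈ D.idxs g K, ∀ ω, eLpNorm (fun ω' => H a (D.ξ ω', W a ω)) (ENNReal.ofReal q) P ≤
      ENNReal.ofReal (φ a (W a ω))) (b : D.Idx g → ℝ)
    (hb : ∀ a ∈ D.idxs g K, eLpNorm (fun ω => φ a (W a ω)) (ENNReal.ofReal q) P ≤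
      ENNReal.ofReal (b a)) :
    eLpNorm (fun ω => ∑ a ∈ D.idxs g K, H a (a.smp ω, W a ω)) (ENNReal.ofReal q) P ≤
      ENNReal.ofReal (bdgConst.{u} q * √(∑ a ∈ D.idxs g K, b a ^ 2)) := by
  have : CompleteSpace E := FiniteDimensional.complete ℝ E
  have hWm : ∀ a, Measurable (W a) := fun a => (hW a).mono (hR.hist_le _) le_rfl
  have hfr : ∀ a, IndepFun a.smp (W a) P := fun a =>
    indep_of_indep_of_le_right (hR.indep_smp_hist a) (hW a).comap_le
  have hdb : ∀ a ∈ D.idxs g K,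
      eLpNorm (fun ω => H a (a.smp ω, W a ω)) (ENNReal.ofReal q) P ≤ ENNReal.ofReal (b a) :=
    fun a ha => (eLpNorm_comp_fresh_le (hR.measurable_smp a) hR.model.measurable_ξ (hWm a) (hfr a)
      (hR.identDistrib_smp a) (by linarith) (hH a) (hφ a ha)).trans (hb a ha)
  have hdm : ∀ a, StronglyMeasurable[D.hist g a.stage ⊔ MeasurableSpace.comap a.smp inferInstance]
      (fun ω => H a (a.smp ω, W a ω)) := fun a => by
    have h1 : Measurable[D.hist g a.stage ⊔ MeasurableSpace.comap a.smp inferInstance] a.smp :=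
      (comap_measurable a.smp).mono le_sup_right le_rfl
    have h2 : Measurable[D.hist g a.stage ⊔ MeasurableSpace.comap a.smp inferInstance] (W a) :=
      (hW a).mono le_sup_left le_rfl
    exact ((hH a).comp (h1.prodMk h2)).stronglyMeasurable
  have key := eLpNorm_sum_le_bdgConst (μ := P) hq
    (fun a : D.Idx g => MeasurableSpace.comap a.smp inferInstance)
    (fun a => (hR.measurable_smp a).comap_le) Idx.stage (D.idxs g K)
    (fun a ha a' h => by
      rw [mem_idxs] at ha ⊢
      simp only [Idx.stage] at h
      split_ifs at h <;> omega)
    (fun a ω => H a (a.smp ω, W a ω)) (fun a _ => hdm a)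
    (fun a ha t hat ht => by
      have hle : (⨆ a' ∈ t, MeasurableSpace.comap a'.smp inferInstance) ≤
          (inferInstance : MeasurableSpace Ω) := iSup₂_le fun a _ => (hR.measurable_smp a).comap_le
      refine condExp_comp_fresh_eq_zero hle (hR.measurable_smp a) hR.model.measurable_ξ
        ((hW a).mono (biSup_mono fun a' ha' => ht ha') le_rfl) (hR.indep_smp a hat)
        (hR.identDistrib_smp a) (hH a).stronglyMeasurable ?_ (h0 a)
      have h1 : MemLp (fun ω => H a (a.smp ω, W a ω)) (ENNReal.ofReal q) P :=
        ⟨((hH a).comp ((hR.measurable_smp a).prodMk (hWm a))).aestronglyMeasurable,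
          (hdb a ha).trans_lt ENNReal.ofReal_lt_top⟩
      refine h1.integrable ?_
      rw [← ENNReal.ofReal_one]; exact ENNReal.ofReal_le_ofReal (by linarith)) b hdb
  refine le_of_eq_of_le ?_ key
  congr 1
  funext ω
  simp [Finset.sum_apply]

/-- Moments of the oracle error of one projection step. The oracle error of the group of agents
represented by `i` is averaged over `N k i` samples. -/
theorem Regular.eLpNorm_err_le {p : ℝ} (hp : 2 ≤ p) (b : Bool) (k : ℕ)
    (hpt : ∀ ω, D.pt b k ω ∈ D.X) {xs : Ω → Space n} (hxs : Measurable[D.hist g (2 * k)] xs)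
    (τ : Fin m → ℝ) (φ : Space n × Space n → ℝ)
    (hφ : ∀ i ω, g i = i → eLpNorm (fun ω' => blk g i (D.F (D.ξ ω') (D.pt b k ω) -
      D.T P (D.pt b k ω))) (ENNReal.ofReal p) P ≤ ENNReal.ofReal (τ i * φ (D.pt b k ω, xs ω)))
    {B : ℝ} (hB : eLpNorm (fun ω => φ (D.pt b k ω, xs ω)) (ENNReal.ofReal p) P ≤
      ENNReal.ofReal B) (hB0 : 0 ≤ B) (hτ : ∀ i, 0 ≤ τ i) :
    eLpNorm (D.err P b k) (ENNReal.ofReal p) P ≤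
      ENNReal.ofReal (bdgConst.{u} p *
        (√(∑ i, if g i = i then τ i ^ 2 / (D.N k i : ℝ) else 0) * B)) := by
  classical
  -- only the samples of the projection step `(b, k)` contribute
  set W : D.Idx g → Ω → Space n × Space n :=
    fun a ω => if a.1.1 = b ∧ a.1.2.1 = k then (D.pt b k ω, xs ω) else 0 with hW
  set H : D.Idx g → Ξ × (Space n × Space n) → Space n := fun a p =>
    if a.1.1 = b ∧ a.1.2.1 = k then
      (D.N k a.1.2.2.1 : ℝ)⁻¹ • blk g a.1.2.2.1 (D.cent P (p.1, p.2.1)) else 0 with hH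
  set ψ : D.Idx g → Space n × Space n → ℝ := fun a w => if a.1.1 = b ∧ a.1.2.1 = k then
      (D.N k a.1.2.2.1 : ℝ)⁻¹ * τ a.1.2.2.1 * φ w else 0 with hψ
  have key := hR.eLpNorm_sum_smp_le hp (k + 1) W ?_ H ?_ ?_ ψ ?_
    (fun a => if a.1.1 = b ∧ a.1.2.1 = k then (D.N k a.1.2.2.1 : ℝ)⁻¹ * τ a.1.2.2.1 * B else 0) ?_
  · have e1 : (fun ω => ∑ a ∈ D.idxs g (k + 1), H a (a.smp ω, W a ω)) = D.err P b k := by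
      funext ω
      rw [hR.err_eq_sum (hpt ω)]
      have e2 : ∀ a : D.Idx g, H a (a.smp ω, W a ω) =
          (fun b' k' i j => if b' = b ∧ k' = k then (D.N k i : ℝ)⁻¹ •
            blk g i (D.cent P (D.sample b k i j ω, D.pt b k ω)) else 0)
            a.1.1 a.1.2.1 a.1.2.2.1 a.1.2.2.2 := by
        intro a
        by_cases h : a.1.1 = b ∧ a.1.2.1 = k
        · simp only [hH, hW, if_pos h, Idx.smp, h.1, h.2, and_self, if_true]
        · simp only [hH, if_neg h]
      rw [sum_idxs (k + 1) (fun b' k' i j => if b' = b ∧ k' = k then (D.N k i : ℝ)⁻¹ •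
          blk g i (D.cent P (D.sample b k i j ω, D.pt b k ω)) else 0) e2,
        Finset.sum_eq_single b (fun b' _ hb' => by simp [hb']) (by simp),
        Finset.sum_eq_single k (fun k' _ hk' => by simp [hk']) (by simp)]
      simp
    rw [e1] at key
    refine key.trans (ENNReal.ofReal_le_ofReal (mul_le_mul_of_nonneg_left ?_ (bdgConst_nonneg _)))
    have e3 : ∀ a : D.Idx g, (if a.1.1 = b ∧ a.1.2.1 = k then
          (D.N k a.1.2.2.1 : ℝ)⁻¹ * τ a.1.2.2.1 * B else 0) ^ 2 =
        (fun b' k' i (_ : ℕ) => if b' = b ∧ k' = k then ((D.N k i : ℝ)⁻¹ * τ i * B) ^ 2 else 0)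
          a.1.1 a.1.2.1 a.1.2.2.1 a.1.2.2.2 := by
      intro a
      by_cases h : a.1.1 = b ∧ a.1.2.1 = k <;> simp [h]
    rw [sum_idxs (k + 1) (fun b' k' i _ => if b' = b ∧ k' = k then
          ((D.N k i : ℝ)⁻¹ * τ i * B) ^ 2 else 0) e3,
        Finset.sum_eq_single b (fun b' _ hb' => by simp [hb']) (by simp),
        Finset.sum_eq_single k (fun k' _ hk' => by simp [hk']) (by simp)]
    refine Real.sqrt_le_iff.2 ⟨by positivity, ?_⟩
    rw [mul_pow, Real.sq_sqrt (Finset.sum_nonneg fun i _ => by split_ifs <;> positivity),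
      Finset.sum_mul]
    refine le_of_eq (Finset.sum_congr rfl fun i _ => ?_)
    by_cases h : g i = i
    · have hN : (D.N k i : ℝ) ≠ 0 := by exact_mod_cast (hR.N_pos k i).ne'
      simp only [h, and_self, if_true, Finset.sum_const, Finset.card_range, nsmul_eq_mul]
      field_simp
    · simp [h]
  · intro a
    by_cases h : a.1.1 = b ∧ a.1.2.1 = k
    · simp only [hW, if_pos h]
      have h1 : Measurable[D.hist g a.stage] (D.pt b k) := by
        have := hR.measurable_pt b k
        rwa [← h.1, ← h.2] at this ⊢
      have h2 : Measurable[D.hist g a.stage] xs := by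
        refine hxs.mono (biSup_mono fun a' ha' => ?_) le_rfl
        have : a'.stage < 2 * k := ha'
        simp only [Idx.stage, Set.mem_ofPred_eq, h.2] at this ⊢
        omega
      exact h1.prodMk h2
    · simp only [hW, if_neg h]
      exact measurable_const
  · intro a
    by_cases h : a.1.1 = b ∧ a.1.2.1 = k
    · simp only [hH, if_pos h]
      have h1 := hR.measurable_cent.comp
        (measurable_fst.prodMk (measurable_fst.comp measurable_snd) :
          Measurable fun p : Ξ × Space n × Space n => (p.1, p.2.1))
      have h2 := (blk (n := n) g a.1.2.2.1).continuous.measurable.comp h1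
      exact h2.const_smul (D.N k a.1.2.2.1 : ℝ)⁻¹
    · simp only [hH, if_neg h]
      exact measurable_const
  · intro a ω
    by_cases h : a.1.1 = b ∧ a.1.2.1 = k
    · simp only [hH, if_pos h]
      rw [integral_smul, (blk g a.1.2.2.1).integral_comp_comm (hR.integrable_cent _),
        hR.integral_cent, map_zero, smul_zero]
    · simp [hH, if_neg h]
  · intro a ha ω
    by_cases h : a.1.1 = b ∧ a.1.2.1 = k
    · simp only [hH, hW, hψ, if_pos h, cent, hR.projX_eq (hpt ω)]
      have := hφ a.1.2.2.1 ω a.2.1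
      refine (eLpNorm_const_smul_le (c := (D.N k a.1.2.2.1 : ℝ)⁻¹)).trans ?_
      rw [mul_assoc, ENNReal.ofReal_mul (by positivity), ← ofReal_norm,
        Real.norm_of_nonneg (by positivity)]
      exact mul_le_mul_right this _
    · simp [hH, if_neg h]
  · intro a ha
    by_cases h : a.1.1 = b ∧ a.1.2.1 = k
    · simp only [hψ, hW, if_pos h]
      have := hτ a.1.2.2.1
      refine (eLpNorm_const_smul_le (c := (D.N k a.1.2.2.1 : ℝ)⁻¹ * τ a.1.2.2.1)
        (f := fun ω => φ (D.pt b k ω, xs ω))).trans ?_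
      rw [ENNReal.ofReal_mul (by positivity), ← ofReal_norm,
        Real.norm_of_nonneg (by positivity)]
      exact mul_le_mul_right hB _
    · simp [hψ, if_neg h]

end

end Data
end StochExtragradient

/-! ### One iteration of the stochastic method -/

namespace StochExtragradient

section L2

variable {Ω : Type*} {mΩ : MeasurableSpace Ω} {μ : Measure Ω} {E : Type*} [NormedAddCommGroup E]

theorem integral_norm_sq_le_of_eLpNorm_le {f : Ω → E} (hf : AEStronglyMeasurable f μ) {r : ℝ}
    (hr : 0 ≤ r) (h : eLpNorm f (ENNReal.ofReal 2) μ ≤ ENNReal.ofReal r) :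
    ∫ ω, ‖f ω‖ ^ 2 ∂μ ≤ r ^ 2 := by
  have hm : MemLp f (ENNReal.ofReal 2) μ := ⟨hf, h.trans_lt ENNReal.ofReal_lt_top⟩
  rw [hm.eLpNorm_eq_integral_rpow_norm (by simp) ENNReal.ofReal_ne_top,
    ENNReal.toReal_ofReal zero_le_two, ENNReal.ofReal_le_ofReal_iff hr] at h
  simp only [Real.rpow_two] at h
  rw [← one_div, ← Real.sqrt_eq_rpow] at h
  exact (Real.sqrt_le_left hr).1 h

theorem eLpNorm_le_of_integral_norm_sq_le {f : Ω → E} (hm : MemLp f (ENNReal.ofReal 2) μ) {r : ℝ}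
    (h : ∫ ω, ‖f ω‖ ^ 2 ∂μ ≤ r) :
    eLpNorm f (ENNReal.ofReal 2) μ ≤ ENNReal.ofReal √r := by
  rw [hm.eLpNorm_eq_integral_rpow_norm (by simp) ENNReal.ofReal_ne_top,
    ENNReal.toReal_ofReal zero_le_two]
  simp only [Real.rpow_two]
  rw [← one_div, ← Real.sqrt_eq_rpow]
  exact ENNReal.ofReal_le_ofReal (Real.sqrt_le_sqrt h)

theorem MemLp.integrable_norm_mul {F : Type*} [NormedAddCommGroup F] {f : Ω → E} {h : Ω → F}
    (hf : MemLp f (ENNReal.ofReal 2) μ) (hh : MemLp h (ENNReal.ofReal 2) μ) :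
    Integrable (fun ω => ‖f ω‖ * ‖h ω‖) μ := by
  rw [show ENNReal.ofReal 2 = 2 by simp] at hf hh
  exact hf.norm.integrable_mul hh.norm

theorem MemLp.integrable_real_inner {V : Type*} [NormedAddCommGroup V] [InnerProductSpace ℝ V]
    {f h : Ω → V} (hf : MemLp f (ENNReal.ofReal 2) μ) (hh : MemLp h (ENNReal.ofReal 2) μ) :
    Integrable (fun ω => ⟪f ω, h ω⟫) μ :=
  (MemLp.integrable_norm_mul hf hh).mono' (hf.1.inner hh.1)
    (ae_of_all _ fun _ => norm_inner_le_norm _ _)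

theorem MemLp.integrable_norm_sq' {f : Ω → E} (hf : MemLp f (ENNReal.ofReal 2) μ) :
    Integrable (fun ω => ‖f ω‖ ^ 2) μ := by
  simpa [sq] using MemLp.integrable_norm_mul hf hf

end L2

namespace Data

variable {m : ℕ} {n : Fin m → ℕ} {Ω : Type u} {Ξ : Type v} (D : Data n Ω Ξ) (g : Fin m → Fin m)

/-- The sum of the reciprocal sample sizes of the groups of agents. -/
noncomputable def repInv (k : ℕ) : ℝ := ∑ i, if g i = i then 1 / (D.N k i : ℝ) else 0

theorem repInv_nonneg (k : ℕ) : 0 ≤ D.repInv g k :=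
  Finset.sum_nonneg fun i _ => by split_ifs <;> positivity

theorem repInv_le_invN (k : ℕ) : D.repInv g k ≤ D.invN k :=
  Finset.sum_le_sum fun i _ => by
    split_ifs
    · exact le_rfl
    · positivity

variable [MeasurableSpace Ω] [MeasurableSpace Ξ] (P : Measure Ω) (L : ℝ)

/-- Regular data with a Lipschitz continuous and pseudo-monotone mean operator and admissible
stepsizes. -/
structure Admissible : Prop extends D.Regular g P where
  L_pos : 0 < L
  lipschitz : ∀ x ∈ D.X, ∀ y ∈ D.X, ‖D.T P x - D.T P y‖ ≤ L * ‖x - y‖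
  pseudoMonotone : ∀ x ∈ D.X, ∀ z ∈ D.X, 0 ≤ ⟪D.T P x, z - x⟫ → 0 ≤ ⟪D.T P z, z - x⟫
  α_pos : ∀ k, 0 < D.α k
  α_le : ∀ k, D.α k ≤ D.αhat
  αhat_lt : L * D.αhat < 1 / √6

variable {D g P L}

theorem Admissible.mul_α_lt (hA : D.Admissible g P L) (k : ℕ) : L * D.α k < 1 / √6 :=
  (mul_le_mul_of_nonneg_left (hA.α_le k) hA.L_pos.le).trans_lt hA.αhat_lt

theorem Admissible.three_mul_sq_le (hA : D.Admissible g P L) (k : ℕ) :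
    3 * (L * D.α k) ^ 2 ≤ 1 := by
  have h0 : 0 ≤ L * D.α k := mul_nonneg hA.L_pos.le (hA.α_pos k).le
  have h1 := pow_le_pow_left₀ h0 (hA.mul_α_lt k).le 2
  rw [div_pow, Real.sq_sqrt (by norm_num)] at h1
  linarith

theorem Regular.isProj_mid (hR : D.Regular g P) (k : ℕ) (ω : Ω) :
    IsProj D.X (D.x k ω - D.α k • D.est k (fun i j => D.sample true k i j ω) (D.pt true k ω))
      (D.pt false k ω) := by
  have : D.pt false k ω = D.projX
      (D.x k ω - D.α k • D.est k (fun i j => D.sample true k i j ω) (D.pt true k ω)) := by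
    simp only [pt, mid, step_eq]; rfl
  rw [this]; exact hR.isProj _

theorem Regular.isProj_succ (hR : D.Regular g P) (k : ℕ) (ω : Ω) :
    IsProj D.X (D.x k ω - D.α k • D.est k (fun i j => D.sample false k i j ω) (D.pt false k ω))
      (D.x (k + 1) ω) := by
  have : D.x (k + 1) ω = D.projX
      (D.x k ω - D.α k • D.est k (fun i j => D.sample false k i j ω) (D.pt false k ω)) := by
    simp only [pt, x, step_eq]; rfl
  rw [this]; exact hR.isProj _

theorem Admissible.sq_step (hA : D.Admissible g P L) {k : ℕ} {ω : Ω} (hx : D.x k ω ∈ D.X)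
    {y : Space n} (hy : y ∈ D.Xstar P) :
    ‖D.x (k + 1) ω - y‖ ^ 2 ≤ ‖D.x k ω - y‖ ^ 2 +
      3 * D.α k ^ 2 * (‖D.err P true k ω‖ ^ 2 + ‖D.err P false k ω‖ ^ 2) +
      2 * D.α k * ⟪D.err P false k ω, y - D.pt false k ω⟫ :=
  extragradient_step hA.lipschitz hA.pseudoMonotone (hA.α_pos k).le (hA.three_mul_sq_le k)
    hx (hA.isProj_mid k ω) (hA.isProj_succ k ω) hy

theorem Admissible.norm_mid_le (hA : D.Admissible g P L) {k : ℕ} {ω : Ω} (hx : D.x k ω ∈ D.X)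
    {y : Space n} (hy : y ∈ D.Xstar P) :
    ‖D.pt false k ω - y‖ ≤ (1 + L * D.α k) * ‖D.x k ω - y‖ + D.α k * ‖D.err P true k ω‖ :=
  norm_mid_sub_le hA.lipschitz (hA.α_pos k).le hx (hA.isProj_mid k ω) hy

theorem Admissible.norm_succ_le (hA : D.Admissible g P L) {k : ℕ} {ω : Ω}
    {y : Space n} (hy : y ∈ D.Xstar P) :
    ‖D.x (k + 1) ω - y‖ ≤ ‖D.x k ω - y‖ + D.α k * ‖D.err P false k ω‖ +
      L * D.α k * ‖D.pt false k ω - y‖ :=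
  norm_next_sub_le hA.lipschitz (hA.α_pos k).le (hA.isProj_mid k ω).1 (hA.isProj_succ k ω) hy

section Measurability

variable (hR : D.Regular g P)

include hR

theorem Regular.measurable_x (k : ℕ) : Measurable (D.x k) :=
  (hR.measurable_hist k).1.mono (hR.hist_le _) le_rfl

theorem Regular.measurable_pt' (b : Bool) (k : ℕ) : Measurable (D.pt b k) :=
  (hR.measurable_pt b k).mono (hR.hist_le _) le_rfl

theorem Regular.measurable_err {b : Bool} {k : ℕ} (h : ∀ ω, D.pt b k ω ∈ D.X) :
    Measurable (D.err P b k) := by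
  have e : D.err P b k = fun ω => ∑ i, if g i = i then ∑ j ∈ Finset.range (D.N k i),
      (D.N k i : ℝ)⁻¹ • blk g i (D.cent P (D.sample b k i j ω, D.pt b k ω)) else 0 :=
    funext fun ω => hR.err_eq_sum (h ω)
  rw [e]
  refine Finset.measurable_fun_sum _ fun i _ => ?_
  by_cases hi : g i = i
  · simp only [if_pos hi]
    refine Finset.measurable_fun_sum _ fun j hj => ?_
    have h1 := hR.measurable_cent.comp
      ((hR.measurable b k i j (Finset.mem_range.1 hj)).prodMk (hR.measurable_pt' b k))
    have h2 := (blk (n := n) g i).continuous.measurable.comp h1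
    exact h2.const_smul (D.N k i : ℝ)⁻¹
  · simp only [if_neg hi]
    exact measurable_const

variable [IsProbabilityMeasure P]

/-- The oracle error of the second projection step is orthogonal to the past. -/
theorem Regular.integral_inner_err_eq_zero {k : ℕ} {xs y : Ω → Space n}
    (hxs : Measurable[D.hist g (2 * k + 1)] xs) (hy : Measurable[D.hist g (2 * k + 1)] y)
    (hyL : MemLp y (ENNReal.ofReal 2) P)
    {φ : Space n × Space n → ℝ}
    (hφ : ∀ ω, eLpNorm (fun ω' => D.F (D.ξ ω') (D.pt false k ω) - D.T P (D.pt false k ω))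
      (ENNReal.ofReal 2) P ≤ ENNReal.ofReal (φ (D.pt false k ω, xs ω)))
    (hφL : eLpNorm (fun ω => φ (D.pt false k ω, xs ω)) (ENNReal.ofReal 2) P < ∞) :
    ∫ ω, ⟪D.err P false k ω, y ω⟫ ∂P = 0 := by
  have hz : ∀ ω, D.pt false k ω ∈ D.X := fun ω => (hR.isProj_mid k ω).1
  have hzm : Measurable[D.hist g (2 * k + 1)] (D.pt false k) := hR.measurable_pt false k
  have hzm' := hR.measurable_pt' false k
  set S : Fin m → ℕ → Ω → Space n := fun i j ω =>
    blk g i (D.cent P (D.sample false k i j ω, D.pt false k ω)) with hS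
  have hterm : ∀ i, g i = i → ∀ j < D.N k i, Integrable (fun ω => ⟪y ω, S i j ω⟫) P ∧
      ∫ ω, ⟪y ω, S i j ω⟫ ∂P = 0 := by
    intro i hi j hj
    let a : D.Idx g := ⟨(false, k, i, j), hi, hj⟩
    have hst : a.stage = 2 * k + 1 := rfl
    have hind := hR.indep_smp_hist a
    rw [hst] at hind
    have hHm : Measurable fun p : Ξ × Space n => blk g i (D.cent P p) :=
      (blk (n := n) g i).continuous.measurable.comp hR.measurable_cent
    have hSm : Measurable (S i j) := hHm.comp ((hR.measurable_smp a).prodMk hzm')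
    have hSL : MemLp (S i j) (ENNReal.ofReal 2) P := by
      refine ⟨hSm.aestronglyMeasurable, lt_of_le_of_lt ?_ hφL⟩
      refine eLpNorm_comp_fresh_le (H := fun p => blk g i (D.cent P (p.1, p.2.1)))
        (w := fun ω => (D.pt false k ω, xs ω)) (hR.measurable_smp a)
        hR.model.measurable_ξ (hzm'.prodMk (hxs.mono (hR.hist_le _) le_rfl))
        (indep_of_indep_of_le_right hind (hzm.prodMk hxs).comap_le)
        (hR.identDistrib_smp a) two_pos (hHm.comp (measurable_fst.prodMk
          (measurable_fst.comp measurable_snd))) fun ω => ?_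
      refine le_trans (eLpNorm_mono fun ω' => ?_) (hφ ω)
      refine (norm_blk_le g i _).trans (le_of_eq ?_)
      simp [cent, hR.projX_eq (hz ω)]
    have hSi : Integrable (S i j) P := hSL.integrable (by simp)
    have hint : Integrable (fun ω => ⟪y ω, S i j ω⟫) P := MemLp.integrable_real_inner hyL hSL
    refine ⟨hint, integral_inner_eq_zero_of_condExp_eq_zero (hR.hist_le _) hy.stronglyMeasurable
      hSi hint ?_⟩
    refine condExp_comp_fresh_eq_zero (H := fun p => blk g i (D.cent P p)) (hR.hist_le _)
      (hR.measurable_smp a) hR.model.measurable_ξ hzm hind (hR.identDistrib_smp a)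
      hHm.stronglyMeasurable hSi fun ω => ?_
    rw [(blk g i).integral_comp_comm (hR.integrable_cent _), hR.integral_cent, map_zero]
  have e : ∀ ω, ⟪D.err P false k ω, y ω⟫ = ∑ i, if g i = i then ∑ j ∈ Finset.range (D.N k i),
      (D.N k i : ℝ)⁻¹ * ⟪y ω, S i j ω⟫ else 0 := by
    intro ω
    rw [hR.err_eq_sum (hz ω), sum_inner]
    refine Finset.sum_congr rfl fun i _ => ?_
    by_cases hi : g i = i
    · rw [if_pos hi, if_pos hi, sum_inner]
      refine Finset.sum_congr rfl fun j _ => ?_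
      rw [real_inner_smul_left, real_inner_comm]
    · simp [hi]
  simp only [e]
  rw [integral_finsetSum]
  · refine Finset.sum_eq_zero fun i _ => ?_
    by_cases hi : g i = i
    · simp only [if_pos hi]
      rw [integral_finsetSum _ fun j hj => (hterm i hi j (Finset.mem_range.1 hj)).1.const_mul _]
      refine Finset.sum_eq_zero fun j hj => ?_
      rw [integral_const_mul, (hterm i hi j (Finset.mem_range.1 hj)).2, mul_zero]
    · simp [hi]
  · intro i _
    by_cases hi : g i = i
    · simp only [if_pos hi]
      exact integrable_finsetSum _ fun j hj =>
        (hterm i hi j (Finset.mem_range.1 hj)).1.const_mul _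
    · simp [hi]

end Measurability

section Moments

theorem one_le_ofReal {p : ℝ} (hp : 2 ≤ p) : 1 ≤ ENNReal.ofReal p := by
  rw [← ENNReal.ofReal_one]; exact ENNReal.ofReal_le_ofReal (by linarith)

/-- The triangle inequality in `L^p` for a pointwise bound by two functions. -/
theorem eLpNorm_le_of_norm_le_add {E E' F : Type*} [NormedAddCommGroup E] [NormedAddCommGroup E']
    [NormedAddCommGroup F] {p : ℝ} (hp : 2 ≤ p)
    {f : Ω → F} {u : Ω → E} {v : Ω → E'} {a b r s : ℝ} (ha : 0 ≤ a) (hb : 0 ≤ b) (hr : 0 ≤ r)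
    (hs : 0 ≤ s)
    (hu : AEStronglyMeasurable u P) (hv : AEStronglyMeasurable v P)
    (h : ∀ ω, ‖f ω‖ ≤ a * ‖u ω‖ + b * ‖v ω‖)
    (hur : eLpNorm u (ENNReal.ofReal p) P ≤ ENNReal.ofReal r)
    (hvs : eLpNorm v (ENNReal.ofReal p) P ≤ ENNReal.ofReal s) :
    eLpNorm f (ENNReal.ofReal p) P ≤ ENNReal.ofReal (a * r + b * s) := by
  have h1 : eLpNorm (fun ω => a * ‖u ω‖) (ENNReal.ofReal p) P ≤ ENNReal.ofReal (a * r) := by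
    refine (eLpNorm_const_smul_le (c := a) (f := fun ω => ‖u ω‖)).trans ?_
    rw [eLpNorm_norm, ENNReal.ofReal_mul ha, ← ofReal_norm, Real.norm_of_nonneg ha]
    exact mul_le_mul_right hur _
  have h2 : eLpNorm (fun ω => b * ‖v ω‖) (ENNReal.ofReal p) P ≤ ENNReal.ofReal (b * s) := by
    refine (eLpNorm_const_smul_le (c := b) (f := fun ω => ‖v ω‖)).trans ?_
    rw [eLpNorm_norm, ENNReal.ofReal_mul hb, ← ofReal_norm, Real.norm_of_nonneg hb]
    exact mul_le_mul_right hvs _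
  rw [ENNReal.ofReal_add (by positivity) (by positivity)]
  refine (eLpNorm_mono_real h).trans ((eLpNorm_add_le ?_ ?_ (one_le_ofReal hp)).trans
    (add_le_add h1 h2))
  · exact hu.norm.const_mul a
  · exact hv.norm.const_mul b

theorem Admissible.memLp_succ (hA : D.Admissible g P L) {p : ℝ} {k : ℕ}
    (hx : ∀ ω, D.x k ω ∈ D.X) {xs : Ω → Space n} (hxs : Measurable[D.hist g (2 * k)] xs)
    (hxsX : ∀ ω, xs ω ∈ D.Xstar P)
    (hxL : MemLp (fun ω => D.x k ω - xs ω) (ENNReal.ofReal p) P)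
    (he1 : MemLp (D.err P true k) (ENNReal.ofReal p) P)
    (he2 : MemLp (D.err P false k) (ENNReal.ofReal p) P) :
    MemLp (fun ω => D.pt false k ω - xs ω) (ENNReal.ofReal p) P ∧
      MemLp (fun ω => D.x (k + 1) ω - xs ω) (ENNReal.ofReal p) P := by
  have hα := (hA.α_pos k).le
  have hL := hA.L_pos.le
  have hxsm : Measurable xs := hxs.mono (hA.hist_le _) le_rfl
  have hz : MemLp (fun ω => D.pt false k ω - xs ω) (ENNReal.ofReal p) P := by
    refine MemLp.mono' ((hxL.norm.const_mul (1 + L * D.α k)).add (he1.norm.const_mul (D.α k)))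
      ((hA.measurable_pt' false k).sub hxsm).aestronglyMeasurable (ae_of_all _ fun ω => ?_)
    exact hA.norm_mid_le (hx ω) (hxsX ω)
  refine ⟨hz, ?_⟩
  refine MemLp.mono' ((hxL.norm.add (he2.norm.const_mul (D.α k))).add
    (hz.norm.const_mul (L * D.α k)))
      ((hA.measurable_x (k + 1)).sub hxsm).aestronglyMeasurable (ae_of_all _ fun ω => ?_)
  exact hA.norm_succ_le (hxsX ω)

/-- The quasi-Fejér inequality in mean square. -/
theorem Admissible.eLpNorm_two_succ_le (hA : D.Admissible g P L) {k : ℕ}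
    (hx : ∀ ω, D.x k ω ∈ D.X) {xs : Ω → Space n} (hxs : Measurable[D.hist g (2 * k)] xs)
    (hxsX : ∀ ω, xs ω ∈ D.Xstar P) {d e₁ e₂ : ℝ} (hd : 0 ≤ d) (he₁ : 0 ≤ e₁) (he₂ : 0 ≤ e₂)
    (hxd : eLpNorm (fun ω => D.x k ω - xs ω) (ENNReal.ofReal 2) P ≤ ENNReal.ofReal d)
    (h1 : eLpNorm (D.err P true k) (ENNReal.ofReal 2) P ≤ ENNReal.ofReal e₁)
    (h2 : eLpNorm (D.err P false k) (ENNReal.ofReal 2) P ≤ ENNReal.ofReal e₂)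
    (h0 : MemLp (fun ω => xs ω - D.pt false k ω) (ENNReal.ofReal 2) P →
      ∫ ω, ⟪D.err P false k ω, xs ω - D.pt false k ω⟫ ∂P = 0) :
    eLpNorm (fun ω => D.x (k + 1) ω - xs ω) (ENNReal.ofReal 2) P ≤
      ENNReal.ofReal √(d ^ 2 + 3 * D.α k ^ 2 * (e₁ ^ 2 + e₂ ^ 2)) := by
  have hα := (hA.α_pos k).le
  have hxsm : Measurable xs := hxs.mono (hA.hist_le _) le_rfl
  have hxL : MemLp (fun ω => D.x k ω - xs ω) (ENNReal.ofReal 2) P :=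
    ⟨((hA.measurable_x k).sub hxsm).aestronglyMeasurable, hxd.trans_lt ENNReal.ofReal_lt_top⟩
  have hL1 : MemLp (D.err P true k) (ENNReal.ofReal 2) P :=
    ⟨(hA.measurable_err (b := true) hx).aestronglyMeasurable, h1.trans_lt ENNReal.ofReal_lt_top⟩
  have hL2 : MemLp (D.err P false k) (ENNReal.ofReal 2) P :=
    ⟨(hA.measurable_err (b := false) fun ω => (hA.isProj_mid k ω).1).aestronglyMeasurable,
      h2.trans_lt ENNReal.ofReal_lt_top⟩
  obtain ⟨hz, hx'⟩ := hA.memLp_succ hx hxs hxsX hxL hL1 hL2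
  have hz' : MemLp (fun ω => xs ω - D.pt false k ω) (ENNReal.ofReal 2) P :=
    hz.neg.ae_eq (ae_of_all _ fun ω => by simp)
  refine eLpNorm_le_of_integral_norm_sq_le hx' ?_
  have i1 := integral_norm_sq_le_of_eLpNorm_le hL1.1 he₁ h1
  have i2 := integral_norm_sq_le_of_eLpNorm_le hL2.1 he₂ h2
  have i3 := integral_norm_sq_le_of_eLpNorm_le hxL.1 hd hxd
  have n1 := MemLp.integrable_norm_sq' hL1
  have n2 := MemLp.integrable_norm_sq' hL2
  have n3 := MemLp.integrable_norm_sq' hxL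
  have n4 := MemLp.integrable_real_inner hL2 hz'
  have n5 : Integrable (fun ω =>
      3 * D.α k ^ 2 * (‖D.err P true k ω‖ ^ 2 + ‖D.err P false k ω‖ ^ 2)) P :=
    (n1.add n2).const_mul _
  have n6 : Integrable (fun ω => ‖D.x k ω - xs ω‖ ^ 2 +
      3 * D.α k ^ 2 * (‖D.err P true k ω‖ ^ 2 + ‖D.err P false k ω‖ ^ 2)) P := n3.add n5
  calc ∫ ω, ‖D.x (k + 1) ω - xs ω‖ ^ 2 ∂P
      ≤ ∫ ω, (‖D.x k ω - xs ω‖ ^ 2 +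
          3 * D.α k ^ 2 * (‖D.err P true k ω‖ ^ 2 + ‖D.err P false k ω‖ ^ 2) +
          2 * D.α k * ⟪D.err P false k ω, xs ω - D.pt false k ω⟫) ∂P :=
        integral_mono (MemLp.integrable_norm_sq' hx') (n6.add (n4.const_mul _))
          fun ω => hA.sq_step (hx ω) (hxsX ω)
    _ = ∫ ω, ‖D.x k ω - xs ω‖ ^ 2 ∂P + 3 * D.α k ^ 2 *
          (∫ ω, ‖D.err P true k ω‖ ^ 2 ∂P + ∫ ω, ‖D.err P false k ω‖ ^ 2 ∂P) := by
        rw [integral_add n6 (n4.const_mul _), integral_add n3 n5, integral_const_mul,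
          integral_const_mul,
          integral_add n1 n2, h0 hz', mul_zero, add_zero]
    _ ≤ _ := by gcongr

variable [IsProbabilityMeasure P]

/-- Under the variance control at `xs ω`, the `L^p` norms of the oracle errors and of the distance
of the intermediate point to `xs ω` are bounded in terms of that of the current iterate. -/
theorem Admissible.moment_bounds (hA : D.Admissible g P L) {p : ℝ} (hp : 2 ≤ p) {k : ℕ}
    (hx : ∀ ω, D.x k ω ∈ D.X) {xs : Ω → Space n} (hxs : Measurable[D.hist g (2 * k)] xs)
    (hxsX : ∀ ω, xs ω ∈ D.Xstar P) {s : ℝ} (hs : 0 ≤ s)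
    (hV : ∀ ω, D.VarianceBoundAt P p (xs ω) s) {d : ℝ} (hd : 0 ≤ d)
    (hxd : eLpNorm (fun ω => D.x k ω - xs ω) (ENNReal.ofReal p) P ≤ ENNReal.ofReal d) :
    eLpNorm (D.err P true k) (ENNReal.ofReal p) P ≤
      ENNReal.ofReal (bdgConst.{u} p * s * √(D.repInv g k) * (1 + d)) ∧
    eLpNorm (fun ω => D.pt false k ω - xs ω) (ENNReal.ofReal p) P ≤ ENNReal.ofReal
      ((1 + L * D.α k) * d + D.α k * (bdgConst.{u} p * s * √(D.repInv g k)) * (1 + d)) ∧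
    eLpNorm (D.err P false k) (ENNReal.ofReal p) P ≤
      ENNReal.ofReal (bdgConst.{u} p * s * √(D.repInv g k) * (1 + ((1 + L * D.α k) * d +
        D.α k * (bdgConst.{u} p * s * √(D.repInv g k)) * (1 + d)))) := by
  have hC := bdgConst_nonneg.{u} p
  have hα := (hA.α_pos k).le
  have hL := hA.L_pos.le
  have hxsm : Measurable xs := hxs.mono (hA.hist_le _) le_rfl
  have herr : ∀ (b : Bool) (hpt : ∀ ω, D.pt b k ω ∈ D.X) {r : ℝ} (hr : 0 ≤ r)
      (hr' : eLpNorm (fun ω => D.pt b k ω - xs ω) (ENNReal.ofReal p) P ≤ ENNReal.ofReal r),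
      eLpNorm (D.err P b k) (ENNReal.ofReal p) P ≤
        ENNReal.ofReal (bdgConst.{u} p * s * √(D.repInv g k) * (1 + r)) := by
    intro b hpt r hr hr'
    have h1 := hA.eLpNorm_err_le hp b k hpt hxs (fun _ => s) (fun w => 1 + ‖w.1 - w.2‖)
      (fun i ω _ => ?_) (B := 1 + r) ?_ (by positivity) fun _ => hs
    · refine h1.trans (ENNReal.ofReal_le_ofReal (le_of_eq ?_))
      have : ∑ i, (if g i = i then s ^ 2 / (D.N k i : ℝ) else 0) = s ^ 2 * D.repInv g k := by
        rw [repInv, Finset.mul_sum]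
        refine Finset.sum_congr rfl fun i _ => ?_
        split_ifs <;> ring
      rw [this, Real.sqrt_mul (sq_nonneg s), Real.sqrt_sq hs]
      ring
    · refine le_trans (eLpNorm_mono fun ω' => ?_) (hV ω _ (hpt ω))
      rw [norm_norm]
      exact norm_blk_le g i _
    · have := eLpNorm_le_of_norm_le_add (P := P) hp (f := fun ω => 1 + ‖D.pt b k ω - xs ω‖)
        (u := fun _ => (1 : ℝ)) (v := fun ω => D.pt b k ω - xs ω) zero_le_one zero_le_one
        (r := 1) zero_le_one hr aestronglyMeasurable_const
        ((hA.measurable_pt' b k).sub hxsm).aestronglyMeasurable (fun ω => by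
          rw [Real.norm_of_nonneg (by positivity)]; simp)
        ((eLpNorm_le_of_ae_bound (C := 1) (by simp)).trans (by simp)) hr'
      simpa using this
  have h1 := herr true hx hd hxd
  have h2 : eLpNorm (fun ω => D.pt false k ω - xs ω) (ENNReal.ofReal p) P ≤ ENNReal.ofReal
      ((1 + L * D.α k) * d + D.α k * (bdgConst.{u} p * s * √(D.repInv g k)) * (1 + d)) := by
    have := eLpNorm_le_of_norm_le_add (P := P) hp (by positivity) hα hd (by positivity)
      ((hA.measurable_x k).sub hxsm).aestronglyMeasurable
      (hA.measurable_err (b := true) hx).aestronglyMeasurable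
      (fun ω => hA.norm_mid_le (hx ω) (hxsX ω)) hxd h1
    refine this.trans (le_of_eq ?_)
    congr 1; ring
  exact ⟨h1, h2, herr false (fun ω => (hA.isProj_mid k ω).1) (by positivity) h2⟩

end Moments

end Data
end StochExtragradient

/-! ### Boundedness in mean square -/

namespace StochExtragradient

section Recursion

/-- A recursion of the form `δ (j + 1)² ≤ δ j² + w j (1 + δ j²)` with `∑ w ≤ b < 1`. It is carried
out with the invariant `(1 + δ j²) (1 - ∑_{i < j} w i) ≤ 1 + δ 0²`. -/
theorem sq_le_of_recursion {δ : ℕ → ℝ≥0∞} {w : ℕ → ℝ} (hw : ∀ j, 0 ≤ w j)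
    (hstep : ∀ j (d : ℝ), 0 ≤ d → δ j ≤ ENNReal.ofReal d →
      δ (j + 1) ≤ ENNReal.ofReal √(d ^ 2 + w j * (1 + d ^ 2)))
    {b : ℝ} (hb : ∀ j, ∑ i ∈ Finset.range j, w i ≤ b) (hb1 : b < 1) (j : ℕ) :
    δ j ^ 2 ≤ ENNReal.ofReal (1 - b)⁻¹ * (1 + δ 0 ^ 2) := by
  have hpos : 0 < (1 - b)⁻¹ := inv_pos.2 (by linarith)
  by_cases hfin : δ 0 = ∞
  · have h0 : ENNReal.ofReal (1 - b)⁻¹ ≠ 0 := (ENNReal.ofReal_pos.2 hpos).ne'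
    rw [hfin, show (1 : ℝ≥0∞) + ∞ ^ 2 = ∞ by simp, ENNReal.mul_top h0]
    exact le_top
  set d := (δ 0).toReal with hd
  have hd0 : 0 ≤ d := ENNReal.toReal_nonneg
  have hprod : ∃ a : ℝ, 0 ≤ a ∧ δ j ≤ ENNReal.ofReal a ∧
      (1 + a ^ 2) * (1 - ∑ i ∈ Finset.range j, w i) ≤ 1 + d ^ 2 := by
    induction j with
    | zero => exact ⟨d, hd0, (ENNReal.ofReal_toReal hfin).ge, by simp⟩
    | succ j ih =>
      obtain ⟨a, ha0, haδ, ha⟩ := ih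
      have h0 : 0 ≤ a ^ 2 + w j * (1 + a ^ 2) := by have := hw j; positivity
      refine ⟨_, Real.sqrt_nonneg _, hstep j a ha0 haδ, ?_⟩
      rw [Real.sq_sqrt h0, Finset.sum_range_succ]
      have h1 := hw j
      have h2 : 0 ≤ ∑ i ∈ Finset.range j, w i := Finset.sum_nonneg fun i _ => hw i
      have h3 : 0 ≤ (1 + a ^ 2) * (w j * (∑ i ∈ Finset.range j, w i + w j)) := by positivity
      nlinarith
  obtain ⟨a, ha0, haδ, ha⟩ := hprod
  have h1 : 1 + a ^ 2 ≤ (1 - b)⁻¹ * (1 + d ^ 2) := by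
    rw [inv_mul_eq_div, le_div_iff₀ (by linarith)]
    refine le_trans (mul_le_mul_of_nonneg_left ?_ (by positivity)) ha
    have := hb j
    linarith
  have h2 : ENNReal.ofReal (1 - b)⁻¹ * (1 + δ 0 ^ 2) =
      ENNReal.ofReal ((1 - b)⁻¹ * (1 + d ^ 2)) := by
    rw [ENNReal.ofReal_mul hpos.le, ENNReal.ofReal_add zero_le_one (by positivity),
      ENNReal.ofReal_one, ENNReal.ofReal_pow hd0, ENNReal.ofReal_toReal hfin]
  rw [h2]
  refine (pow_le_pow_left' haδ 2).trans ?_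
  rw [← ENNReal.ofReal_pow ha0]
  exact ENNReal.ofReal_le_ofReal (by linarith)

theorem lt_top_of_recursion {δ : ℕ → ℝ≥0∞}
    (hstep : ∀ j (d : ℝ), 0 ≤ d → δ j ≤ ENNReal.ofReal d → δ (j + 1) < ∞)
    (h0 : δ 0 < ∞) (j : ℕ) : δ j < ∞ := by
  induction j with
  | zero => exact h0
  | succ j ih => exact hstep j _ ENNReal.toReal_nonneg (ENNReal.ofReal_toReal ih.ne).ge

/-- The noise of one iteration in terms of `t = L α` and of the noise level `h`. -/
theorem noise_le {c t h d : ℝ} (hc : IsNoiseConst c) (ht : 0 < t) (ht' : t < 1 / √6) (hh : 0 ≤ h)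
    (hd : 0 ≤ d) :
    3 * ((h * (1 + d)) ^ 2 + (h * (1 + ((1 + t) * d + h * (1 + d)))) ^ 2) ≤
      c * h ^ 2 * (1 + h ^ 2) * (1 + d ^ 2) := by
  have h1 := mul_le_mul_of_nonneg_right (hc.2 t h ht ht' hh) (by positivity : 0 ≤ 1 + d ^ 2)
  refine le_trans ?_ h1
  have h2 : h * (1 + ((1 + t) * d + h * (1 + d))) ≤ h * ((1 + t + h) * (1 + d)) := by
    refine mul_le_mul_of_nonneg_left ?_ hh
    nlinarith
  have h3 := pow_le_pow_left₀ (by positivity) h2 2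
  have h4 : (1 + d) ^ 2 ≤ 2 * (1 + d ^ 2) := by nlinarith [sq_nonneg (1 - d)]
  have h5 : 0 ≤ h ^ 2 * (1 + (1 + t + h) ^ 2) := by positivity
  have h6 := mul_le_mul_of_nonneg_left h4 h5
  have h7 : 0 ≤ h ^ 2 * (1 + t + h) ^ 2 * (1 + d ^ 2) := by positivity
  have h8 : 0 ≤ h ^ 2 * (1 + d ^ 2) := by positivity
  nlinarith

/-- Summation of the noise over the iterations, by `∑ v² ≤ (∑ v)²`. -/
theorem sum_noise_le {c G γ : ℝ} (hc : 1 < c) (hγ : 0 ≤ γ) {v : ℕ → ℝ} (hv : ∀ j, 0 ≤ v j)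
    (j : ℕ) (hsum : ∑ i ∈ Finset.range j, v i ≤ γ) :
    ∑ i ∈ Finset.range j, c * (G ^ 2 * v i) * (1 + G ^ 2 * v i) ≤
      2 * c * G ^ 2 * γ + (2 * c * G ^ 2) ^ 2 * γ ^ 2 := by
  have h0 : 0 ≤ ∑ i ∈ Finset.range j, v i := Finset.sum_nonneg fun i _ => hv i
  have h1 : ∑ i ∈ Finset.range j, v i ^ 2 ≤ γ ^ 2 := by
    refine le_trans ?_ (pow_le_pow_left₀ h0 hsum 2)
    rw [sq (∑ i ∈ Finset.range j, v i), Finset.sum_mul]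
    refine Finset.sum_le_sum fun i hi => ?_
    rw [sq]
    exact mul_le_mul_of_nonneg_left (Finset.single_le_sum (fun i _ => hv i) hi) (hv i)
  have e : ∑ i ∈ Finset.range j, c * (G ^ 2 * v i) * (1 + G ^ 2 * v i) =
      c * G ^ 2 * ∑ i ∈ Finset.range j, v i + c * G ^ 4 * ∑ i ∈ Finset.range j, v i ^ 2 := by
    rw [Finset.mul_sum, Finset.mul_sum, ← Finset.sum_add_distrib]
    exact Finset.sum_congr rfl fun i _ => by ring
  rw [e]
  have hc0 : 0 ≤ c := by linarith
  have h2 := mul_le_mul_of_nonneg_left hsum (by positivity : 0 ≤ c * G ^ 2)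
  have h3 := mul_le_mul_of_nonneg_left h1 (by positivity : 0 ≤ c * G ^ 4)
  have h4 : 0 ≤ c * G ^ 2 * γ := by positivity
  have h5 : 0 ≤ G ^ 4 * γ ^ 2 := by positivity
  have h6 : c ≤ 4 * c ^ 2 := by nlinarith
  have h7 := mul_le_mul_of_nonneg_right h6 h5
  nlinarith

end Recursion

namespace Data

variable {m : ℕ} {n : Fin m → ℕ} {Ω : Type u} {Ξ : Type v} {D : Data n Ω Ξ} {g : Fin m → Fin m}

theorem invN_nonneg (k : ℕ) : 0 ≤ D.invN k := Finset.sum_nonneg fun i _ => by positivity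

theorem sum_range_invN_le (hsum : Summable D.invN) (k₀ j : ℕ) :
    ∑ i ∈ Finset.range j, D.invN (k₀ + i) ≤ ∑' k, D.invN (k₀ + k) := by
  have h : Summable fun k => D.invN (k₀ + k) := by
    simpa only [add_comm] using (summable_nat_add_iff k₀).2 hsum
  exact h.sum_le_tsum _ fun i _ => invN_nonneg _

variable [MeasurableSpace Ω] {P : Measure Ω}

theorem expSqDist_eq (k : ℕ) :
    D.expSqDist P k =
      eLpNorm (fun ω => Metric.infDist (D.x k ω) (D.Xstar P)) (ENNReal.ofReal 2) P ^ 2 := by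
  rw [eLpNorm_eq_lintegral_rpow_enorm_toReal (by simp) ENNReal.ofReal_ne_top,
    ENNReal.toReal_ofReal zero_le_two, ← ENNReal.rpow_two, ← ENNReal.rpow_mul]
  norm_num
  refine lintegral_congr fun ω => ?_
  rw [Real.enorm_eq_ofReal Metric.infDist_nonneg, ENNReal.ofReal_pow Metric.infDist_nonneg]

variable [MeasurableSpace Ξ] {L : ℝ}

/-- The solution set is closed and convex, hence admits a projection. -/
theorem Admissible.isProj_Xstar (hA : D.Admissible g P L) (hne : (D.Xstar P).Nonempty)
    (u : Space n) : IsProj (D.Xstar P) u (proj (D.Xstar P) u) := by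
  have hcl : IsClosed D.X := by
    have : D.X = ⋂ i, (fun x : Space n => x i) ⁻¹' D.block i := by
      ext x; simp [X]
    rw [this]
    exact isClosed_iInter fun i => (hA.model.isClosed i).preimage (by fun_prop)
  have hconv : Convex ℝ D.X := by
    intro x hx y hy a b ha hb hab i
    exact hA.model.convex i (hx i) (hy i) ha hb hab
  exact isProj_proj hne (isClosed_solutionSet hcl hA.continuousOn_T)
    (convex_solutionSet hconv hA.continuousOn_T hA.pseudoMonotone) u

theorem Admissible.αhat_pos (hA : D.Admissible g P L) : 0 < D.αhat :=
  (hA.α_pos 0).trans_le (hA.α_le 0)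

/-- The nearest solution to the current iterate. -/
theorem Admissible.measurable_nearest (hA : D.Admissible g P L) (hne : (D.Xstar P).Nonempty)
    (k : ℕ) : Measurable[D.hist g (2 * k)] fun ω => proj (D.Xstar P) (D.x k ω) :=
  (continuous_of_isProj (hA.isProj_Xstar hne)).measurable.comp (hA.measurable_hist k).1

theorem Admissible.eLpNorm_nearest (hA : D.Admissible g P L) (hne : (D.Xstar P).Nonempty)
    (k : ℕ) :
    eLpNorm (fun ω => D.x k ω - proj (D.Xstar P) (D.x k ω)) (ENNReal.ofReal 2) P =
      eLpNorm (fun ω => Metric.infDist (D.x k ω) (D.Xstar P)) (ENNReal.ofReal 2) P :=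
  eLpNorm_congr_norm_ae (ae_of_all _ fun ω => by
    rw [Real.norm_of_nonneg Metric.infDist_nonneg, (hA.isProj_Xstar hne _).infDist_eq])

theorem Admissible.eLpNorm_infDist_le (hA : D.Admissible g P L) (hne : (D.Xstar P).Nonempty)
    (k : ℕ) :
    eLpNorm (fun ω => Metric.infDist (D.x (k + 1) ω) (D.Xstar P)) (ENNReal.ofReal 2) P ≤
      eLpNorm (fun ω => D.x (k + 1) ω - proj (D.Xstar P) (D.x k ω)) (ENNReal.ofReal 2) P :=
  eLpNorm_mono fun ω => by
    rw [Real.norm_of_nonneg Metric.infDist_nonneg, ← dist_eq_norm]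
    exact Metric.infDist_le_dist_of_mem (hA.isProj_Xstar hne _).1

theorem Admissible.noise_sq_le (hA : D.Admissible g P L) {c : ℝ} (hc : IsNoiseConst c) (k : ℕ)
    {C s d : ℝ} (hC : 0 ≤ C) (hs : 0 ≤ s) (hd : 0 ≤ d) :
    3 * D.α k ^ 2 * ((C * s * √(D.repInv g k) * (1 + d)) ^ 2 +
      (C * s * √(D.repInv g k) * (1 + ((1 + L * D.α k) * d +
        D.α k * (C * s * √(D.repInv g k)) * (1 + d)))) ^ 2) ≤
      c * ((C * D.αhat * s) ^ 2 * D.invN k) * (1 + (C * D.αhat * s) ^ 2 * D.invN k) *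
        (1 + d ^ 2) := by
  have hα := (hA.α_pos k).le
  set ρ := √(D.repInv g k) with hρdef
  set h := D.α k * (C * s * ρ) with hh
  have hh0 : 0 ≤ h := by positivity
  have hn := noise_le hc (mul_pos hA.L_pos (hA.α_pos k)) (hA.mul_α_lt k) hh0 hd
  have hle : h ^ 2 ≤ (C * D.αhat * s) ^ 2 * D.invN k := by
    have e : h ^ 2 = (C * D.α k * s) ^ 2 * D.repInv g k := by
      rw [hh, ← Real.sq_sqrt (repInv_nonneg D g k)]; ring
    rw [e]
    refine mul_le_mul (pow_le_pow_left₀ (by positivity) ?_ 2) (repInv_le_invN D g k)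
      (repInv_nonneg D g k) (by positivity)
    have := hA.α_le k
    gcongr
  have hc0 : 0 ≤ c := by linarith [hc.1]
  have hmono : c * h ^ 2 * (1 + h ^ 2) * (1 + d ^ 2) ≤
      c * ((C * D.αhat * s) ^ 2 * D.invN k) * (1 + (C * D.αhat * s) ^ 2 * D.invN k) *
        (1 + d ^ 2) := by
    have hN0 := invN_nonneg (D := D) k
    gcongr
  refine le_trans (le_of_eq ?_) (hn.trans hmono)
  rw [hh]; ring

variable [IsProbabilityMeasure P]

theorem VarianceBoundAt.mono {p q : ℝ} (hpq : q ≤ p) (hR : D.Regular g P) {y : Space n} {s : ℝ}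
    (h : D.VarianceBoundAt P p y s) : D.VarianceBoundAt P q y s := fun x hx =>
  (eLpNorm_le_eLpNorm_of_exponent_le (ENNReal.ofReal_le_ofReal hpq)
    ((hR.model.integrable x hx).1.sub aestronglyMeasurable_const).norm).trans (h x hx)

/-- The bound of `Admissible.eLpNorm_two_succ_le` with the noise expressed through the variance
control. -/
theorem Admissible.two_step (hA : D.Admissible g P L) {c : ℝ} (hc : IsNoiseConst c) {k : ℕ}
    (hx : ∀ ω, D.x k ω ∈ D.X) {xs : Ω → Space n} (hxs : Measurable[D.hist g (2 * k)] xs)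
    (hxsX : ∀ ω, xs ω ∈ D.Xstar P) {s : ℝ} (hs : 0 ≤ s)
    (hV : ∀ ω, D.VarianceBoundAt P 2 (xs ω) s) {d : ℝ} (hd : 0 ≤ d)
    (hxd : eLpNorm (fun ω => D.x k ω - xs ω) (ENNReal.ofReal 2) P ≤ ENNReal.ofReal d) :
    eLpNorm (fun ω => D.x (k + 1) ω - xs ω) (ENNReal.ofReal 2) P ≤
      ENNReal.ofReal √(d ^ 2 + c * ((bdgConst.{u} 2 * D.αhat * s) ^ 2 * D.invN k) *
        (1 + (bdgConst.{u} 2 * D.αhat * s) ^ 2 * D.invN k) * (1 + d ^ 2)) := by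
  have hC := bdgConst_nonneg.{u} 2
  have hα := (hA.α_pos k).le
  have hL := hA.L_pos.le
  have hρ := Real.sqrt_nonneg (D.repInv g k)
  obtain ⟨h1, h2, h3⟩ := hA.moment_bounds le_rfl hx hxs hxsX hs hV hd hxd
  have hzm := hA.measurable_pt' false k
  have hxsm : Measurable xs := hxs.mono (hA.hist_le _) le_rfl
  have hxs' : Measurable[D.hist g (2 * k + 1)] xs :=
    hxs.mono (biSup_mono fun a ha => Nat.lt_succ_of_lt ha) le_rfl
  have key := hA.eLpNorm_two_succ_le hx hxs hxsX hd (by positivity) (by positivity) hxd h1 h3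
    fun hyL => ?_
  · exact key.trans (ENNReal.ofReal_le_ofReal (Real.sqrt_le_sqrt
      (add_le_add_right (hA.noise_sq_le hc k hC hs hd) _)))
  · -- the variance control at the nearest solution makes the second error square integrable
    refine hA.integral_inner_err_eq_zero (φ := fun w => s * (1 + ‖w.1 - w.2‖)) hxs' ?_ hyL
      (fun ω => ?_) ?_
    · exact hxs'.sub (hA.measurable_pt false k)
    · refine le_trans (eLpNorm_mono fun ω' => ?_) (hV ω _ (hA.isProj_mid k ω).1)
      rw [norm_norm]
    · refine (eLpNorm_const_smul_le (c := s)
        (f := fun ω => 1 + ‖D.pt false k ω - xs ω‖)).trans_lt ?_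
      refine ENNReal.mul_lt_top enorm_lt_top ?_
      refine (eLpNorm_add_le aestronglyMeasurable_const
        ((hzm.sub hxsm).norm).aestronglyMeasurable (by simp)).trans_lt ?_
      refine ENNReal.add_lt_top.2 ⟨?_, ?_⟩
      · exact (memLp_const (1 : ℝ)).2
      · rw [eLpNorm_norm]; exact h2.trans_lt ENNReal.ofReal_lt_top

/-- Mean square boundedness with respect to a single solution. -/
theorem Admissible.two_bound (hA : D.Admissible g P L) {c : ℝ} (hc : IsNoiseConst c)
    (hsum : Summable D.invN) {y : Space n} (hy : y ∈ D.Xstar P) {s : ℝ} (hs : 0 ≤ s)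
    (hV : D.VarianceBoundAt P 2 y s) {k₀ : ℕ} (hk₀ : D.x₀ ∈ D.X ∨ 1 ≤ k₀) {γ : ℝ} (hγ : 0 ≤ γ)
    (hb : 2 * c * (bdgConst.{u} 2 * D.αhat * s) ^ 2 * γ +
      (2 * c * (bdgConst.{u} 2 * D.αhat * s) ^ 2) ^ 2 * γ ^ 2 < 1)
    (hγs : ∑' k, D.invN (k₀ + k) ≤ γ) {k : ℕ} (hk : k₀ ≤ k) :
    eLpNorm (fun ω => D.x k ω - y) (ENNReal.ofReal 2) P ^ 2 ≤
      ENNReal.ofReal (1 - (2 * c * (bdgConst.{u} 2 * D.αhat * s) ^ 2 * γ +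
        (2 * c * (bdgConst.{u} 2 * D.αhat * s) ^ 2) ^ 2 * γ ^ 2))⁻¹ *
        (1 + eLpNorm (fun ω => D.x k₀ ω - y) (ENNReal.ofReal 2) P ^ 2) := by
  obtain ⟨j, rfl⟩ := Nat.exists_eq_add_of_le hk
  have hc0 : 0 ≤ c := by linarith [hc.1]
  refine sq_le_of_recursion (δ := fun j => eLpNorm (fun ω => D.x (k₀ + j) ω - y)
    (ENNReal.ofReal 2) P)
    (w := fun j => c * ((bdgConst.{u} 2 * D.αhat * s) ^ 2 * D.invN (k₀ + j)) *
        (1 + (bdgConst.{u} 2 * D.αhat * s) ^ 2 * D.invN (k₀ + j))) (fun j => ?_)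
    (fun j d hd h => ?_) (fun j => ?_) hb j
  · have := invN_nonneg (D := D) (k₀ + j); positivity
  · exact hA.two_step hc (hA.x_mem (hk₀.imp_right fun h => h.trans (Nat.le_add_right k₀ _)))
      measurable_const (fun _ => hy) hs (fun _ => hV) hd h
  · exact sum_noise_le hc.1 hγ (fun _ => invN_nonneg _) j ((sum_range_invN_le hsum k₀ j).trans hγs)

/-- The step from `k` to `k + 1` is compared with the solution nearest to the iterate `x^k`. -/
theorem Admissible.dist_step (hA : D.Admissible g P L) {c : ℝ} (hc : IsNoiseConst c)
    (hne : (D.Xstar P).Nonempty) {s : ℝ} (hs : 0 ≤ s)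
    (hV : ∀ y ∈ D.Xstar P, D.VarianceBoundAt P 2 y s) {k : ℕ} (hk : D.x₀ ∈ D.X ∨ 1 ≤ k)
    {d : ℝ} (hd : 0 ≤ d)
    (h : eLpNorm (fun ω => Metric.infDist (D.x k ω) (D.Xstar P)) (ENNReal.ofReal 2) P ≤
      ENNReal.ofReal d) :
    eLpNorm (fun ω => Metric.infDist (D.x (k + 1) ω) (D.Xstar P)) (ENNReal.ofReal 2) P ≤
      ENNReal.ofReal √(d ^ 2 + c * ((bdgConst.{u} 2 * D.αhat * s) ^ 2 * D.invN k) *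
        (1 + (bdgConst.{u} 2 * D.αhat * s) ^ 2 * D.invN k) * (1 + d ^ 2)) := by
  rw [← hA.eLpNorm_nearest hne] at h
  exact (hA.eLpNorm_infDist_le hne k).trans (hA.two_step hc (hA.x_mem hk)
    (hA.measurable_nearest hne k) (fun ω => (hA.isProj_Xstar hne _).1) hs
    (fun ω => hV _ (hA.isProj_Xstar hne _).1) hd h)

/-- Boundedness of the mean square distance to the solution set. -/
theorem Admissible.dist_bound (hA : D.Admissible g P L) {c : ℝ} (hc : IsNoiseConst c)
    (hsum : Summable D.invN) (hne : (D.Xstar P).Nonempty) {s : ℝ} (hs : 0 ≤ s)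
    (hV : ∀ y ∈ D.Xstar P, D.VarianceBoundAt P 2 y s) {k₀ : ℕ} (hk₀ : D.x₀ ∈ D.X ∨ 1 ≤ k₀)
    {γ : ℝ} (hγ : 0 ≤ γ) {b : ℝ} (hb : 2 * c * (bdgConst.{u} 2 * D.αhat * s) ^ 2 * γ +
      (2 * c * (bdgConst.{u} 2 * D.αhat * s) ^ 2) ^ 2 * γ ^ 2 ≤ b) (hb1 : b < 1)
    (hγs : ∑' k, D.invN (k₀ + k) ≤ γ) {k : ℕ} (hk : k₀ ≤ k) :
    D.expSqDist P k ≤ ENNReal.ofReal (1 - b)⁻¹ * (1 + D.expSqDist P k₀) := by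
  obtain ⟨j, rfl⟩ := Nat.exists_eq_add_of_le hk
  have hc0 : 0 ≤ c := by linarith [hc.1]
  rw [expSqDist_eq, expSqDist_eq]
  refine sq_le_of_recursion (δ := fun j => eLpNorm
    (fun ω => Metric.infDist (D.x (k₀ + j) ω) (D.Xstar P)) (ENNReal.ofReal 2) P)
    (w := fun j => c * ((bdgConst.{u} 2 * D.αhat * s) ^ 2 * D.invN (k₀ + j)) *
        (1 + (bdgConst.{u} 2 * D.αhat * s) ^ 2 * D.invN (k₀ + j))) (fun j => ?_)
    (fun j d hd h => ?_) (fun j => ?_) hb1 j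
  · have := invN_nonneg (D := D) (k₀ + j); positivity
  · exact hA.dist_step hc hne hs hV (hk₀.imp_right fun h => h.trans (Nat.le_add_right k₀ _)) hd h
  · exact (sum_noise_le hc.1 hγ (fun _ => invN_nonneg _) j
      ((sum_range_invN_le hsum k₀ j).trans hγs)).trans hb

theorem Admissible.expSqDist_lt_top (hA : D.Admissible g P L) {c : ℝ} (hc : IsNoiseConst c)
    (hne : (D.Xstar P).Nonempty) {s : ℝ} (hs : 0 ≤ s)
    (hV : ∀ y ∈ D.Xstar P, D.VarianceBoundAt P 2 y s) (hx₀ : D.x₀ ∈ D.X) (k : ℕ) :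
    D.expSqDist P k < ∞ := by
  rw [expSqDist_eq]
  refine ENNReal.pow_lt_top ?_
  refine lt_top_of_recursion (δ := fun j => eLpNorm
    (fun ω => Metric.infDist (D.x j ω) (D.Xstar P)) (ENNReal.ofReal 2) P)
    (fun j d hd h => (hA.dist_step hc hne hs hV (Or.inl hx₀) hd h).trans_lt ENNReal.ofReal_lt_top)
    ?_ k
  exact (memLp_const (Metric.infDist D.x₀ (D.Xstar P))).2

/-- Integrability of the iterates, which is needed before moments can be compared as real
numbers. -/
theorem Admissible.memLp_x (hA : D.Admissible g P L) {p : ℝ} (hp : 2 ≤ p) {y : Space n}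
    (hy : y ∈ D.Xstar P) {s : ℝ} (hs : 0 ≤ s) (hV : D.VarianceBoundAt P p y s) {k₀ : ℕ}
    (hk₀ : D.x₀ ∈ D.X ∨ 1 ≤ k₀)
    (h₀ : MemLp (fun ω => D.x k₀ ω - y) (ENNReal.ofReal p) P) {k : ℕ} (hk : k₀ ≤ k) :
    MemLp (fun ω => D.x k ω - y) (ENNReal.ofReal p) P := by
  induction k, hk using Nat.le_induction with
  | base => exact h₀
  | succ k hk ih =>
    have hx : ∀ ω, D.x k ω ∈ D.X := hA.x_mem (hk₀.imp_right fun h => by omega)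
    obtain ⟨h1, -, h3⟩ := hA.moment_bounds hp hx measurable_const (fun _ => hy) hs (fun _ => hV)
      ENNReal.toReal_nonneg (ENNReal.ofReal_toReal ih.2.ne).ge
    exact (hA.memLp_succ hx measurable_const (fun _ => hy) ih
      ⟨(hA.measurable_err (b := true) hx).aestronglyMeasurable, h1.trans_lt ENNReal.ofReal_lt_top⟩
      ⟨(hA.measurable_err (b := false) fun ω => (hA.isProj_mid k ω).1).aestronglyMeasurable,
        h3.trans_lt ENNReal.ofReal_lt_top⟩).2

end Data
end StochExtragradient

/-! ### Componentwise control of the variance -/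

namespace StochExtragradient
namespace Data

variable {m : ℕ} {n : Fin m → ℕ} {Ω : Type u} {Ξ : Type v} {D : Data n Ω Ξ} {g : Fin m → Fin m}

theorem norm_eq_sqrt_sum (v : Space n) :
    ‖v‖ = √(∑ a : (i : Fin m) × Fin (n i), ‖v a.1 a.2‖ ^ 2) := by
  rw [PiLp.norm_eq_of_L2, Fintype.sum_sigma]
  simp only [EuclideanSpace.norm_sq_eq]

theorem norm_blk_eq_sqrt_sum (i : Fin m) (v : Space n) :
    ‖blk g i v‖ = √(∑ a : (i : Fin m) × Fin (n i) with g a.1 = i, ‖v a.1 a.2‖ ^ 2) := by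
  rw [← Real.sqrt_sq (norm_nonneg (blk g i v)), norm_blk_sq, Finset.sum_filter, Fintype.sum_sigma]
  congr 1
  refine Finset.sum_congr rfl fun i' _ => ?_
  by_cases h : g i' = i
  · simp only [h, if_true, EuclideanSpace.norm_sq_eq]
  · simp [h]

theorem Nmin_le (k : ℕ) (i : Fin m) : D.Nmin k ≤ D.N k i := ciInf_le' _ i

theorem Nmin_pos (hN : ∀ k i, 0 < D.N k i) (i : Fin m) (k : ℕ) : 0 < D.Nmin k := by
  have : Nonempty (Fin m) := ⟨i⟩
  obtain ⟨j, hj⟩ := exists_eq_ciInf_of_finite (f := D.N k)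
  rw [Nmin, ← hj]; exact hN k j

/-- The variances of the averages over the groups of agents sum up to at most that of the whole
operator divided by the smallest sample size. -/
theorem sum_group_le (hN : ∀ k i, 0 < D.N k i) (s : (i : Fin m) → Fin (n i) → ℝ) (k : ℕ) :
    ∑ i, (if g i = i then √(∑ a : (i : Fin m) × Fin (n i) with g a.1 = i, s a.1 a.2 ^ 2) ^ 2 /
      (D.N k i : ℝ) else 0) ≤ (∑ i, ∑ l, s i l ^ 2) / (D.Nmin k : ℝ) := by
  have e : ∑ i, ∑ l, s i l ^ 2 =
      ∑ i, ∑ a : (i : Fin m) × Fin (n i) with g a.1 = i, s a.1 a.2 ^ 2 := by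
    rw [Finset.sum_fiberwise, Fintype.sum_sigma]
  rw [e, Finset.sum_div]
  refine Finset.sum_le_sum fun i _ => ?_
  have h0 : 0 ≤ ∑ a : (i : Fin m) × Fin (n i) with g a.1 = i, s a.1 a.2 ^ 2 :=
    Finset.sum_nonneg fun _ _ => sq_nonneg _
  have h1 : (0 : ℝ) < D.Nmin k := by exact_mod_cast Nmin_pos hN i k
  have h2 : (D.Nmin k : ℝ) ≤ D.N k i := by exact_mod_cast Nmin_le k i
  split_ifs
  · rw [Real.sq_sqrt h0]
    gcongr
  · positivity

variable [MeasurableSpace Ω] [MeasurableSpace Ξ] {P : Measure Ω} {L : ℝ}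

theorem aestronglyMeasurable_sub (hR : D.Regular g P) {w : Space n}
    (hw : w ∈ D.X) (i : Fin m) (l : Fin (n i)) :
    AEStronglyMeasurable (fun ω => D.F (D.ξ ω) w i l - D.T P w i l) P := by
  have h1 : Continuous fun v : Space n => v i l := by fun_prop
  exact (h1.comp_aestronglyMeasurable (hR.model.integrable w hw).1).sub aestronglyMeasurable_const

theorem UniformVarianceControl.eLpNorm_le (hR : D.Regular g P)
    {s : (i : Fin m) → Fin (n i) → ℝ} (h : D.UniformVarianceControl P 2 s) {w : Space n}
    (hw : w ∈ D.X) :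
    eLpNorm (fun ω => D.F (D.ξ ω) w - D.T P w) (ENNReal.ofReal 2) P ≤
      ENNReal.ofReal √(∑ a : (i : Fin m) × Fin (n i), s a.1 a.2 ^ 2) := by
  have h1 := eLpNorm_sqrt_sum_sq_le (μ := P) le_rfl Finset.univ
    (fun (a : (i : Fin m) × Fin (n i)) ω' => D.F (D.ξ ω') w a.1 a.2 - D.T P w a.1 a.2)
    (fun a _ => aestronglyMeasurable_sub hR hw a.1 a.2) (fun a => s a.1 a.2)
    fun a _ => h.2 a.1 a.2 w hw
  refine le_of_eq_of_le (eLpNorm_congr_norm_ae (ae_of_all _ fun ω => ?_)) h1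
  rw [Real.norm_of_nonneg (Real.sqrt_nonneg _), norm_eq_sqrt_sum]
  rfl

theorem UniformVarianceControl.eLpNorm_blk_le (hR : D.Regular g P)
    {s : (i : Fin m) → Fin (n i) → ℝ} (h : D.UniformVarianceControl P 2 s) {w : Space n}
    (hw : w ∈ D.X) (i : Fin m) :
    eLpNorm (fun ω => blk g i (D.F (D.ξ ω) w - D.T P w)) (ENNReal.ofReal 2) P ≤
      ENNReal.ofReal √(∑ a : (i : Fin m) × Fin (n i) with g a.1 = i, s a.1 a.2 ^ 2) := by
  have h1 := eLpNorm_sqrt_sum_sq_le (μ := P) le_rfl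
    (Finset.univ.filter fun a : (i : Fin m) × Fin (n i) => g a.1 = i)
    (fun (a : (i : Fin m) × Fin (n i)) ω' => D.F (D.ξ ω') w a.1 a.2 - D.T P w a.1 a.2)
    (fun a _ => aestronglyMeasurable_sub hR hw a.1 a.2) (fun a => s a.1 a.2)
    fun a _ => h.2 a.1 a.2 w hw
  refine le_of_eq_of_le (eLpNorm_congr_norm_ae (ae_of_all _ fun ω => ?_)) h1
  rw [Real.norm_of_nonneg (Real.sqrt_nonneg _), norm_blk_eq_sqrt_sum]
  rfl

variable [IsProbabilityMeasure P]

theorem UniformVarianceControl.mono {p q : ℝ} (hpq : q ≤ p) (hR : D.Regular g P)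
    {s : (i : Fin m) → Fin (n i) → ℝ} (h : D.UniformVarianceControl P p s) :
    D.UniformVarianceControl P q s := by
  exact ⟨h.1, fun i l x hx => (eLpNorm_le_eLpNorm_of_exponent_le (ENNReal.ofReal_le_ofReal hpq)
    (aestronglyMeasurable_sub hR hx i l)).trans (h.2 i l x hx)⟩

theorem Admissible.eLpNorm_err_le_of_uniform (hA : D.Admissible g P L)
    {s : (i : Fin m) → Fin (n i) → ℝ} (hV : D.UniformVarianceControl P 2 s) {k : ℕ} (b : Bool)
    (hpt : ∀ ω, D.pt b k ω ∈ D.X) :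
    eLpNorm (D.err P b k) (ENNReal.ofReal 2) P ≤
      ENNReal.ofReal (bdgConst.{u} 2 * √((∑ i, ∑ l, s i l ^ 2) / (D.Nmin k : ℝ))) := by
  have h1 := hA.eLpNorm_err_le le_rfl b k hpt (xs := fun _ => 0) measurable_const
    (fun i => √(∑ a : (i : Fin m) × Fin (n i) with g a.1 = i, s a.1 a.2 ^ 2))
    (fun _ => 1) (fun i ω _ => by
      rw [mul_one]
      exact hV.eLpNorm_blk_le hA.toRegular (hpt ω) i) (B := 1)
    ((eLpNorm_le_of_ae_bound (C := 1) (by simp)).trans (by simp)) zero_le_one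
    fun _ => Real.sqrt_nonneg _
  refine h1.trans (ENNReal.ofReal_le_ofReal ?_)
  rw [mul_one]
  exact mul_le_mul_of_nonneg_left (Real.sqrt_le_sqrt (sum_group_le hA.N_pos s k))
    (bdgConst_nonneg 2)

/-- The mean square distance to the solution set increases in one iteration by at most the variance
of the averaged operator. -/
theorem Admissible.dist_step_of_uniform (hA : D.Admissible g P L) (hne : (D.Xstar P).Nonempty)
    {s : (i : Fin m) → Fin (n i) → ℝ} (hV : D.UniformVarianceControl P 2 s) {k : ℕ}
    (hk : D.x₀ ∈ D.X ∨ 1 ≤ k) {d : ℝ} (hd : 0 ≤ d)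
    (h : eLpNorm (fun ω => Metric.infDist (D.x k ω) (D.Xstar P)) (ENNReal.ofReal 2) P ≤
      ENNReal.ofReal d) :
    eLpNorm (fun ω => Metric.infDist (D.x (k + 1) ω) (D.Xstar P)) (ENNReal.ofReal 2) P ≤
      ENNReal.ofReal √(d ^ 2 + 17 * bdgConst.{u} 2 ^ 2 * D.αhat ^ 2 *
        (∑ i, ∑ l, s i l ^ 2) / (D.Nmin k : ℝ)) := by
  rw [← hA.eLpNorm_nearest hne] at h
  have hx := hA.x_mem hk
  have hC := bdgConst_nonneg.{u} 2
  have hxs := hA.measurable_nearest hne k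
  have hxs' : Measurable[D.hist g (2 * k + 1)] fun ω => proj (D.Xstar P) (D.x k ω) :=
    hxs.mono (biSup_mono fun a ha => Nat.lt_succ_of_lt ha) le_rfl
  have hσ : 0 ≤ (∑ i, ∑ l, s i l ^ 2) / (D.Nmin k : ℝ) :=
    div_nonneg (Finset.sum_nonneg fun _ _ => Finset.sum_nonneg fun _ _ => sq_nonneg _)
      (Nat.cast_nonneg _)
  have hz : ∀ ω, D.pt false k ω ∈ D.X := fun ω => (hA.isProj_mid k ω).1
  have hconst : eLpNorm (fun _ : Ω => √(∑ a : (i : Fin m) × Fin (n i), s a.1 a.2 ^ 2))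
      (ENNReal.ofReal 2) P < ∞ := (memLp_const _).2
  have key := hA.eLpNorm_two_succ_le hx hxs (fun ω => (hA.isProj_Xstar hne _).1) hd
    (by positivity) (by positivity) h (hA.eLpNorm_err_le_of_uniform hV true hx)
    (hA.eLpNorm_err_le_of_uniform hV false hz) fun hyL =>
      hA.integral_inner_err_eq_zero
        (φ := fun _ => √(∑ a : (i : Fin m) × Fin (n i), s a.1 a.2 ^ 2)) hxs'
        (hxs'.sub (hA.measurable_pt false k)) hyL (fun ω => hV.eLpNorm_le hA.toRegular (hz ω))
        hconst
  refine (hA.eLpNorm_infDist_le hne k).trans (key.trans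
    (ENNReal.ofReal_le_ofReal (Real.sqrt_le_sqrt (add_le_add_right ?_ _))))
  generalize (∑ i, ∑ l, s i l ^ 2) = r at hσ ⊢
  have h1 : D.α k ^ 2 ≤ D.αhat ^ 2 := pow_le_pow_left₀ (hA.α_pos k).le (hA.α_le k) 2
  have h2 := mul_le_mul_of_nonneg_right h1 (mul_nonneg (sq_nonneg (bdgConst.{u} 2)) hσ)
  have h3 : 0 ≤ D.αhat ^ 2 * (bdgConst.{u} 2 ^ 2 * (r / (D.Nmin k : ℝ))) := by positivity
  rw [mul_pow, Real.sq_sqrt hσ, mul_div_assoc]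
  linarith

theorem Admissible.expSqDist_le_of_uniform (hA : D.Admissible g P L) (hne : (D.Xstar P).Nonempty)
    {p : ℝ} (hp : 2 ≤ p) {s : (i : Fin m) → Fin (n i) → ℝ} (hV : D.UniformVarianceControl P p s)
    (hx₀ : D.x₀ ∈ D.X) (hsum : Summable fun k => 1 / (D.Nmin k : ℝ)) (k : ℕ) :
    D.expSqDist P k ≤ ENNReal.ofReal (Metric.infDist D.x₀ (D.Xstar P) ^ 2 +
      ∑' k, 17 * bdgConst.{u} 2 ^ 2 * D.αhat ^ 2 * (∑ i, ∑ l, s i l ^ 2) / (D.Nmin k : ℝ)) := by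
  set w : ℕ → ℝ := fun k =>
    17 * bdgConst.{u} 2 ^ 2 * D.αhat ^ 2 * (∑ i, ∑ l, s i l ^ 2) / (D.Nmin k : ℝ) with hw
  have hw0 : ∀ k, 0 ≤ w k := fun k => by
    have : 0 ≤ ∑ i, ∑ l, s i l ^ 2 :=
      Finset.sum_nonneg fun _ _ => Finset.sum_nonneg fun _ _ => sq_nonneg _
    simp only [hw]
    positivity
  have hsw : Summable w := by
    refine (hsum.mul_left (17 * bdgConst.{u} 2 ^ 2 * D.αhat ^ 2 *
      (∑ i, ∑ l, s i l ^ 2))).congr fun k => ?_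
    simp only [hw]; ring
  have hrec : eLpNorm (fun ω => Metric.infDist (D.x k ω) (D.Xstar P)) (ENNReal.ofReal 2) P ≤
      ENNReal.ofReal √(Metric.infDist D.x₀ (D.Xstar P) ^ 2 + ∑ i ∈ Finset.range k, w i) := by
    induction k with
    | zero =>
      rw [Finset.sum_range_zero, add_zero, Real.sqrt_sq Metric.infDist_nonneg]
      exact (eLpNorm_le_of_ae_bound (C := Metric.infDist D.x₀ (D.Xstar P))
        (ae_of_all _ fun ω => (Real.norm_of_nonneg Metric.infDist_nonneg).le)).trans (by simp)
    | succ k ih =>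
      have h0 : 0 ≤ Metric.infDist D.x₀ (D.Xstar P) ^ 2 + ∑ i ∈ Finset.range k, w i :=
        add_nonneg (sq_nonneg _) (Finset.sum_nonneg fun i _ => hw0 i)
      have := hA.dist_step_of_uniform hne (hV.mono hp hA.toRegular) (Or.inl hx₀)
        (Real.sqrt_nonneg _) ih
      rwa [Real.sq_sqrt h0, add_assoc, ← Finset.sum_range_succ] at this
  rw [expSqDist_eq]
  refine (pow_le_pow_left' hrec 2).trans ?_
  rw [← ENNReal.ofReal_pow (Real.sqrt_nonneg _), Real.sq_sqrt
    (add_nonneg (sq_nonneg _) (Finset.sum_nonneg fun i _ => hw0 i))]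
  exact ENNReal.ofReal_le_ofReal (add_le_add_right (hsw.sum_le_tsum _ fun i _ => hw0 i) _)

end Data
end StochExtragradient

/-! ### Boundedness of higher moments -/

namespace StochExtragradient

/-- The distance of the intermediate point enters the martingale part both linearly and
quadratically. Here `M` bounds the distance of the iterates and `g` is the noise level of one
iteration; either `g ≤ G`, where the noise level `G` enters the constant of the bound, or `g` is
small in absolute terms and the factor `√2` pays for it. -/
theorem mid_add_sq_le {a t g G b M : ℝ} (ht : 0 ≤ t) (hta : 1 + t ≤ a) (hg : 0 ≤ g) (hG : 0 ≤ G)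
    (hM : 0 ≤ M) (hb : g ≤ G ∧ 1 ≤ b ∨ g ≤ 2 / 25 ∧ √2 ≤ b) :
    ((1 + t) * M + g * (1 + M)) + ((1 + t) * M + g * (1 + M)) ^ 2 ≤
      b * (a ^ 2 + (1 + 2 * a) * G + 2 * G ^ 2) * (1 + M + M ^ 2) := by
  have ha : 1 ≤ a := by linarith
  have h0 : (1 + t) * M + g * (1 + M) ≤ (a + g) * M + g := by nlinarith
  have h1 : 0 ≤ (1 + t) * M + g * (1 + M) := by positivity
  refine (add_le_add h0 (pow_le_pow_left₀ h1 h0 2)).trans ?_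
  have e : (a + g) * M + g + ((a + g) * M + g) ^ 2 =
      (g + g ^ 2) + (a + g + 2 * a * g + 2 * g ^ 2) * M + (a + g) ^ 2 * M ^ 2 := by ring
  rw [e]
  suffices h : ∃ r, r ≤ b * (a ^ 2 + (1 + 2 * a) * G + 2 * G ^ 2) ∧ g + g ^ 2 ≤ r ∧
      a + g + 2 * a * g + 2 * g ^ 2 ≤ r ∧ (a + g) ^ 2 ≤ r by
    obtain ⟨r, hr, r1, r2, r3⟩ := h
    have s1 := mul_le_mul_of_nonneg_right r2 hM
    have s2 := mul_le_mul_of_nonneg_right r3 (sq_nonneg M)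
    have s3 := mul_le_mul_of_nonneg_right hr (by positivity : 0 ≤ 1 + M + M ^ 2)
    nlinarith
  have ha2 : a ≤ a ^ 2 := by nlinarith
  have hag : 0 ≤ a * g := by positivity
  have hgg : 0 ≤ g ^ 2 := sq_nonneg g
  rcases hb with ⟨h2, h3⟩ | ⟨h2, h3⟩
  · refine ⟨a ^ 2 + (1 + 2 * a) * g + 2 * g ^ 2, ?_, by nlinarith, by nlinarith, by nlinarith⟩
    have h4 : a ^ 2 + (1 + 2 * a) * g + 2 * g ^ 2 ≤ a ^ 2 + (1 + 2 * a) * G + 2 * G ^ 2 := by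
      gcongr
    have h5 : 0 ≤ a ^ 2 + (1 + 2 * a) * G + 2 * G ^ 2 := by positivity
    nlinarith
  · have h4 : (1.4 : ℝ) ≤ √2 := Real.le_sqrt_of_sq_le (by norm_num)
    have h5 : 1.4 ≤ b := h4.trans h3
    have h6 : g ^ 2 ≤ 2 / 25 * g := by nlinarith
    have h7 : a * g ≤ 2 / 25 * a := by nlinarith
    refine ⟨1.4 * a ^ 2, ?_, by nlinarith, by nlinarith, by nlinarith⟩
    have h8 : 0 ≤ (1 + 2 * a) * G + 2 * G ^ 2 := by positivity
    nlinarith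

/-- Admissible constants are large, as the values `t = 2/5` and `h = 1/100` show. -/
theorem noise_const_ge {c : ℝ} (hc : IsNoiseConst c) : 81 ≤ c := by
  have h1 : (2 / 5 : ℝ) < 1 / √6 := by
    rw [lt_div_iff₀ (by positivity)]
    have : √6 < 5 / 2 := (Real.sqrt_lt' (by norm_num)).2 (by norm_num)
    linarith
  have := hc.2 (2 / 5) (1 / 100) (by norm_num) h1 (by norm_num)
  norm_num at this
  linarith

/-- Resolution of a quadratic inequality whose linear term cannot be absorbed without loss. -/
theorem sq_le_of_le_add {β d M : ℝ} (hβ : 0 ≤ β) (hβ1 : β < 1)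
    (h : M ^ 2 ≤ d ^ 2 + β * (1 + M + M ^ 2)) : M ^ 2 ≤ 4 * ((1 - β) ^ 2)⁻¹ * (1 + d ^ 2) := by
  have hε : 0 < 1 - β := by linarith
  rw [mul_assoc, mul_comm (((1 - β) ^ 2)⁻¹), ← mul_assoc, ← div_eq_mul_inv,
    le_div_iff₀ (by positivity)]
  have h1 := mul_le_mul_of_nonneg_left h hε.le
  nlinarith [sq_nonneg ((1 - β) * M - β), mul_nonneg hβ (sq_nonneg d), sq_nonneg d]

namespace Data

variable {m : ℕ} {n : Fin m → ℕ} {Ω : Type u} {Ξ : Type v} {D : Data n Ω Ξ} {g : Fin m → Fin m}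
  [MeasurableSpace Ω] [MeasurableSpace Ξ] {P : Measure Ω} {L : ℝ}

theorem Admissible.sq_le_sum (hA : D.Admissible g P L) {y : Space n} (hy : y ∈ D.Xstar P) {k₀ : ℕ}
    (hk₀ : D.x₀ ∈ D.X ∨ 1 ≤ k₀) (ω : Ω) (j : ℕ) :
    ‖D.x (k₀ + j) ω - y‖ ^ 2 ≤ ‖D.x k₀ ω - y‖ ^ 2 +
      ∑ i ∈ Finset.range j, 3 * D.α (k₀ + i) ^ 2 *
        (‖D.err P true (k₀ + i) ω‖ ^ 2 + ‖D.err P false (k₀ + i) ω‖ ^ 2) +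
      ∑ i ∈ Finset.range j, 2 * D.α (k₀ + i) *
        ⟪D.err P false (k₀ + i) ω, y - D.pt false (k₀ + i) ω⟫ := by
  induction j with
  | zero => simp
  | succ j ih =>
    rw [Finset.sum_range_succ, Finset.sum_range_succ]
    have := hA.sq_step (ω := ω)
      (hA.x_mem (k := k₀ + j) (hk₀.imp_right fun h => h.trans (Nat.le_add_right k₀ j)) ω) hy
    rw [← add_assoc k₀ j 1]
    linarith

variable [IsProbabilityMeasure P]

/-- Moments of the martingale part. The Burkholder-Davis-Gundy inequality is applied to the sum over
all samples of all iterations, in which every sample of agent `i` carries the weight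
`2 α_k / N_{k,i}`; its conditional moments are those of the noise, multiplied by the distance of the
intermediate point. -/
theorem Admissible.eLpNorm_sum_inner_le (hA : D.Admissible g P L) {p : ℝ} (hp : 4 ≤ p)
    {y : Space n} {s : ℝ} (hs : 0 ≤ s) (hV : D.VarianceBoundAt P p y s) (k₀ j : ℕ) {B γ : ℝ}
    (hB : 0 ≤ B) (hZ : ∀ k, k₀ ≤ k → k < k₀ + j → ∃ Z, 0 ≤ Z ∧
      eLpNorm (fun ω => D.pt false k ω - y) (ENNReal.ofReal p) P ≤ ENNReal.ofReal Z ∧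
      Z + Z ^ 2 ≤ B)
    (hγ : ∑ i ∈ Finset.range j, D.repInv g (k₀ + i) ≤ γ) :
    eLpNorm (fun ω => ∑ i ∈ Finset.range j, 2 * D.α (k₀ + i) *
        ⟪D.err P false (k₀ + i) ω, y - D.pt false (k₀ + i) ω⟫) (ENNReal.ofReal (p / 2)) P ≤
      ENNReal.ofReal (bdgConst.{u} (p / 2) * (2 * D.αhat * s * B * √γ)) := by
  classical
  have hα := hA.αhat_pos.le
  have hq : ENNReal.ofReal (p / 2) ≤ ENNReal.ofReal p := ENNReal.ofReal_le_ofReal (by linarith)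
  have hz : ∀ k ω, D.pt false k ω ∈ D.X := fun k ω => (hA.isProj_mid k ω).1
  -- only the second projection steps from iteration `k₀` on contribute
  set Q : D.Idx g → Prop := fun a => a.1.1 = false ∧ k₀ ≤ a.1.2.1 with hQ
  set r : ℕ → Fin m → ℝ := fun k i => 2 * D.α k * (D.N k i : ℝ)⁻¹ with hr
  have hr0 : ∀ k i, 0 ≤ r k i := fun k i => by
    have := (hA.α_pos k).le
    positivity
  set W : D.Idx g → Ω → Space n := fun a ω => if Q a then D.pt false a.1.2.1 ω else 0 with hW
  set H : D.Idx g → Ξ × Space n → ℝ := fun a w =>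
    if Q a then r a.1.2.1 a.1.2.2.1 * ⟪blk g a.1.2.2.1 (D.cent P w), y - w.2⟫ else 0 with hH
  set φ : D.Idx g → Space n → ℝ := fun a w =>
    if Q a then r a.1.2.1 a.1.2.2.1 * s * (‖w - y‖ + ‖w - y‖ ^ 2) else 0 with hφ
  have key := hA.eLpNorm_sum_smp_le (q := p / 2) (by linarith) (k₀ + j) W ?_ H ?_ ?_ φ ?_
    (fun a => if Q a then r a.1.2.1 a.1.2.2.1 * s * B else 0) ?_
  · have e1 : (fun ω => ∑ a ∈ D.idxs g (k₀ + j), H a (a.smp ω, W a ω)) =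
        fun ω => ∑ i ∈ Finset.range j, 2 * D.α (k₀ + i) *
          ⟪D.err P false (k₀ + i) ω, y - D.pt false (k₀ + i) ω⟫ := by
      funext ω
      have e2 : ∀ a : D.Idx g, H a (a.smp ω, W a ω) =
          (fun b k i j => if b = false ∧ k₀ ≤ k then r k i *
            ⟪blk g i (D.cent P (D.sample b k i j ω, D.pt false k ω)), y - D.pt false k ω⟫ else 0)
            a.1.1 a.1.2.1 a.1.2.2.1 a.1.2.2.2 := by
        intro a
        by_cases h : Q a
        · have h' : a.1.1 = false ∧ k₀ ≤ a.1.2.1 := h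
          simp only [hH, hW, if_pos h, if_pos h', Idx.smp]
        · have h' : ¬(a.1.1 = false ∧ k₀ ≤ a.1.2.1) := h
          simp only [hH, if_neg h, if_neg h']
      rw [sum_idxs (k₀ + j) (fun b k i j => if b = false ∧ k₀ ≤ k then r k i *
            ⟪blk g i (D.cent P (D.sample b k i j ω, D.pt false k ω)), y - D.pt false k ω⟫
          else 0) e2,
        Finset.sum_eq_single false (fun b' _ hb' => by simp [hb']) (by simp),
        Finset.sum_range_add, Finset.sum_eq_zero, zero_add]
      · refine Finset.sum_congr rfl fun i _ => ?_
        rw [hA.err_eq_sum (hz _ _), sum_inner, Finset.mul_sum]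
        refine Finset.sum_congr rfl fun i' _ => ?_
        by_cases h : g i' = i'
        · rw [if_pos h, if_pos h, sum_inner, Finset.mul_sum]
          refine Finset.sum_congr rfl fun j' _ => ?_
          rw [if_pos ⟨rfl, Nat.le_add_right _ _⟩, real_inner_smul_left]
          simp only [hr]; ring
        · simp [h]
      · intro k hk
        have : ¬ k₀ ≤ k := not_le.2 (Finset.mem_range.1 hk)
        simp [this]
    rw [e1] at key
    refine key.trans (ENNReal.ofReal_le_ofReal (mul_le_mul_of_nonneg_left ?_ (bdgConst_nonneg _)))
    have e3 : ∀ a : D.Idx g, (if Q a then r a.1.2.1 a.1.2.2.1 * s * B else 0) ^ 2 =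
        (fun b k i (_ : ℕ) => if b = false ∧ k₀ ≤ k then (r k i * s * B) ^ 2 else 0)
          a.1.1 a.1.2.1 a.1.2.2.1 a.1.2.2.2 := by
      intro a
      by_cases h : Q a
      · have h' : a.1.1 = false ∧ k₀ ≤ a.1.2.1 := h
        simp only [if_pos h, if_pos h']
      · have h' : ¬(a.1.1 = false ∧ k₀ ≤ a.1.2.1) := h
        simp only [if_neg h, if_neg h']
        simp
    rw [sum_idxs (k₀ + j) (fun b k i _ =>
          if b = false ∧ k₀ ≤ k then (r k i * s * B) ^ 2 else 0) e3,
        Finset.sum_eq_single false (fun b' _ hb' => by simp [hb']) (by simp),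
        Finset.sum_range_add, Finset.sum_eq_zero, zero_add]
    · have h0 : 0 ≤ 2 * D.αhat * s * B := by positivity
      rw [← Real.sqrt_sq h0, ← Real.sqrt_mul (sq_nonneg _)]
      refine Real.sqrt_le_sqrt (le_trans ?_ (mul_le_mul_of_nonneg_left hγ (sq_nonneg _)))
      rw [Finset.mul_sum]
      refine Finset.sum_le_sum fun i _ => ?_
      rw [repInv, Finset.mul_sum]
      refine Finset.sum_le_sum fun i' _ => ?_
      by_cases h : g i' = i'
      · have hN : (0 : ℝ) < D.N (k₀ + i) i' := by exact_mod_cast hA.N_pos _ _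
        have h1 := hA.α_le (k₀ + i)
        have h2 := (hA.α_pos (k₀ + i)).le
        simp only [h, if_true, true_and, Nat.le_add_right, Finset.sum_const, Finset.card_range,
          nsmul_eq_mul]
        have e4 : (D.N (k₀ + i) i' : ℝ) * (r (k₀ + i) i' * s * B) ^ 2 =
            (2 * D.α (k₀ + i) * s * B) ^ 2 * (1 / (D.N (k₀ + i) i' : ℝ)) := by
          simp only [hr]; field_simp
        rw [e4]
        gcongr
      · simp [h]
    · intro k hk
      have : ¬ k₀ ≤ k := not_le.2 (Finset.mem_range.1 hk)
      simp [this]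
  · intro a
    by_cases h : Q a
    · simp only [hW, if_pos h]
      have h1 := hA.measurable_pt false a.1.2.1
      have h2 : a.stage = 2 * a.1.2.1 + if false then 0 else 1 := by simp [Idx.stage, h.1]
      rwa [← h2] at h1
    · simp only [hW, if_neg h]
      exact measurable_const
  · intro a
    by_cases h : Q a
    · simp only [hH, if_pos h]
      have h2 := (blk (n := n) g a.1.2.2.1).continuous.measurable.comp hA.measurable_cent
      exact (h2.inner (measurable_const.sub measurable_snd)).const_mul _
    · simp only [hH, if_neg h]
      exact measurable_const
  · intro a ω
    by_cases h : Q a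
    · simp only [hH, if_pos h]
      rw [integral_const_mul]
      have h1 : ∫ ω', ⟪blk g a.1.2.2.1 (D.cent P (D.ξ ω', W a ω)), y - W a ω⟫ ∂P = 0 := by
        simp only [real_inner_comm (y - W a ω)]
        rw [integral_inner ((blk g a.1.2.2.1).integrable_comp (hA.integrable_cent _)),
          (blk g a.1.2.2.1).integral_comp_comm (hA.integrable_cent _), hA.integral_cent, map_zero,
          inner_zero_right]
      rw [h1, mul_zero]
    · simp [hH, if_neg h]
  · intro a _ ω
    by_cases h : Q a
    · simp only [hH, hW, hφ, if_pos h, cent, hA.projX_eq (hz _ ω)]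
      set z := D.pt false a.1.2.1 ω with hzdef
      have hzX : z ∈ D.X := hz _ ω
      have h1 : eLpNorm (fun ω' => ‖D.F (D.ξ ω') z - D.T P z‖) (ENNReal.ofReal (p / 2)) P ≤
          ENNReal.ofReal (s * (1 + ‖z - y‖)) :=
        (hV.mono (by linarith : p / 2 ≤ p) hA.toRegular) z hzX
      refine (eLpNorm_mono (g := fun ω' => (r a.1.2.1 a.1.2.2.1 * ‖z - y‖) •
        ‖D.F (D.ξ ω') z - D.T P z‖) fun ω' => ?_).trans
        ((eLpNorm_const_smul_le (c := r a.1.2.1 a.1.2.2.1 * ‖z - y‖)).trans ?_)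
      · have := hr0 a.1.2.1 a.1.2.2.1
        rw [norm_smul, norm_norm, norm_mul, Real.norm_of_nonneg this,
          Real.norm_of_nonneg (by positivity : 0 ≤ r a.1.2.1 a.1.2.2.1 * ‖z - y‖),
          mul_assoc (r a.1.2.1 a.1.2.2.1)]
        refine mul_le_mul_of_nonneg_left ?_ this
        refine (norm_inner_le_norm _ _).trans ?_
        rw [norm_sub_rev y z, mul_comm]
        exact mul_le_mul_of_nonneg_left (norm_blk_le g _ _) (norm_nonneg _)
      · have := hr0 a.1.2.1 a.1.2.2.1
        rw [← ofReal_norm, Real.norm_of_nonneg (by positivity)]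
        refine (mul_le_mul_right h1 _).trans ?_
        rw [← ENNReal.ofReal_mul (by positivity)]
        exact ENNReal.ofReal_le_ofReal (le_of_eq (by ring))
    · simp [hH, if_neg h]
  · intro a ha
    by_cases h : Q a
    · simp only [hφ, hW, if_pos h]
      obtain ⟨Z, hZ0, hZ1, hZB⟩ := hZ a.1.2.1 h.2 (mem_idxs.1 ha)
      have := hr0 a.1.2.1 a.1.2.2.1
      refine (eLpNorm_const_smul_le (c := r a.1.2.1 a.1.2.2.1 * s) (f := fun ω =>
        ‖D.pt false a.1.2.1 ω - y‖ + ‖D.pt false a.1.2.1 ω - y‖ ^ 2)).trans ?_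
      rw [ENNReal.ofReal_mul (by positivity), ← ofReal_norm, Real.norm_of_nonneg (by positivity)]
      refine mul_le_mul_right ?_ _
      have hm : Measurable fun ω => D.pt false a.1.2.1 ω - y :=
        (hA.measurable_pt' false _).sub_const y
      refine (eLpNorm_add_le hm.norm.aestronglyMeasurable
        (hm.norm.pow_const 2).aestronglyMeasurable (one_le_ofReal (by linarith))).trans ?_
      rw [eLpNorm_norm, eLpNorm_norm_sq (by linarith)]
      refine le_trans (add_le_add ((eLpNorm_le_eLpNorm_of_exponent_le hq
        hm.aestronglyMeasurable).trans hZ1) (pow_le_pow_left' hZ1 2)) ?_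
      rw [← ENNReal.ofReal_pow hZ0, ← ENNReal.ofReal_add hZ0 (sq_nonneg _)]
      exact ENNReal.ofReal_le_ofReal hZB
    · simp [hφ, if_neg h]

end Data
end StochExtragradient

namespace StochExtragradient
namespace Data

theorem eLpNorm_const_mul_le_ofReal {Ω : Type*} {mΩ : MeasurableSpace Ω} {μ : Measure Ω}
    {f : Ω → ℝ} {q : ℝ≥0∞} {a r : ℝ} (ha : 0 ≤ a) (h : eLpNorm f q μ ≤ ENNReal.ofReal r) :
    eLpNorm (fun ω => a * f ω) q μ ≤ ENNReal.ofReal (a * r) := by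
  refine (eLpNorm_const_smul_le (c := a) (f := f)).trans ?_
  rw [← ofReal_norm, Real.norm_of_nonneg ha, ENNReal.ofReal_mul ha]
  exact mul_le_mul_right h _

variable {m : ℕ} {n : Fin m → ℕ} {Ω : Type u} {Ξ : Type v} {D : Data n Ω Ξ} {g : Fin m → Fin m}
  [MeasurableSpace Ω] [MeasurableSpace Ξ] {P : Measure Ω} {L : ℝ}

theorem Admissible.measurable_err_of_mem (hA : D.Admissible g P L) {k : ℕ}
    (hk : D.x₀ ∈ D.X ∨ 1 ≤ k) (b : Bool) : Measurable (D.err P b k) := by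
  cases b
  · exact hA.measurable_err fun ω => (hA.isProj_mid _ ω).1
  · exact hA.measurable_err (hA.x_mem hk)

variable [IsProbabilityMeasure P]

/-- The contribution of the squared oracle errors of one iteration. -/
theorem Admissible.eLpNorm_sq_err_le (hA : D.Admissible g P L) {c : ℝ} (hc : IsNoiseConst c)
    {p : ℝ} (hp : 4 ≤ p) {y : Space n} (hy : y ∈ D.Xstar P) {s : ℝ}
    (hs : 0 ≤ s) (hV : D.VarianceBoundAt P p y s) {k : ℕ} (hk : D.x₀ ∈ D.X ∨ 1 ≤ k)
    {M : ℝ} (hM : 0 ≤ M)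
    (hle : eLpNorm (fun ω => D.x k ω - y) (ENNReal.ofReal p) P ≤ ENNReal.ofReal M) :
    eLpNorm (fun ω => 3 * D.α k ^ 2 * (‖D.err P true k ω‖ ^ 2 + ‖D.err P false k ω‖ ^ 2))
      (ENNReal.ofReal (p / 2)) P ≤
      ENNReal.ofReal (c * ((bdgConst.{u} p * D.αhat * s) ^ 2 * D.invN k) *
        (1 + (bdgConst.{u} p * D.αhat * s) ^ 2 * D.invN k) * (1 + M ^ 2)) := by
  have hC := bdgConst_nonneg.{u} p
  have hL := hA.L_pos.le
  have hα := (hA.α_pos k).le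
  have hp2 : (2 : ℝ) ≤ p := by linarith
  obtain ⟨m1, -, m2⟩ := hA.moment_bounds hp2 (hA.x_mem hk) measurable_const (fun _ => hy)
    hs (fun _ => hV) hM hle
  have h1 := eLpNorm_add_le (μ := P)
    ((hA.measurable_err_of_mem hk true).norm.pow_const 2).aestronglyMeasurable
    ((hA.measurable_err_of_mem hk false).norm.pow_const 2).aestronglyMeasurable
    (one_le_ofReal (p := p / 2) (by linarith))
  rw [eLpNorm_norm_sq (by linarith), eLpNorm_norm_sq (by linarith)] at h1
  have h2 := h1.trans (add_le_add (pow_le_pow_left' m1 2) (pow_le_pow_left' m2 2))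
  rw [← ENNReal.ofReal_pow (by positivity), ← ENNReal.ofReal_pow (by positivity),
    ← ENNReal.ofReal_add (by positivity) (by positivity)] at h2
  refine (eLpNorm_const_mul_le_ofReal (by positivity) h2).trans ?_
  exact ENNReal.ofReal_le_ofReal (hA.noise_sq_le hc k hC hs hM)

/-- The martingale part. If the groups of agents do not share one sample size, the noise of a
single iteration is controlled by the smallness of the total noise. -/
theorem Admissible.eLpNorm_martingale_le (hA : D.Admissible g P L) {c : ℝ} (hc : IsNoiseConst c)
    (hsum : Summable D.invN) {p : ℝ} (hp : 4 ≤ p) {y : Space n} (hy : y ∈ D.Xstar P) {s : ℝ}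
    (hs : 0 ≤ s) (hV : D.VarianceBoundAt P p y s) {k₀ j : ℕ} (hk₀ : D.x₀ ∈ D.X ∨ 1 ≤ k₀) {γ : ℝ}
    (hγs : ∑' k, D.invN (k₀ + k) ≤ γ) {G b : ℝ} (hG : bdgConst.{u} p * D.αhat * s ≤ G)
    (hb0 : 0 ≤ b) (hb : (1 ≤ b ∧ ∀ k, D.repInv g k ≤ 1) ∨
      (√2 ≤ b ∧ 2 * c * (bdgConst.{u} p * D.αhat * s) ^ 2 * γ ≤ 1))
    {M : ℝ} (hM : 0 ≤ M) (hle : ∀ k, k₀ ≤ k → k ≤ k₀ + j →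
      eLpNorm (fun ω => D.x k ω - y) (ENNReal.ofReal p) P ≤ ENNReal.ofReal M) :
    eLpNorm (fun ω => ∑ i ∈ Finset.range j, 2 * D.α (k₀ + i) *
        ⟪D.err P false (k₀ + i) ω, y - D.pt false (k₀ + i) ω⟫) (ENNReal.ofReal (p / 2)) P ≤
      ENNReal.ofReal (√3 * b * bdgConst.{u} (p / 2) * (bdgConst.{u} p * D.αhat * s) *
        ((1 + L * D.αhat) ^ 2 + (3 + 2 * L * D.αhat) * G + 2 * G ^ 2) * √γ *
          (1 + M + M ^ 2)) := by
  have hC := bdgConst_nonneg.{u} p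
  have hCq := bdgConst_nonneg.{u} (p / 2)
  have hC3 := two_le_sqrt_three_mul_bdgConst.{u} hp
  have hα := hA.αhat_pos.le
  have hL := hA.L_pos.le
  have hG0 : 0 ≤ G := le_trans (by positivity) hG
  have hv := fun i => invN_nonneg (D := D) (k₀ + i)
  have hp2 : (2 : ℝ) ≤ p := by linarith
  have hmart := hA.eLpNorm_sum_inner_le hp hs hV k₀ j
    (B := b * ((1 + L * D.αhat) ^ 2 + (1 + 2 * (1 + L * D.αhat)) * G + 2 * G ^ 2) *
      (1 + M + M ^ 2)) (γ := γ) (by positivity)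
    (fun k hk hkj => by
      have hα' := (hA.α_pos k).le
      have hkX : D.x₀ ∈ D.X ∨ 1 ≤ k := hk₀.imp_right fun h => h.trans hk
      refine ⟨_, by positivity, (hA.moment_bounds hp2 (hA.x_mem hkX) measurable_const
        (fun _ => hy) hs (fun _ => hV) hM (hle k hk hkj.le)).2.1, ?_⟩
      refine mid_add_sq_le (by positivity)
        (add_le_add_right (mul_le_mul_of_nonneg_left (hA.α_le _) hL) _) (by positivity) hG0 hM ?_
      have hgG : D.α k * (bdgConst.{u} p * s * √(D.repInv g k)) ≤
          bdgConst.{u} p * D.αhat * s * √(D.repInv g k) := by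
        have h1 := mul_le_mul_of_nonneg_right (hA.α_le k)
          (by positivity : 0 ≤ bdgConst.{u} p * s * √(D.repInv g k))
        refine h1.trans (le_of_eq (by ring))
      rcases hb with ⟨h1, h2⟩ | ⟨h1, h2⟩
      · refine Or.inl ⟨hgG.trans ((mul_le_of_le_one_right (by positivity) ?_).trans hG), h1⟩
        exact Real.sqrt_le_one.2 (h2 _)
      · -- the total noise is small because the constant of the noise is large
        refine Or.inr ⟨hgG.trans (abs_le_of_sq_le_sq' ?_ (by norm_num)).2, h1⟩
        have h3 : D.repInv g k ≤ γ := by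
          obtain ⟨i, rfl⟩ := Nat.exists_eq_add_of_le hk
          have hs' : Summable fun k => D.invN (k₀ + k) := by
            simpa only [add_comm] using (summable_nat_add_iff k₀).2 hsum
          exact (repInv_le_invN D g _).trans ((hs'.le_tsum i fun k _ => hv k).trans hγs)
        rw [mul_pow, Real.sq_sqrt (repInv_nonneg D g _)]
        have hγ : 0 ≤ γ := (repInv_nonneg D g k).trans h3
        have h4 := mul_le_mul_of_nonneg_left h3 (sq_nonneg (bdgConst.{u} p * D.αhat * s))
        have h5 : 0 ≤ (bdgConst.{u} p * D.αhat * s) ^ 2 * γ := by positivity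
        have h6 := mul_le_mul_of_nonneg_right (noise_const_ge hc) h5
        linarith)
    ((Finset.sum_le_sum fun i _ => repInv_le_invN D g _).trans
      ((sum_range_invN_le hsum k₀ j).trans hγs))
  refine hmart.trans (ENNReal.ofReal_le_ofReal ?_)
  have h1 := mul_le_mul_of_nonneg_right hC3 (by positivity :
    0 ≤ bdgConst.{u} (p / 2) * (D.αhat * s * (b * ((1 + L * D.αhat) ^ 2 +
      (1 + 2 * (1 + L * D.αhat)) * G + 2 * G ^ 2) * (1 + M + M ^ 2)) * √γ))
  refine le_trans (le_of_eq (by ring)) (h1.trans (le_of_eq (by ring)))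

/-- Quasi-Fejér inequality in `L^p`, summed over the iterations `k₀, …, k₀ + j - 1` over which the
distance to the solution is at most `M` in `L^p`; `r` bounds the martingale part. -/
theorem Admissible.sq_le_of_forall_le (hA : D.Admissible g P L) {c : ℝ} (hc : IsNoiseConst c)
    (hsum : Summable D.invN) {p : ℝ} (hp : 4 ≤ p) {y : Space n} (hy : y ∈ D.Xstar P) {s : ℝ}
    (hs : 0 ≤ s) (hV : D.VarianceBoundAt P p y s) {k₀ j : ℕ} (hk₀ : D.x₀ ∈ D.X ∨ 1 ≤ k₀) {γ : ℝ}
    (hγs : ∑' k, D.invN (k₀ + k) ≤ γ)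
    {M : ℝ} (hM : 0 ≤ M) (hle : ∀ k, k₀ ≤ k → k ≤ k₀ + j →
      eLpNorm (fun ω => D.x k ω - y) (ENNReal.ofReal p) P ≤ ENNReal.ofReal M)
    {d : ℝ} (hd : 0 ≤ d)
    (hd' : eLpNorm (fun ω => D.x k₀ ω - y) (ENNReal.ofReal p) P ≤ ENNReal.ofReal d)
    {r : ℝ} (hr : 0 ≤ r) (hmart : eLpNorm (fun ω => ∑ i ∈ Finset.range j, 2 * D.α (k₀ + i) *
        ⟪D.err P false (k₀ + i) ω, y - D.pt false (k₀ + i) ω⟫) (ENNReal.ofReal (p / 2)) P ≤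
      ENNReal.ofReal r) :
    eLpNorm (fun ω => D.x (k₀ + j) ω - y) (ENNReal.ofReal p) P ^ 2 ≤ ENNReal.ofReal (d ^ 2 +
      (2 * c * (bdgConst.{u} p * D.αhat * s) ^ 2 * γ +
        (2 * c * (bdgConst.{u} p * D.αhat * s) ^ 2) ^ 2 * γ ^ 2) * (1 + M ^ 2) + r) := by
  have hv := fun i => invN_nonneg (D := D) (k₀ + i)
  have hγ : 0 ≤ γ := (tsum_nonneg hv).trans hγs
  have hXk : ∀ i, D.x₀ ∈ D.X ∨ 1 ≤ k₀ + i := fun i =>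
    hk₀.imp_right fun h => h.trans (Nat.le_add_right k₀ _)
  set w : ℕ → ℝ := fun i => c * ((bdgConst.{u} p * D.αhat * s) ^ 2 * D.invN (k₀ + i)) *
    (1 + (bdgConst.{u} p * D.αhat * s) ^ 2 * D.invN (k₀ + i)) * (1 + M ^ 2) with hw
  have hw0 : ∀ i, 0 ≤ w i := fun i => by
    have h1 := hc.1
    have h2 := hv i
    positivity
  have hq1 := one_le_ofReal (p := p / 2) (by linarith)
  set N : ℕ → Ω → ℝ := fun i ω => 3 * D.α (k₀ + i) ^ 2 *
    (‖D.err P true (k₀ + i) ω‖ ^ 2 + ‖D.err P false (k₀ + i) ω‖ ^ 2) with hN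
  set I : Ω → ℝ := fun ω => ∑ i ∈ Finset.range j, 2 * D.α (k₀ + i) *
      ⟪D.err P false (k₀ + i) ω, y - D.pt false (k₀ + i) ω⟫ with hI
  have hm : Measurable fun ω => ‖D.x k₀ ω - y‖ ^ 2 :=
    (((hA.measurable_x k₀).sub_const y).norm).pow_const 2
  have hNm : ∀ i, Measurable (N i) := fun i =>
    (((hA.measurable_err_of_mem (hXk i) true).norm.pow_const 2).add
      ((hA.measurable_err_of_mem (hXk i) false).norm.pow_const 2)).const_mul _
  have hS : Measurable (∑ i ∈ Finset.range j, N i) := by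
    have := Finset.measurable_fun_sum (Finset.range j) fun i _ => hNm i
    convert this using 1
    funext ω
    exact Finset.sum_apply _ _ _
  have hIm : Measurable I :=
    Finset.measurable_fun_sum _ fun i _ => ((hA.measurable_err_of_mem (hXk i) false).inner
      (measurable_const.sub (hA.measurable_pt' false _))).const_mul _
  have t1 : eLpNorm (fun ω => ‖D.x k₀ ω - y‖ ^ 2) (ENNReal.ofReal (p / 2)) P ≤
      ENNReal.ofReal (d ^ 2) := by
    rw [eLpNorm_norm_sq (by linarith), ENNReal.ofReal_pow hd]
    exact pow_le_pow_left' hd' 2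
  have t2 : eLpNorm (∑ i ∈ Finset.range j, N i)
      (ENNReal.ofReal (p / 2)) P ≤ ENNReal.ofReal (∑ i ∈ Finset.range j, w i) := by
    rw [ENNReal.ofReal_sum_of_nonneg fun i _ => hw0 i]
    refine (eLpNorm_sum_le (fun i _ => (hNm i).aestronglyMeasurable) hq1).trans
      (Finset.sum_le_sum fun i hi => ?_)
    exact hA.eLpNorm_sq_err_le hc hp hy hs hV (hXk i) hM
      (hle _ (Nat.le_add_right _ _) (by have := Finset.mem_range.1 hi; omega))
  have h12 := (eLpNorm_add_le hm.aestronglyMeasurable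
    hS.aestronglyMeasurable hq1).trans (add_le_add t1 t2)
  have h123 := (eLpNorm_add_le (hm.add hS).aestronglyMeasurable
    hIm.aestronglyMeasurable hq1).trans (add_le_add h12 hmart)
  rw [← eLpNorm_norm_sq (by linarith)]
  refine (eLpNorm_mono_real fun ω => ?_).trans (h123.trans ?_)
  · rw [Real.norm_of_nonneg (sq_nonneg _)]
    simp only [Pi.add_apply, Finset.sum_apply]
    exact hA.sq_le_sum hy hk₀ ω j
  have hW0 : 0 ≤ ∑ i ∈ Finset.range j, w i := Finset.sum_nonneg fun i _ => hw0 i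
  rw [← ENNReal.ofReal_add (sq_nonneg _) hW0, ← ENNReal.ofReal_add (by positivity) hr]
  refine ENNReal.ofReal_le_ofReal (add_le_add (add_le_add le_rfl ?_) le_rfl)
  rw [hw, ← Finset.sum_mul]
  exact mul_le_mul_of_nonneg_right
    (sum_noise_le hc.1 hγ hv j ((sum_range_invN_le hsum k₀ j).trans hγs)) (by positivity)

/-- Boundedness in `L^p` with respect to a single solution. -/
theorem Admissible.four_bound (hA : D.Admissible g P L) {c : ℝ} (hc : IsNoiseConst c)
    (hsum : Summable D.invN) {p : ℝ} (hp : 4 ≤ p) {y : Space n} (hy : y ∈ D.Xstar P) {s : ℝ}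
    (hs : 0 ≤ s) (hV : D.VarianceBoundAt P p y s) {k₀ : ℕ} (hk₀ : D.x₀ ∈ D.X ∨ 1 ≤ k₀) {γ : ℝ}
    (hγs : ∑' k, D.invN (k₀ + k) ≤ γ) {G b : ℝ} (hG : bdgConst.{u} p * D.αhat * s ≤ G)
    (hb0 : 0 ≤ b) (hb : (1 ≤ b ∧ ∀ k, D.repInv g k ≤ 1) ∨ √2 ≤ b) {β : ℝ}
    (hβ : √3 * b * bdgConst.{u} (p / 2) * (bdgConst.{u} p * D.αhat * s) *
        ((1 + L * D.αhat) ^ 2 + (3 + 2 * L * D.αhat) * G + 2 * G ^ 2) * √γ +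
      2 * c * (bdgConst.{u} p * D.αhat * s) ^ 2 * γ +
        (2 * c * (bdgConst.{u} p * D.αhat * s) ^ 2) ^ 2 * γ ^ 2 = β) (hβ1 : β < 1)
    {k : ℕ} (hk : k₀ ≤ k) :
    eLpNorm (fun ω => D.x k ω - y) (ENNReal.ofReal p) P ^ 2 ≤
      ENNReal.ofReal (4 * ((1 - β) ^ 2)⁻¹) *
        (1 + eLpNorm (fun ω => D.x k₀ ω - y) (ENNReal.ofReal p) P ^ 2) := by
  have hC := bdgConst_nonneg.{u} p
  have hCq := bdgConst_nonneg.{u} (p / 2)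
  have hα := hA.αhat_pos.le
  have hL := hA.L_pos.le
  have hG0 : 0 ≤ G := le_trans (by positivity) hG
  have hc0 : 0 ≤ c := by linarith [hc.1]
  have hγ : 0 ≤ γ := (tsum_nonneg fun i => invN_nonneg (D := D) (k₀ + i)).trans hγs
  have hconst : 0 < 4 * ((1 - β) ^ 2)⁻¹ := by
    have : 0 < 1 - β := by linarith
    positivity
  by_cases hfin : eLpNorm (fun ω => D.x k₀ ω - y) (ENNReal.ofReal p) P = ∞
  · have h0 : ENNReal.ofReal (4 * ((1 - β) ^ 2)⁻¹) ≠ 0 := (ENNReal.ofReal_pos.2 hconst).ne'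
    rw [hfin, show (1 : ℝ≥0∞) + ∞ ^ 2 = ∞ by simp, ENNReal.mul_top h0]
    exact le_top
  obtain ⟨δ, hδ0, hδe⟩ : ∃ δ : ℕ → ℝ, (∀ k, 0 ≤ δ k) ∧ ∀ k, k₀ ≤ k →
      eLpNorm (fun ω => D.x k ω - y) (ENNReal.ofReal p) P = ENNReal.ofReal (δ k) := by
    refine ⟨fun k => (eLpNorm (fun ω => D.x k ω - y) (ENNReal.ofReal p) P).toReal,
      fun k => ENNReal.toReal_nonneg, fun k hk => ?_⟩
    refine (ENNReal.ofReal_toReal (hA.memLp_x (by linarith) hy hs hV hk₀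
      ⟨((hA.measurable_x k₀).sub_const y).aestronglyMeasurable,
        lt_top_iff_ne_top.2 hfin⟩ hk).2.ne).symm
  -- the iteration in which the largest moment is attained
  obtain ⟨K, hK, hmax⟩ := Finset.exists_max_image (Finset.Icc k₀ k) δ ⟨k, by simp [hk]⟩
  obtain ⟨hK1, hK2⟩ := Finset.mem_Icc.1 hK
  obtain ⟨j, rfl⟩ := Nat.exists_eq_add_of_le hK1
  have hle : ∀ k', k₀ ≤ k' → k' ≤ k₀ + j →
      eLpNorm (fun ω => D.x k' ω - y) (ENNReal.ofReal p) P ≤ ENNReal.ofReal (δ (k₀ + j)) :=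
    fun k' h1 h2 => by
      rw [hδe k' h1]
      exact ENNReal.ofReal_le_ofReal (hmax k' (Finset.mem_Icc.2 ⟨h1, h2.trans hK2⟩))
  generalize hβ₁ : √3 * b * bdgConst.{u} (p / 2) * (bdgConst.{u} p * D.αhat * s) *
        ((1 + L * D.αhat) ^ 2 + (3 + 2 * L * D.αhat) * G + 2 * G ^ 2) * √γ = β₁ at hβ
  have hβ₁0 : 0 ≤ β₁ := by rw [← hβ₁]; positivity
  generalize hDp : 2 * c * (bdgConst.{u} p * D.αhat * s) ^ 2 = Dp at hβ
  have hD0 : 0 ≤ Dp := by rw [← hDp]; positivity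
  have hD1 : 0 ≤ Dp * γ := by positivity
  have hD2 : 0 ≤ Dp ^ 2 * γ ^ 2 := by positivity
  have hM0 := hδ0 (k₀ + j)
  have hmart := hA.eLpNorm_martingale_le hc hsum hp hy hs hV (j := j) hk₀ hγs hG hb0
    (hb.imp id fun h => ⟨h, by rw [hDp]; linarith⟩) hM0 hle
  rw [hβ₁] at hmart
  have key := hA.sq_le_of_forall_le hc hsum hp hy hs hV (j := j) hk₀ hγs hM0 hle
    (hδ0 k₀) (hδe k₀ le_rfl).le (by positivity) hmart
  rw [hδe _ hK1, ← ENNReal.ofReal_pow (hδ0 _), hDp] at key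
  have key' := (ENNReal.ofReal_le_ofReal_iff (by positivity)).1 key
  have h1 : δ (k₀ + j) ^ 2 ≤ δ k₀ ^ 2 + β * (1 + δ (k₀ + j) + δ (k₀ + j) ^ 2) := by
    have h2 : 0 ≤ (Dp * γ + Dp ^ 2 * γ ^ 2) * δ (k₀ + j) := by positivity
    rw [← hβ]
    linarith
  have h2 := sq_le_of_le_add (by linarith) hβ1 h1
  rw [hδe k hk, hδe k₀ le_rfl, ← ENNReal.ofReal_pow (hδ0 _), ← ENNReal.ofReal_pow (hδ0 _),
    ← ENNReal.ofReal_one, ← ENNReal.ofReal_add zero_le_one (sq_nonneg _),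
    ← ENNReal.ofReal_mul hconst.le]
  refine ENNReal.ofReal_le_ofReal (le_trans ?_ h2)
  exact pow_le_pow_left₀ (hδ0 k) (hmax k (Finset.mem_Icc.2 ⟨hk, le_rfl⟩)) 2

end Data
end StochExtragradient

/-! ### Reduction to everywhere continuous operators and to groups of agents -/

namespace StochExtragradient
namespace Data

section Regularize

variable {m : ℕ} {n : Fin m → ℕ} {Ω : Type u} {Ξ : Type v} (D : Data n Ω Ξ) (S : Set Ξ)

open Classical in
/-- The data with the random operator replaced by zero on a set `S` of values of the random
variable. For a measurable null set `S` that contains all values at which the operator is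
discontinuous, this changes nothing almost surely. -/
noncomputable def regularize : Data n Ω Ξ :=
  { D with F := fun s w => if s ∈ S then 0 else D.F s w }

variable {D S}

theorem regularize_F_of_notMem {s : Ξ} (hs : s ∉ S) (w : Space n) :
    (D.regularize S).F s w = D.F s w := if_neg hs

theorem regularize_F_of_mem {s : Ξ} (hs : s ∈ S) (w : Space n) :
    (D.regularize S).F s w = 0 := if_pos hs

theorem regularize_step {k : ℕ} {s : Fin m → ℕ → Ξ} (hs : ∀ i j, j < D.N k i → s i j ∉ S)
    (x w : Space n) : (D.regularize S).step k s x w = D.step k s x w := by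
  have h : ∀ i, ∑ j ∈ Finset.range (D.N k i), (D.regularize S).F (s i j) w i =
      ∑ j ∈ Finset.range (D.N k i), D.F (s i j) w i := fun i =>
    Finset.sum_congr rfl fun j hj => by
      rw [regularize_F_of_notMem (hs i j (Finset.mem_range.1 hj))]
  have e : (D.regularize S).step k s x w = WithLp.toLp 2 fun i => proj (D.block i) (x i -
      (D.α k / D.N k i) • ∑ j ∈ Finset.range (D.N k i), (D.regularize S).F (s i j) w i) := rfl
  rw [e, step]
  simp only [h]

theorem regularize_x {ω : Ω} (hω : ∀ b k i j, j < D.N k i → D.sample b k i j ω ∉ S) (k : ℕ) :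
    (D.regularize S).x k ω = D.x k ω := by
  induction k with
  | zero => rfl
  | succ k ih =>
    have e : (D.regularize S).x (k + 1) ω = (D.regularize S).step k
        (fun i j => D.sampleη k i j ω) ((D.regularize S).x k ω) ((D.regularize S).step k
          (fun i j => D.sampleξ k i j ω) ((D.regularize S).x k ω)
          ((D.regularize S).x k ω)) := rfl
    have h1 : ∀ i j, j < D.N k i → D.sampleξ k i j ω ∉ S := hω true k
    have h2 : ∀ i j, j < D.N k i → D.sampleη k i j ω ∉ S := hω false k
    rw [e, ih, regularize_step h1, regularize_step h2]
    rfl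

variable [MeasurableSpace Ω] {P : Measure Ω}

theorem regularize_F_ae (hS : ∀ᵐ ω ∂P, D.ξ ω ∉ S) :
    ∀ᵐ ω ∂P, ∀ w, (D.regularize S).F (D.ξ ω) w = D.F (D.ξ ω) w := by
  filter_upwards [hS] with ω hω w
  exact regularize_F_of_notMem hω w

theorem regularize_T (hS : ∀ᵐ ω ∂P, D.ξ ω ∉ S) : (D.regularize S).T P = D.T P := by
  funext w
  exact integral_congr_ae ((regularize_F_ae hS).mono fun ω h => h w)

theorem regularize_Xstar (hS : ∀ᵐ ω ∂P, D.ξ ω ∉ S) : (D.regularize S).Xstar P = D.Xstar P := by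
  have : (D.regularize S).Xstar P = solutionSet ((D.regularize S).T P) D.X := rfl
  rw [this, regularize_T hS]; rfl

theorem VarianceBoundAt.regularize (hS : ∀ᵐ ω ∂P, D.ξ ω ∉ S) {p : ℝ} {y : Space n} {s : ℝ}
    (h : D.VarianceBoundAt P p y s) : (D.regularize S).VarianceBoundAt P p y s := by
  intro w hw
  rw [regularize_T hS]
  refine le_of_eq_of_le (eLpNorm_congr_ae ?_) (h w hw)
  filter_upwards [regularize_F_ae hS] with ω hω
  exact congrArg (fun v => ‖v - D.T P w‖) (hω w)

theorem UniformVarianceControl.regularize (hS : ∀ᵐ ω ∂P, D.ξ ω ∉ S) {p : ℝ}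
    {s : (i : Fin m) → Fin (n i) → ℝ} (h : D.UniformVarianceControl P p s) :
    (D.regularize S).UniformVarianceControl P p s := by
  refine ⟨h.1, fun i l w hw => ?_⟩
  rw [regularize_T hS]
  refine le_of_eq_of_le (eLpNorm_congr_ae ?_) (h.2 i l w hw)
  filter_upwards [regularize_F_ae hS] with ω hω
  exact congrArg (fun v : Space n => v i l - D.T P w i l) (hω w)

theorem regularize_expSqDist (hS : ∀ᵐ ω ∂P, D.ξ ω ∉ S)
    (hx : ∀ᵐ ω ∂P, ∀ k, (D.regularize S).x k ω = D.x k ω) (k : ℕ) :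
    (D.regularize S).expSqDist P k = D.expSqDist P k := by
  rw [expSqDist, expSqDist, regularize_Xstar hS]
  refine lintegral_congr_ae ?_
  filter_upwards [hx] with ω hω
  rw [hω k]

theorem regularize_eLpNorm (hx : ∀ᵐ ω ∂P, ∀ k, (D.regularize S).x k ω = D.x k ω) (q : ℝ≥0∞)
    (y : Space n) (k : ℕ) :
    eLpNorm (fun ω => (D.regularize S).x k ω - y) q P = eLpNorm (fun ω => D.x k ω - y) q P := by
  refine eLpNorm_congr_ae ?_
  filter_upwards [hx] with ω hω
  rw [hω k]

end Regularize

variable {m : ℕ} {n : Fin m → ℕ} {Ω : Type u} {Ξ : Type v} {D : Data n Ω Ξ}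
  {L : ℝ}

theorem StepsizeBounds.pos (h : D.StepsizeBounds L) (k : ℕ) : 0 < D.α k := by
  by_cases hb : BddBelow (Set.range D.α)
  · exact h.1.trans_le (ciInf_le hb k)
  · have := h.1
    rw [Real.iInf_of_not_bddBelow hb] at this
    exact absurd this (lt_irrefl 0)

theorem SamplingRate.summable (hm : 1 ≤ m) (h : D.SamplingRate) :
    Summable D.invN ∧ Summable fun k => 1 / (D.Nmin k : ℝ) := by
  have hpos : ∀ k, (0 : ℝ) < D.Nmin k := fun k => by exact_mod_cast Nmin_pos h.1 ⟨0, hm⟩ k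
  have h1 : ∀ k, 1 / (D.Nmin k : ℝ) ≤ D.invN k := fun k => by
    have : Nonempty (Fin m) := ⟨⟨0, hm⟩⟩
    obtain ⟨j, hj⟩ := exists_eq_ciInf_of_finite (f := D.N k)
    rw [Nmin, ← hj]
    exact Finset.single_le_sum (f := fun i => 1 / (D.N k i : ℝ)) (fun i _ => by positivity)
      (Finset.mem_univ j)
  have h2 : ∀ k, D.invN k ≤ m * (1 / (D.Nmin k : ℝ)) := fun k => by
    have h3 : D.invN k ≤ ∑ _i : Fin m, 1 / (D.Nmin k : ℝ) := Finset.sum_le_sum fun i _ => by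
      have h4 : (D.Nmin k : ℝ) ≤ D.N k i := by exact_mod_cast Nmin_le k i
      exact one_div_le_one_div_of_le (hpos k) h4
    simpa using h3
  rcases h.2 with h3 | h3
  · exact ⟨h3, h3.of_nonneg_of_le (fun k => by positivity) h1⟩
  · exact ⟨(h3.mul_left (m : ℝ)).of_nonneg_of_le (fun k => invN_nonneg k) h2, h3⟩

variable [MeasurableSpace Ω] [MeasurableSpace Ξ] {P : Measure Ω} {coord : Coordination}

/-- Agents that share their samples form a group. In the centralized case there is a single group,
in the distributed case every agent is a group of its own. -/
theorem SamplingCoordination.exists_grouping (hm : 1 ≤ m) (hN : ∀ k i, 0 < D.N k i)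
    (h : D.SamplingCoordination P coord) :
    ∃ g : Fin m → Fin m, (∀ i, g (g i) = g i) ∧ (∀ k i, D.N k (g i) = D.N k i) ∧
      (∀ b k i j, j < D.N k i → D.sample b k (g i) j = D.sample b k i j) ∧
      iIndepFun (fun a : D.Idx g => a.smp) P ∧
      ((constB m coord = 1 ∧ ∀ k, D.repInv g k ≤ 1) ∨ constB m coord = 2) := by
  have hN1 : ∀ k i, 1 / (D.N k i : ℝ) ≤ 1 := fun k i => by
    have : (1 : ℝ) ≤ D.N k i := by exact_mod_cast hN k i
    exact (div_le_one (by linarith)).2 this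
  have hc := h.coordination
  cases coord with
  | centralized =>
    obtain ⟨h1, h2, h3⟩ := hc
    set i₀ : Fin m := ⟨0, hm⟩ with hi₀
    refine ⟨fun _ => i₀, fun _ => rfl, fun k i => h1 k _ _, fun b k i j hj => ?_, ?_,
      Or.inl ⟨rfl, fun k => ?_⟩⟩
    · exact h2 b k _ _ j (by rw [h1 k i₀ i]; exact hj)
    · have hinj : Function.Injective (fun a : D.Idx (fun _ => i₀) =>
          (⟨(a.1.1, a.1.2.1, a.1.2.2.2), by have := a.2.2; rwa [← a.2.1] at this⟩ :
            {a : Bool × ℕ × ℕ // a.2.2 < D.N a.2.1 i₀})) := by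
        rintro ⟨⟨b, k, i, j⟩, hi, hj⟩ ⟨⟨b', k', i', j'⟩, hi', hj'⟩ hab
        simp only [Subtype.mk.injEq, Prod.mk.injEq] at hab hi hi' ⊢
        exact ⟨hab.1, hab.2.1, hi.symm.trans hi', hab.2.2⟩
      have h4 := (h3 i₀).precomp hinj
      have e : (fun a : D.Idx (fun _ => i₀) => a.smp) =
          fun a : D.Idx (fun _ => i₀) => D.sample a.1.1 a.1.2.1 i₀ a.1.2.2.2 := by
        funext a
        rw [Idx.smp, ← a.2.1]
      rw [e]
      exact h4
    · rw [repInv, Finset.sum_ite_eq]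
      simpa using hN1 k i₀
  | distributed =>
    refine ⟨id, fun _ => rfl, fun _ _ => rfl, fun _ _ _ _ _ => rfl, ?_, ?_⟩
    · have hinj : Function.Injective (fun a : D.Idx id => (⟨a.1, a.2.2⟩ :
          {a : Bool × ℕ × Fin m × ℕ // a.2.2.2 < D.N a.2.1 a.2.2.1})) := fun a a' haa => by
        simpa [Subtype.ext_iff] using haa
      have h4 := hc.precomp hinj
      exact h4
    · by_cases h1 : m = 1
      · refine Or.inl ⟨if_pos h1, fun k => ?_⟩
        subst h1
        simpa [repInv] using hN1 k 0
      · exact Or.inr (if_neg h1)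

/-- Under the standing assumptions, the iterates agree almost surely with those of regular data. -/
theorem Standing.exists_admissible (hm : 1 ≤ m) [IsProbabilityMeasure P]
    (hD : D.Standing P coord L) :
    ∃ (S : Set Ξ) (g : Fin m → Fin m), (D.regularize S).Admissible g P L ∧
      (∀ᵐ ω ∂P, D.ξ ω ∉ S) ∧ (∀ᵐ ω ∂P, ∀ k, (D.regularize S).x k ω = D.x k ω) ∧
      ((constB m coord = 1 ∧ ∀ k, D.repInv g k ≤ 1) ∨ constB m coord = 2) := by
  obtain ⟨S, hsub, hSm, hS0⟩ := exists_measurable_superset_of_null (ae_iff.1 hD.model.continuousOn)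
  have hSξ : ∀ᵐ ω ∂P, D.ξ ω ∉ S := by
    refine ae_iff.2 ?_
    rw [Measure.map_apply hD.model.measurable_ξ hSm] at hS0
    simp only [not_not]
    exact hS0
  have hSs : ∀ᵐ ω ∂P, ∀ b k i j, j < D.N k i → D.sample b k i j ω ∉ S := by
    simp only [ae_all_iff]
    intro b k i j hj
    refine ae_iff.2 ?_
    rw [← (hD.coordination.identDistrib b k i j hj).map_eq,
      Measure.map_apply (hD.coordination.measurable b k i j hj) hSm] at hS0
    simp only [not_not]
    exact hS0
  obtain ⟨g, g1, g2, g3, g4, g5⟩ := hD.coordination.exists_grouping hm hD.rate.1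
  have hcont : ∀ s, ContinuousOn ((D.regularize S).F s) D.X := fun s => by
    by_cases hs : s ∈ S
    · exact (continuousOn_const (c := (0 : Space n))).congr fun w _ => regularize_F_of_mem hs w
    · have h1 : ContinuousOn (D.F s) D.X := by
        by_contra h
        exact hs (hsub h)
      exact h1.congr fun w _ => regularize_F_of_notMem hs w
  refine ⟨S, g, ?_, hSξ, hSs.mono fun ω hω k => regularize_x hω k, g5⟩
  have hT := regularize_T hSξ
  obtain ⟨y, hy⟩ := hD.consistent
  have hmod : (D.regularize S).StochasticModel P :=
    { isClosed := hD.model.isClosed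
      convex := hD.model.convex
      measurable_ξ := hD.model.measurable_ξ
      continuousOn := ae_of_all _ hcont
      measurable_F := fun w hw => Measurable.ite hSm measurable_const (hD.model.measurable_F w hw)
      measurable_F_init := Measurable.ite hSm measurable_const hD.model.measurable_F_init
      integrable := fun w hw => (hD.model.integrable w hw).congr
        ((regularize_F_ae hSξ).mono fun ω h => (h w).symm) }
  have hreg : (D.regularize S).Regular g P :=
    { nonempty := ⟨y, hy.1⟩
      model := hmod
      continuousOn := hcont
      continuousOn_T := by
        rw [hT]; exact continuousOn_of_lipschitz hD.lipschitz.2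
      N_pos := hD.rate.1
      measurable := hD.coordination.measurable
      identDistrib := hD.coordination.identDistrib
      idem := g1
      N_rep := g2
      sample_rep := g3
      indep := g4 }
  exact
    { hreg with
      L_pos := hD.lipschitz.1
      lipschitz := by rw [hT]; exact hD.lipschitz.2
      pseudoMonotone := by rw [hT]; exact hD.pseudoMonotone
      α_pos := hD.stepsize.pos
      α_le := fun k => le_ciSup hD.stepsize.2.1 k
      αhat_lt := by
        have h1 := hD.stepsize.2.2
        have h6 : 0 < √6 := by positivity
        rw [lt_div_iff₀ (mul_pos h6 hD.lipschitz.1)] at h1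
        rw [lt_div_iff₀ h6]
        change L * D.αhat * √6 < 1
        linarith }

end Data
end StochExtragradient

theorem mainTheorem2 {m : ℕ} (hm : 1 ≤ m) {n : Fin m → ℕ} {Ω : Type u} {Ξ : Type v}
    [MeasurableSpace Ω] [MeasurableSpace Ξ] (P : Measure Ω) [IsProbabilityMeasure P]
    (D : StochExtragradient.Data n Ω Ξ) (coord : StochExtragradient.Coordination) (L : ℝ)
    (hD : D.Standing P coord L) (c : ℝ) (hc : StochExtragradient.IsNoiseConst c) :
    -- (i) variance control at one solution
    (∀ (p : ℝ), (p = 2 ∨ 4 ≤ p) → ∀ xs ∈ D.Xstar P, ∀ s : ℝ, 0 < s →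
      D.VarianceBoundAt P p xs s →
      (D.x₀ ∈ D.X → ∀ k, MemLp (fun ω => D.x k ω - xs) (ENNReal.ofReal p) P) ∧
      ∀ (k₀ : ℕ), (D.x₀ ∈ D.X ∨ 1 ≤ k₀) → ∀ (γ β : ℝ), 0 < γ →
        β = StochExtragradient.constβ
          (StochExtragradient.constBp.{u} p (StochExtragradient.constA m)
            (StochExtragradient.constB m coord) L D.αhat s)
          (StochExtragradient.constD.{u} p c D.αhat s) γ →
        β < 1 → (∑' k, D.invN (k₀ + k)) < γ →
        (⨆ k ≥ k₀, eLpNorm (fun ω => ‖D.x k ω - xs‖) (ENNReal.ofReal p) P ^ 2) ≤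
          ENNReal.ofReal (StochExtragradient.boundConst p β) *
            (1 + eLpNorm (fun ω => ‖D.x k₀ ω - xs‖) (ENNReal.ofReal p) P ^ 2)) ∧
    -- (ii) variance uniformly bounded over the solution set
    (∀ (p : ℝ), 2 ≤ p → ∀ (sf : D.Xstar P → ℝ≥0), D.VarianceControlOnSolutions P p sf →
      ∀ s : ℝ, 0 < s → (∀ y, (sf y : ℝ) ≤ s) →
      (D.x₀ ∈ D.X → ∀ k, D.expSqDist P k < ∞) ∧
      ∀ φ : ℝ, 0 < φ → φ < (√5 - 1) / 2 →
      ∀ (k₀ : ℕ), (D.x₀ ∈ D.X ∨ 1 ≤ k₀) →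
        (∑' k, D.invN (k₀ + k)) ≤
          φ / (2 * c * D.αhat ^ 2 * StochExtragradient.bdgConst.{u} 2 ^ 2 * s ^ 2) →
        (⨆ k ≥ k₀, D.expSqDist P k) ≤
          (1 + D.expSqDist P k₀) / ENNReal.ofReal (1 - φ - φ ^ 2)) ∧
    -- (iii) variance uniformly bounded over the feasible set
    (∀ (p : ℝ), 2 ≤ p → ∀ (s : (i : Fin m) → Fin (n i) → ℝ), D.UniformVarianceControl P p s →
      D.x₀ ∈ D.X →
        (⨆ k, D.expSqDist P k) ≤
          ENNReal.ofReal (Metric.infDist D.x₀ (D.Xstar P) ^ 2 +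
            ∑' k, 17 * StochExtragradient.bdgConst.{u} 2 ^ 2 * D.αhat ^ 2 *
              (∑ i, ∑ l, s i l ^ 2) / (D.Nmin k : ℝ))) := by
  obtain ⟨S, g, hA, hξ, hx, hg⟩ := hD.exists_admissible hm
  obtain ⟨hsum, hsum'⟩ := hD.rate.summable hm
  set D' := D.regularize S with hD'
  have hX : D'.Xstar P = D.Xstar P := StochExtragradient.Data.regularize_Xstar hξ
  have hne : (D'.Xstar P).Nonempty := hX ▸ hD.consistent
  have hN : ∀ q y k, eLpNorm (fun ω => D'.x k ω - y) q P = eLpNorm (fun ω => D.x k ω - y) q P :=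
    StochExtragradient.Data.regularize_eLpNorm hx
  have hdist : ∀ k, D'.expSqDist P k = D.expSqDist P k :=
    StochExtragradient.Data.regularize_expSqDist hξ hx
  refine ⟨fun p hp xs hxs s hs hV => ⟨fun hx₀ k => ?_, fun k₀ hk₀ γ β hγ hβ hβ1 hγs => ?_⟩,
    fun p hp sf hV s hs hsf => ⟨fun hx₀ k => ?_, fun φ hφ hφ' k₀ hk₀ hφs => ?_⟩,
    fun p hp s hV hx₀ => ?_⟩
  · have hp2 : 2 ≤ p := by rcases hp with h | h <;> linarith
    have h1 : MemLp (fun ω => D'.x k ω - xs) (ENNReal.ofReal p) P :=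
      hA.memLp_x hp2 (hX ▸ hxs) hs.le (hV.regularize hξ) (k₀ := 0) (Or.inl hx₀)
        (memLp_const (D.x₀ - xs)) (Nat.zero_le k)
    refine h1.ae_eq ?_
    filter_upwards [hx] with ω hω
    rw [hω k]
  · refine iSup₂_le fun k hk => ?_
    rw [eLpNorm_norm, eLpNorm_norm, ← hN, ← hN]
    have hy : xs ∈ D'.Xstar P := hX ▸ hxs
    rcases eq_or_ne p 2 with rfl | hp2
    · have e : 2 * c * (StochExtragradient.bdgConst.{u} 2 * D'.αhat * s) ^ 2 * γ +
          (2 * c * (StochExtragradient.bdgConst.{u} 2 * D'.αhat * s) ^ 2) ^ 2 * γ ^ 2 = β := by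
        rw [hβ, StochExtragradient.constβ, StochExtragradient.constBp, if_pos rfl,
          StochExtragradient.constD, show D'.αhat = D.αhat from rfl]
        ring
      have key := hA.two_bound hc hsum hy hs.le (hV.regularize hξ) hk₀ hγ.le (by rw [e]; exact hβ1)
        hγs.le hk
      rw [e] at key
      rwa [StochExtragradient.boundConst, if_pos rfl]
    · have hp4 : 4 ≤ p := hp.resolve_left hp2
      have hGA : √(StochExtragradient.constA m) ^ 2 = StochExtragradient.constA m :=
        Real.sq_sqrt (by unfold StochExtragradient.constA; split_ifs <;> norm_num)
      have hA1 : 1 ≤ √(StochExtragradient.constA m) := Real.one_le_sqrt.2 (by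
        unfold StochExtragradient.constA; split_ifs <;> norm_num)
      have hG0 : 0 ≤ StochExtragradient.bdgConst.{u} p * D'.αhat * s :=
        mul_nonneg (mul_nonneg (StochExtragradient.bdgConst_nonneg p) hA.αhat_pos.le) hs.le
      rw [StochExtragradient.boundConst, if_neg hp2]
      refine hA.four_bound hc hsum hp4 hy hs.le (hV.regularize hξ) hk₀ hγs.le
        (G := √(StochExtragradient.constA m) * (StochExtragradient.bdgConst.{u} p * D'.αhat * s))
        (b := √(StochExtragradient.constB m coord)) (le_mul_of_one_le_left hG0 hA1)
        (Real.sqrt_nonneg _) ?_ ?_ hβ1 hk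
      · -- with several independent groups the factor `√2` is available, otherwise each iteration
        -- has at most the noise of a single sample
        rcases hg with ⟨h1, h2⟩ | h1
        · exact Or.inl ⟨by rw [h1, Real.sqrt_one], h2⟩
        · exact Or.inr (by rw [h1])
      · rw [hβ, StochExtragradient.constβ, StochExtragradient.constBp, if_neg hp2,
          StochExtragradient.constD, show D'.αhat = D.αhat from rfl,
          Real.sqrt_mul (by norm_num : (0 : ℝ) ≤ 3), mul_pow, hGA]
        ring
  · have hV' : ∀ y ∈ D'.Xstar P, D'.VarianceBoundAt P 2 y s := fun y hy =>
      (StochExtragradient.Data.VarianceBoundAt.regularize hξ fun w hw =>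
        (hV.bound ⟨y, hX ▸ hy⟩ w hw).trans (ENNReal.ofReal_le_ofReal
          (mul_le_mul_of_nonneg_right (hsf _) (by positivity)))).mono hp hA.toRegular
    rw [← hdist]
    exact hA.expSqDist_lt_top hc hne hs.le hV' hx₀ k
  · have hV' : ∀ y ∈ D'.Xstar P, D'.VarianceBoundAt P 2 y s := fun y hy =>
      (StochExtragradient.Data.VarianceBoundAt.regularize hξ fun w hw =>
        (hV.bound ⟨y, hX ▸ hy⟩ w hw).trans (ENNReal.ofReal_le_ofReal
          (mul_le_mul_of_nonneg_right (hsf _) (by positivity)))).mono hp hA.toRegular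
    have hφ1 : φ + φ ^ 2 < 1 := by
      have h5 : √5 ^ 2 = 5 := Real.sq_sqrt (by norm_num)
      nlinarith [Real.sqrt_nonneg 5]
    refine iSup₂_le fun k hk => ?_
    rw [← hdist, ← hdist]
    have hc0 : 0 ≤ c := by linarith [hc.1]
    have e : 2 * c * D.αhat ^ 2 * StochExtragradient.bdgConst.{u} 2 ^ 2 * s ^ 2 =
        2 * c * (StochExtragradient.bdgConst.{u} 2 * D'.αhat * s) ^ 2 := by
      rw [show D'.αhat = D.αhat from rfl]; ring
    rw [e] at hφs
    have hD0 : 0 ≤ 2 * c * (StochExtragradient.bdgConst.{u} 2 * D'.αhat * s) ^ 2 := by positivity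
    -- if the denominator vanishes, then so does the quotient, and all bounds remain valid
    have hφ2 : 2 * c * (StochExtragradient.bdgConst.{u} 2 * D'.αhat * s) ^ 2 *
        (φ / (2 * c * (StochExtragradient.bdgConst.{u} 2 * D'.αhat * s) ^ 2)) ≤ φ := by
      rcases hD0.eq_or_lt with h | h
      · rw [← h, zero_mul]; exact hφ.le
      · rw [mul_div_cancel₀ _ h.ne']
    have key := hA.dist_bound hc hsum hne hs.le hV' hk₀ (div_nonneg hφ.le hD0) (b := φ + φ ^ 2)
      (add_le_add hφ2 (by
        rw [← mul_pow]
        exact pow_le_pow_left₀ (mul_nonneg hD0 (div_nonneg hφ.le hD0)) hφ2 2)) hφ1 hφs hk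
    rwa [ENNReal.ofReal_inv_of_pos (by linarith), mul_comm, ← div_eq_mul_inv,
      ← sub_sub] at key
  · refine iSup_le fun k => ?_
    rw [← hdist, ← hX]
    exact hA.expSqDist_le_of_uniform hne hp (hV.regularize hξ) hx₀ hsum' k
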